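/- **Setting.** Let $d\ge 1$, $S>0$, and let $\mathcal X\subset\mathbb R^d$ be a compact set contained in the interior of $[-S,S]^d$. Let $\mathbb 1\in C^\infty(\mathbb R^d)$ take values in $[0,1]$, with $\mathbb 1=1$ on $\mathcal X$ and $\mathbb 1=0$ outside $[-S,S]^d$. On $\mathbb R^m$ write $\widehat f(\xi)=(2\pi)^{-m/2}\int f(x)e^{-i\xi\cdot x}\,dx$. *Activation function.* Let $\mathcal S_m(\mathbb R)$ be the set of Schwartz functions $f$ with $f(x)=O(|x|^m)$ as $x\to0$. A function $\widehat t\in L^2_{\rm loc}(\mathbb R\setminus\{0\})$ is a generalised Fourier transform, of order $m\in\mathbb N_0$, of a continuous function $t:\mathbb R\to\mathbb R$ of polynomial growth if $\int\widehat t f=\int t\widehat f$ for all $f\in\mathcal S_{2m}(\mathbb R)$, the left-hand integrals being absolutely convergent. Let $C_1^*(\mathbb R)$ be the set of continuous $t:\mathbb R\to\mathbb R$ with $\sup_x|t(x)|/(1+|x|)<\infty$ that admit a generalised Fourier transform. Let $\phi\in C_1^*(\mathbb R)$ be Lipschitz continuous, let $\widehat\phi$ be a generalised Fourier transform of $\phi$,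 and let $\psi:\mathbb R\to\mathbb R$ be a Schwartz function with $$(2\pi)^{d/2}\int_{\mathbb R}|\xi|^{-d}\,\overline{\widehat\psi(\xi)}\,\widehat\phi(\xi)\,d\xi=1,\qquad \int_{\mathbb R}|\xi|^{-d-2}\big|\overline{\widehat\psi(\xi)}\,\widehat\phi(\xi)\big|\,d\xi<\infty,$$ and such that $\widehat\psi\in\mathcal S_{2m}(\mathbb R)$ for some $m$ for which $\widehat\phi$ is a generalised Fourier transform of $\phi$ of order $m$. *Densities.* Let $p_w:\mathbb R^d\to[0,\infty)$ and $p_b:\mathbb R\to[0,\infty)$ be probability densities, each symmetric about the origin, essentially bounded, with finite second moment, and with everywhere positive, integrable Fourier transform. Suppose also that $\int\|x\|^2\,\widehat{p_w}(x)\,dx<\infty$ and that $p_b$ is differentiable with essentially bounded derivative. For $\sigma_w,\sigma_b>0$ put $p_{w,\sigma}(w)=\sigma_w^{-d}p_w(w/\sigma_w)$, $p_{b,\sigma}(b)=\sigma_b^{-1}p_b(b/\sigma_b)$ and $Z=(2\pi)^{1/2}\sigma_w^d\sigma_b\,\|\widehat{p_w}\|_{L^1}^{-1}\|\widehat{p_b}\|_{L^1}^{-1}$.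 *Discretised operator.* For $D=n^d$ with $n\ge1$, let $x_1,\dots,x_D$ be the points of the grid $\{-S+2Sk/n: k=0,\dots,n-1\}^d$ and $u_j=(2S)^dD^{-1}\mathbb 1(x_j)$. For $N\ge1$ let $(w_i,b_i)$, $i=1,\dots,N$, be independent random variables with density $p_{w,\sigma}\times p_{b,\sigma}$ and $v_i=Z/N$. Define $$I_{\sigma,D,N}f(x)=\sum_{i=1}^N v_i\Big(\sum_{j=1}^D u_j f(x_j)\psi(w_i\cdot x_j+b_i)\Big)\phi(w_i\cdot x+b_i).$$ For $f\in C^1(\mathbb R^d)$ let $M_1^*(f)=\max_{|\alpha|\le1}\sup_{x\in[-S,S]^d}|\partial^\alpha f(x)|$. **Theorem.** There is a constant $C$, which may depend on $d,S,\mathcal X,\mathbb 1,\phi,\widehat\phi,\psi,p_w,p_b$ but not on $f,\sigma_w,\sigma_b,\delta,D,N$, such that for every $f\in C^1(\mathbb R^d)$ with $M_1^*(f)<\infty$, all $\sigma_w,\sigma_b,\delta>0$, all $D=n^d$ with $n\ge1$ and all $N\ge1$, with probability at least $1-\delta$ with respect to $(w_i,b_i)_{i=1}^N$, $$\sup_{x\in\mathcal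 X}|f(x)-I_{\sigma,D,N}f(x)|\le C\,M_1^*(f)\Big\{\frac1{\sigma_w}+\frac{\sigma_w^d(\sigma_w+1)^2}{\sigma_b}+\frac{\sigma_b(\sigma_b+1)\sigma_w^d(\sigma_w+1)^2}{D^{1/d}}+\frac{\sigma_b\sigma_w^{d+1}}{\delta\sqrt N}\Big\}.$$ -/

import Mathlib

open MeasureTheory ProbabilityTheory Set Asymptotics
open scoped SchwartzMap ENNReal Topology

noncomputable section

namespace Ridgelet

/-- `ℝᵈ` with the Euclidean norm. -/
abbrev E (d : ℕ) : Type := EuclideanSpace ℝ (Fin d)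

section Fourier

variable {V : Type*} [NormedAddCommGroup V] [InnerProductSpace ℝ V] [MeasurableSpace V]
  [BorelSpace V] [FiniteDimensional ℝ V]

/-- The unitary Fourier transform
`f̂(ξ) = (2π)^{-d/2} ∫ f(x) exp(-i ξ·x) dx` on a `d`-dimensional Euclidean space. -/
def fourier (f : V → ℂ) (ξ : V) : ℂ :=
  (((2 * Real.pi) ^ (-(Module.finrank ℝ V : ℝ) / 2) : ℝ) : ℂ) *
    ∫ x, f x * Complex.exp (-Complex.I * ((inner ℝ ξ x : ℝ) : ℂ))

/-- The Fourier transform of a real-valued function. -/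
def fourierReal (f : V → ℝ) : V → ℂ := fourier (fun x => (f x : ℂ))

/-- `f(x) = O(‖x‖ᵐ)` as `x → 0`; the Schwartz functions with this property form `𝒮ₘ`. -/
def VanishesToOrder (m : ℕ) (f : V → ℂ) : Prop :=
  f =O[𝓝 0] fun x => ‖x‖ ^ m

/-- `that ∈ L²_loc(V ∖ {0})` is a generalised Fourier transform of `t`, of order `m`:
`∫ that f = ∫ t f̂` for all `f ∈ 𝒮₂ₘ`. The left-hand integrals are required to exist. -/
structure IsGenFourier (m : ℕ) (t : V → ℝ) (that : V → ℂ) : Prop where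
  memLp_two_loc : ∀ K : Set V, IsCompact K → K ⊆ {0}ᶜ → MemLp that 2 (volume.restrict K)
  integrable : ∀ f : 𝓢(V, ℂ), VanishesToOrder (2 * m) f → Integrable fun w => that w * f w
  integral_eq : ∀ f : 𝓢(V, ℂ), VanishesToOrder (2 * m) f →
    ∫ w, that w * f w = ∫ x, (t x : ℂ) * fourier f x

/-- `C_k^*(V)`: the continuous functions of at most polynomial growth of order `k` that admit a
generalised Fourier transform. -/
def CStar (V : Type*) [NormedAddCommGroup V] [InnerProductSpace ℝ V] [MeasurableSpace V]
    [BorelSpace V] [FiniteDimensional ℝ V] (k : ℕ) : Set (V → ℝ) :=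
  {t | Continuous t ∧ (∃ c : ℝ, ∀ x, |t x| ≤ c * (1 + ‖x‖ ^ k)) ∧
    ∃ (that : V → ℂ) (m : ℕ), IsGenFourier m t that}

/-- A probability density with properties (i)-(v): symmetry, boundedness, finite second moment,
positive Fourier transform, integrable Fourier transform. -/
structure IsRegularDensity (p : V → ℝ) : Prop where
  nonneg : ∀ x, 0 ≤ p x
  integrable : Integrable p
  integral_eq_one : ∫ x, p x = 1
  symm : ∀ x, p x = p (-x)
  bounded : MemLp p ∞ volume
  second_moment : Integrable fun x => ‖x‖ ^ 2 * p x
  fourier_pos : ∀ ξ, (fourierReal p ξ).im = 0 ∧ 0 < (fourierReal p ξ).re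
  fourier_integrable : Integrable (fourierReal p)

/-- The scaled density `σ^{-d} p(σ⁻¹ x)`. -/
def scaledDensity (σ : ℝ) (p : V → ℝ) (x : V) : ℝ :=
  (σ ^ Module.finrank ℝ V)⁻¹ * p (σ⁻¹ • x)

/-- The probability measure with density `scaledDensity σ p`. -/
def scaledLaw (σ : ℝ) (p : V → ℝ) : Measure V :=
  volume.withDensity fun x => ENNReal.ofReal (scaledDensity σ p x)

instance (σ : ℝ) (p : V → ℝ) : SFinite (scaledLaw σ p) := by
  unfold scaledLaw; infer_instance

end Fourier

variable {d : ℕ}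

/-- The assumptions on the activation function `φ ∈ C_1^*(ℝ)`, its generalised Fourier transform
`φhat`, and the Schwartz function `ψ` defining the ridgelet transform on `ℝᵈ`.
The generalised Fourier transform of `φ` only tests against functions vanishing to order `2m` at
the origin; `order` says that `ψ̂` is such a function. -/
structure IsRidgeletPair (d : ℕ) (φ : ℝ → ℝ) (φhat : ℝ → ℂ) (ψ : 𝓢(ℝ, ℝ)) : Prop where
  mem_CStar : φ ∈ CStar ℝ 1
  order : ∃ m : ℕ, IsGenFourier m φ φhat ∧ VanishesToOrder (2 * m) (fourierReal ψ)
  normalised : (((2 * Real.pi) ^ ((d : ℝ) / 2) : ℝ) : ℂ) *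
    ∫ ξ : ℝ, ((|ξ| ^ d)⁻¹ : ℝ) * (starRingEnd ℂ (fourierReal ψ ξ) * φhat ξ) = 1
  integrable : Integrable fun ξ : ℝ =>
    (|ξ| ^ (d + 2))⁻¹ * ‖starRingEnd ℂ (fourierReal ψ ξ) * φhat ξ‖

/-- The finite bandwidth assumption on the densities `p_w` and `p_b`. -/
structure IsFiniteBandwidth (pw : E d → ℝ) (pb : ℝ → ℝ) : Prop where
  regular_w : IsRegularDensity pw
  regular_b : IsRegularDensity pb
  fourier_second_moment : Integrable fun x => (‖x‖ ^ 2 : ℝ) * (fourierReal pw x).re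
  differentiable_b : Differentiable ℝ pb
  deriv_bounded : MemLp (deriv pb) ∞ volume

/-- The hyper-cube `[-S,S]ᵈ`. -/
def cube (d : ℕ) (S : ℝ) : Set (E d) := {x | ∀ i, x i ∈ Icc (-S) S}

/-- A mollifier: a smooth function with values in `[0,1]` that is `1` on `𝒳` and `0` off the
cube. -/
structure IsMollifier (S : ℝ) (𝒳 : Set (E d)) (χ : E d → ℝ) : Prop where
  smooth : ContDiff ℝ (⊤ : ℕ∞) χ
  mem_Icc : ∀ x, χ x ∈ Icc (0 : ℝ) 1
  eq_one : ∀ x ∈ 𝒳, χ x = 1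
  eq_zero : ∀ x ∉ cube d S, χ x = 0

/-- `M_1^*(f) = max_{|α| ≤ 1} sup_{x ∈ [-S,S]ᵈ} |∂^α f(x)|`, as an extended number. -/
def M1Star (S : ℝ) (f : E d → ℝ) : ℝ≥0∞ :=
  max (⨆ x ∈ cube d S, ‖f x‖ₑ)
    (⨆ i : Fin d, ⨆ x ∈ cube d S, ‖fderiv ℝ f x (EuclideanSpace.single i 1)‖ₑ)

/-- The nodes of the Cartesian product of `d` copies of the `n`-point left endpoint rule on
`[-S,S]`; there are `D = nᵈ` of them. -/
def gridNode (S : ℝ) (n : ℕ) (j : Fin d → Fin n) : E d :=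
  WithLp.toLp 2 fun i => -S + 2 * S * ((j i : ℕ) : ℝ) / (n : ℝ)

/-- The weight `u_j = (2S)ᵈ D⁻¹ 𝟙(x_j)`, with `D = nᵈ`. -/
def gridWeight (S : ℝ) (χ : E d → ℝ) (n : ℕ) (j : Fin d → Fin n) : ℝ :=
  (2 * S) ^ d * ((n ^ d : ℕ) : ℝ)⁻¹ * χ (gridNode S n j)

/-- The total mass `Z` of the finite-bandwidth measure. -/
def totalMass (pw : E d → ℝ) (pb : ℝ → ℝ) (σw σb : ℝ) : ℝ :=
  (2 * Real.pi) ^ (1 / 2 : ℝ) * σw ^ d * σb /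
    ((∫ ξ, ‖fourierReal pw ξ‖) * ∫ ξ, ‖fourierReal pb ξ‖)

/-- The discretised operator with nodes and weights `(x_j, u_j)` and `((w_i, b_i), v_i)`:
`∑ᵢ vᵢ (∑ⱼ uⱼ f(xⱼ) ψ(wᵢ·xⱼ + bᵢ)) φ(wᵢ·x + bᵢ)`. -/
def discretised {ι κ : Type*} [Fintype ι] [Fintype κ] (φ ψ : ℝ → ℝ)
    (xs : ι → E d) (u : ι → ℝ) (θ : κ → E d × ℝ) (v : κ → ℝ) (f : E d → ℝ) (x : E d) : ℝ :=
  ∑ i, v i * (∑ j, u j * f (xs j) * ψ (inner ℝ (θ i).1 (xs j) + (θ i).2)) *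
    φ (inner ℝ (θ i).1 x + (θ i).2)

/-- The operator `I_{σ,D,N}` with `D = nᵈ` grid nodes, mollified weights, and `v_i = Z / N`. -/
def ridgeletOperator (S : ℝ) (χ : E d → ℝ) (φ ψ : ℝ → ℝ) (pw : E d → ℝ) (pb : ℝ → ℝ)
    (σw σb : ℝ) (n N : ℕ) (θ : Fin N → E d × ℝ) (f : E d → ℝ) (x : E d) : ℝ :=
  discretised φ ψ (gridNode S n) (gridWeight S χ n) θ
    (fun _ => totalMass pw pb σw σb * (N : ℝ)⁻¹) f x

end Ridgelet

end

/-! Write g = χf. The mean of the operator is Z times the average over (w, b) of a quadrature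
version of (∫ g(y) ψ(w·y+b) dy) φ(w·x+b). The error therefore splits into a bias, a quadrature error
and a random fluctuation.

Bias. Fourier inversion at 0 gives ‖p̂_b‖₁ = (2π)^{1/2} p_b(0), so Z times the density of b equals
σ_w^d ‖p̂_w‖₁⁻¹ p_b(b/σ_b)/p_b(0), where the last ratio is 1 + O(|b|/σ_b). With the ratio replaced
by 1, integrating ψ(w·y+b) φ(w·x+b) over b gives k(w·(x-y)), where k(t) = ∫ ψ(s) φ(s+t) ds = ∫
conj(ψ̂) φ̂ e^{itξ} dξ (`ridgeKernel_eq`, `abs_integral_density_sub_le`). Averaging e^{iξ w·(x-y)}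
over w produces p̂_w(σ_w ξ(y-x)), an approximate identity of width 1/(σ_w|ξ|) and mass proportional
to (σ_w|ξ|)^{-d}. The normalisation of φ and ψ then reproduces g(x), with error O(1/σ_w) because g
is Lipschitz (`abs_reconstruction_sub_le`, `exists_bias_bound`).

Quadrature. The function g(y) ψ(w·y+b) of y is Lipschitz with constant O(1+‖w‖) and vanishes off the
cube, so the grid sum errs by O((1+‖w‖)/n). Multiplying by Z and by the linear growth of φ, and
averaging, gives the third term (`exists_mean_bound`).

Fluctuation. With a the grid coefficient, split a φ(w·x+b) into a (φ(w·x+b) - φ(b)) and a φ(b). The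
first part is a Lipschitz function of w·x that vanishes at x = 0: symmetrisation and contraction
bound its expected supremum by O(σ_w √N) (`lintegral_iSup_neuron_le`), and Markov's inequality costs
1/δ. The second part does not involve x, and Chebyshev's inequality suffices; its second moment is
bounded in two ways (`exists_second_moment_le`) so that the result fits the stated terms for both
large and small σ_w (`fluctuation_le`). Suprema are taken over a countable dense subset of 𝒳, and
continuity extends the bound to all of 𝒳. -/

noncomputable section

namespace Ridgelet

/-! ### The scaled laws: dilation, moments, characteristic function. -/

section Law

variable {V : Type*} [NormedAddCommGroup V] [InnerProductSpace ℝ V] [MeasurableSpace V]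
  [BorelSpace V] [FiniteDimensional ℝ V]

/-- The measure with density `p`. -/
def baseLaw (p : V → ℝ) : Measure V := volume.withDensity fun x => ENNReal.ofReal (p x)

/-- Change of variables. Integrals against the scaled law become integrals against the fixed density
`p`, which makes their dependence on `σ` explicit. -/
theorem scaledLaw_eq_map {σ : ℝ} (hσ : 0 < σ) (p : V → ℝ) :
    scaledLaw σ p = (baseLaw p).map (σ • ·) := by
  have hσ' := hσ.ne'
  have hm : Measurable fun x : V => σ • x := measurable_const_smul σ
  have key (F : V → ℝ≥0∞) : ∫⁻ x, F (σ • x) =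
      ENNReal.ofReal (σ ^ Module.finrank ℝ V)⁻¹ * ∫⁻ x, F x := by
    have h1 := lintegral_map_equiv (μ := (volume : Measure V)) F (MeasurableEquiv.smul₀ σ hσ')
    have h2 := Measure.map_addHaar_smul (volume : Measure V) hσ'
    rw [abs_of_pos (by positivity)] at h2
    rw [← smul_eq_mul, ← lintegral_smul_measure, ← h2]
    exact h1.symm
  ext s hs
  rw [Measure.map_apply hm hs, scaledLaw, baseLaw, withDensity_apply _ hs,
    withDensity_apply _ (hm hs), ← lintegral_indicator hs, ← lintegral_indicator (hm hs)]
  have h3 (x : V) : s.indicator (fun x => ENNReal.ofReal (scaledDensity σ p x)) x =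
      ENNReal.ofReal (σ ^ Module.finrank ℝ V)⁻¹ *
        s.indicator (fun x => ENNReal.ofReal (p (σ⁻¹ • x))) x := by
    by_cases hx : x ∈ s
    · simp [hx, scaledDensity, ENNReal.ofReal_mul (show 0 ≤ (σ ^ Module.finrank ℝ V)⁻¹ by positivity)]
    · simp [hx]
  simp_rw [h3]
  rw [lintegral_const_mul' _ _ ENNReal.ofReal_ne_top, ← key]
  refine lintegral_congr fun x => ?_
  by_cases hx : σ • x ∈ s <;> simp [hx, hσ']

variable {p : V → ℝ}

theorem aemeasurable_ofReal_density (hp : Integrable p) :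
    AEMeasurable (fun x => ENNReal.ofReal (p x)) volume :=
  hp.aestronglyMeasurable.aemeasurable.ennreal_ofReal

theorem integral_baseLaw {F : Type*} [NormedAddCommGroup F] [NormedSpace ℝ F]
    (hp : IsRegularDensity p) (f : V → F) : ∫ x, f x ∂baseLaw p = ∫ x, p x • f x := by
  rw [baseLaw, integral_withDensity_eq_integral_toReal_smul₀ (aemeasurable_ofReal_density hp.integrable)
    (by simp)]
  simp [ENNReal.toReal_ofReal (hp.nonneg _)]

theorem integrable_baseLaw_iff {F : Type*} [NormedAddCommGroup F] [NormedSpace ℝ F]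
    (hp : IsRegularDensity p) (f : V → F) :
    Integrable f (baseLaw p) ↔ Integrable fun x => p x • f x := by
  rw [baseLaw, integrable_withDensity_iff_integrable_smul₀'
    (aemeasurable_ofReal_density hp.integrable) (by simp)]
  simp [ENNReal.toReal_ofReal (hp.nonneg _)]

theorem isProbabilityMeasure_baseLaw (hp : IsRegularDensity p) :
    IsProbabilityMeasure (baseLaw p) := by
  constructor
  rw [baseLaw, withDensity_apply _ MeasurableSet.univ, Measure.restrict_univ,
    ← ofReal_integral_eq_lintegral_ofReal hp.integrable (ae_of_all _ hp.nonneg),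
    hp.integral_eq_one, ENNReal.ofReal_one]

theorem isProbabilityMeasure_scaledLaw {σ : ℝ} (hσ : 0 < σ) (hp : IsRegularDensity p) :
    IsProbabilityMeasure (scaledLaw σ p) := by
  have := isProbabilityMeasure_baseLaw hp
  rw [scaledLaw_eq_map hσ]
  exact Measure.isProbabilityMeasure_map (measurable_const_smul σ).aemeasurable

theorem integral_scaledLaw {F : Type*} [NormedAddCommGroup F] [NormedSpace ℝ F]
    {σ : ℝ} (hσ : 0 < σ) (hp : IsRegularDensity p) (f : V → F) :
    ∫ x, f x ∂scaledLaw σ p = ∫ x, p x • f (σ • x) := by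
  rw [scaledLaw_eq_map hσ, ← integral_baseLaw hp]
  exact integral_map_equiv (MeasurableEquiv.smul₀ σ hσ.ne') f

theorem integrable_scaledLaw_iff {F : Type*} [NormedAddCommGroup F] [NormedSpace ℝ F]
    {σ : ℝ} (hσ : 0 < σ) (hp : IsRegularDensity p) (f : V → F) :
    Integrable f (scaledLaw σ p) ↔ Integrable fun x => p x • f (σ • x) := by
  rw [scaledLaw_eq_map hσ, ← integrable_baseLaw_iff hp]
  exact integrable_map_equiv (MeasurableEquiv.smul₀ σ hσ.ne') f

theorem integrable_one_add_norm_sq_scaledLaw {σ : ℝ} (hσ : 0 < σ) (hp : IsRegularDensity p) :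
    Integrable (fun x => (1 + ‖x‖) ^ 2) (scaledLaw σ p) := by
  have := isProbabilityMeasure_scaledLaw hσ hp
  have h : Integrable (fun x => ‖x‖ ^ 2) (scaledLaw σ p) := by
    rw [integrable_scaledLaw_iff hσ hp]
    refine (hp.second_moment.const_mul (σ ^ 2)).congr (ae_of_all _ fun x => ?_)
    simp [norm_smul, abs_of_pos hσ]; ring
  refine ((integrable_const (2 : ℝ)).add (h.const_mul 2)).mono' (by fun_prop)
    (ae_of_all _ fun x => ?_)
  rw [Real.norm_of_nonneg (by positivity)]
  simp only [Pi.add_apply]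
  nlinarith [sq_nonneg (1 - ‖x‖)]

theorem integral_norm_sq_scaledLaw {σ : ℝ} (hσ : 0 < σ) (hp : IsRegularDensity p) :
    ∫ x, ‖x‖ ^ 2 ∂scaledLaw σ p = σ ^ 2 * ∫ x, ‖x‖ ^ 2 * p x := by
  rw [integral_scaledLaw hσ hp, ← integral_const_mul]
  congr 1; ext x
  simp [norm_smul, abs_of_pos hσ]; ring

theorem integrable_norm_sq_scaledLaw {σ : ℝ} (hσ : 0 < σ) (hp : IsRegularDensity p) :
    Integrable (fun x => ‖x‖ ^ 2) (scaledLaw σ p) :=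
  (integrable_one_add_norm_sq_scaledLaw hσ hp).mono' (by fun_prop) (ae_of_all _ fun x => by
    rw [Real.norm_of_nonneg (by positivity)]
    gcongr; linarith)

theorem exists_integral_one_add_norm_sq_scaledLaw_le (hp : IsRegularDensity p) :
    ∃ c : ℝ, 0 ≤ c ∧ ∀ σ : ℝ, 0 < σ → ∫ x, (1 + ‖x‖) ^ 2 ∂scaledLaw σ p ≤ c * (1 + σ) ^ 2 := by
  have hm : 0 ≤ ∫ x, ‖x‖ ^ 2 * p x := integral_nonneg fun x => mul_nonneg (by positivity) (hp.nonneg x)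
  refine ⟨2 + 2 * ∫ x, ‖x‖ ^ 2 * p x, by positivity, fun σ hσ => ?_⟩
  have := isProbabilityMeasure_scaledLaw hσ hp
  have h := integrable_norm_sq_scaledLaw hσ hp
  calc ∫ x, (1 + ‖x‖) ^ 2 ∂scaledLaw σ p ≤ ∫ x, (2 + 2 * ‖x‖ ^ 2) ∂scaledLaw σ p := by
        refine integral_mono (integrable_one_add_norm_sq_scaledLaw hσ hp)
          ((integrable_const _).add (h.const_mul 2)) fun x => ?_
        simp only
        nlinarith [sq_nonneg (1 - ‖x‖)]
    _ = 2 + 2 * (σ ^ 2 * ∫ x, ‖x‖ ^ 2 * p x) := by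
        rw [integral_add (integrable_const _) (h.const_mul 2), integral_const_mul,
          integral_norm_sq_scaledLaw hσ hp]
        simp
    _ ≤ _ := by nlinarith [mul_nonneg hm hσ.le]

/-- The constant only undoes the unitary normalisation in `fourier`; this is how p̂_w enters the
reconstruction formula. -/
theorem integral_exp_inner_scaledLaw {σ : ℝ} (hσ : 0 < σ) (hp : IsRegularDensity p) (v : V) :
    ∫ w, Complex.exp (Complex.I * ((inner ℝ w v : ℝ) : ℂ)) ∂scaledLaw σ p =
      (((2 * Real.pi) ^ ((Module.finrank ℝ V : ℝ) / 2) : ℝ) : ℂ) *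
        fourierReal p (-(σ • v)) := by
  rw [integral_scaledLaw hσ hp, fourierReal, fourier, ← mul_assoc, ← Complex.ofReal_mul,
    ← Real.rpow_add (by positivity)]
  simp only [neg_div, add_neg_cancel, Real.rpow_zero, Complex.ofReal_one, one_mul]
  congr 1; ext w
  rw [Complex.real_smul, inner_neg_left, inner_smul_left, inner_smul_left, real_inner_comm]
  simp

end Law

/-! ### The correlation of ψ and φ as a Fourier integral. -/

section Kernel
open scoped FourierTransform

/-- The product of the Fourier transform of `φ` with the conjugate of that of `ψ`. -/
def symbol (φhat : ℝ → ℂ) (ψ : ℝ → ℝ) (ξ : ℝ) : ℂ := starRingEnd ℂ (fourierReal ψ ξ) * φhat ξ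

/-- The correlation `∫ ψ(s) φ(s + t) ds`. -/
def ridgeKernel (φ ψ : ℝ → ℝ) (t : ℝ) : ℝ := ∫ s, ψ s * φ (s + t)

/-- A Schwartz function with Fourier transform `s ↦ ψ (s - t)`. -/
def modulated (ψ : 𝓢(ℝ, ℝ)) (t : ℝ) : 𝓢(ℝ, ℂ) :=
  ((2 * Real.pi) ^ (-(1 : ℝ) / 2) : ℝ) • SchwartzMap.compCLMOfContinuousLinearEquiv ℝ
    (LinearEquiv.smulOfNeZero ℝ ℝ (2 * Real.pi)⁻¹ (by positivity)).toContinuousLinearEquiv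
    (𝓕⁻ ((ψ.compSubConstCLM ℝ t).postcompCLM Complex.ofRealCLM))

theorem modulated_apply' (ψ : 𝓢(ℝ, ℝ)) (t ξ : ℝ) :
    modulated ψ t ξ = (((2 * Real.pi) ^ (-(1 : ℝ) / 2) : ℝ) : ℂ) *
      𝓕⁻ ((ψ.compSubConstCLM ℝ t).postcompCLM Complex.ofRealCLM) ((2 * Real.pi)⁻¹ * ξ) := by
  simp [modulated]

/-- `modulated` is the inverse transform of a translate of `ψ`: translation gives the phase, and the
inverse transform of a real function is the conjugate of the forward one. -/
theorem modulated_apply (ψ : 𝓢(ℝ, ℝ)) (t ξ : ℝ) :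
    modulated ψ t ξ = starRingEnd ℂ (fourierReal ψ ξ) *
      Complex.exp (Complex.I * ((t * ξ : ℝ) : ℂ)) := by
  rw [modulated_apply', SchwartzMap.fourierInv_coe, Real.fourierInv_eq', fourierReal, fourier,
    map_mul, Complex.conj_ofReal, ← integral_conj, mul_assoc, ← integral_mul_const]
  simp only [Module.finrank_self, Nat.cast_one]
  congr 1
  rw [← integral_add_right_eq_self _ t]
  congr 1; ext b
  simp only [add_sub_cancel_right, SchwartzMap.postcompCLM_apply, SchwartzMap.compSubConstCLM_apply,
    Complex.ofRealCLM_apply, map_mul, Complex.conj_ofReal, ← Complex.exp_conj, map_neg,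
    Complex.conj_I, smul_eq_mul, neg_neg, neg_mul]
  rw [mul_comm, mul_assoc (_ : ℂ), ← Complex.exp_add]
  congr 2
  have : (Real.pi : ℂ) ≠ 0 := by exact_mod_cast Real.pi_ne_zero
  simp
  field_simp

theorem fourier_modulated (ψ : 𝓢(ℝ, ℝ)) (t b : ℝ) :
    fourier (modulated ψ t) b = (ψ (b - t) : ℂ) := by
  set Ψ : 𝓢(ℝ, ℂ) := (ψ.compSubConstCLM ℝ t).postcompCLM Complex.ofRealCLM with hΨ
  have h1 : 𝓕 (𝓕⁻ Ψ) b = (ψ (b - t) : ℂ) := by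
    rw [FourierTransform.fourier_fourierInv_eq]; simp [hΨ]
  rw [SchwartzMap.fourier_coe, Real.fourier_eq'] at h1
  have h2 := Measure.integral_comp_mul_left
    (fun v : ℝ => Complex.exp (((-2 * Real.pi * inner ℝ v b : ℝ) : ℂ) * Complex.I) • (𝓕⁻ Ψ) v)
    (2 * Real.pi)⁻¹
  rw [h1] at h2
  have hπ : (Real.pi : ℂ) ≠ 0 := by exact_mod_cast Real.pi_ne_zero
  have hc : (((2 * Real.pi) ^ (-(1 : ℝ) / 2) : ℝ) : ℂ) * (((2 * Real.pi) ^ (-(1 : ℝ) / 2) : ℝ) : ℂ)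
      = ((2 * Real.pi)⁻¹ : ℝ) := by
    rw [← Complex.ofReal_mul, ← Real.rpow_add (by positivity), ← Real.rpow_neg_one]
    norm_num
  rw [fourier]
  simp only [modulated_apply', ← hΨ, Module.finrank_self, Nat.cast_one]
  have h3 (x : ℝ) : (((2 * Real.pi) ^ (-(1 : ℝ) / 2) : ℝ) : ℂ) * (𝓕⁻ Ψ) ((2 * Real.pi)⁻¹ * x) *
      Complex.exp (-Complex.I * ((inner ℝ b x : ℝ) : ℂ)) =
      (((2 * Real.pi) ^ (-(1 : ℝ) / 2) : ℝ) : ℂ) *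
      (Complex.exp (((-2 * Real.pi * inner ℝ ((2 * Real.pi)⁻¹ * x) b : ℝ) : ℂ) * Complex.I) •
        (𝓕⁻ Ψ) ((2 * Real.pi)⁻¹ * x)) := by
    rw [smul_eq_mul, mul_assoc]
    congr 1
    rw [mul_comm]
    congr 2
    simp
    field_simp
  simp_rw [h3]
  rw [integral_const_mul, h2, ← mul_assoc, hc, inv_inv, abs_of_pos (by positivity),
    Complex.real_smul, ← mul_assoc, ← Complex.ofReal_mul, inv_mul_cancel₀ (by positivity),
    Complex.ofReal_one, one_mul]

variable {φ : ℝ → ℝ} {φhat : ℝ → ℂ} {ψ : 𝓢(ℝ, ℝ)} {m : ℕ}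

/-- The phase has modulus one, so every translate of `ψ` yields an admissible test function. -/
theorem vanishesToOrder_modulated (h : VanishesToOrder m (fourierReal ψ)) (t : ℝ) :
    VanishesToOrder m (modulated ψ t) := by
  refine (h.norm_left.congr_left fun ξ => ?_).of_norm_left
  rw [modulated_apply, norm_mul, RCLike.norm_conj, Complex.norm_exp]
  simp

theorem integrable_symbol (hφ : IsGenFourier m φ φhat)
    (hψ : VanishesToOrder (2 * m) (fourierReal ψ)) : Integrable (symbol φhat ψ) := by
  refine (hφ.integrable _ (vanishesToOrder_modulated hψ 0)).congr (ae_of_all _ fun ξ => ?_)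
  simp [modulated_apply, symbol, mul_comm]

/-- This is the defining identity of the generalised Fourier transform tested on `modulated ψ t`,
whose transform is the translate ψ(· - t). -/
theorem ridgeKernel_eq (hφ : IsGenFourier m φ φhat)
    (hψ : VanishesToOrder (2 * m) (fourierReal ψ)) (t : ℝ) :
    (ridgeKernel φ ψ t : ℂ) =
      ∫ ξ, symbol φhat ψ ξ * Complex.exp (Complex.I * ((t * ξ : ℝ) : ℂ)) := by
  have h := hφ.integral_eq _ (vanishesToOrder_modulated hψ t)
  simp only [fourier_modulated, modulated_apply] at h
  have h2 := integral_add_right_eq_self (μ := volume) (fun x : ℝ => (φ x : ℂ) * (ψ (x - t) : ℂ)) t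
  rw [ridgeKernel, ← integral_complex_ofReal]
  calc _ = ∫ s, (φ (s + t) : ℂ) * (ψ (s + t - t) : ℂ) := by
        congr 1; ext s; rw [add_sub_cancel_right]; push_cast; ring
    _ = _ := h2.trans h.symm
    _ = _ := by congr 1; ext ξ; simp only [symbol]; ring

theorem abs_ridgeKernel_le (hφ : IsGenFourier m φ φhat)
    (hψ : VanishesToOrder (2 * m) (fourierReal ψ)) (t : ℝ) :
    |ridgeKernel φ ψ t| ≤ ∫ ξ, ‖symbol φhat ψ ξ‖ := by
  rw [← Real.norm_eq_abs, ← Complex.norm_real, ridgeKernel_eq hφ hψ]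
  refine (norm_integral_le_integral_norm _).trans_eq ?_
  congr 1; ext ξ
  rw [norm_mul, Complex.norm_exp]
  simp

end Kernel

/-! ### Reconstruction from Gaussian-free averaging over w: an approximate identity. -/

section Reconstruction

variable {V : Type*} [NormedAddCommGroup V] [InnerProductSpace ℝ V] [MeasurableSpace V]
  [BorelSpace V] [FiniteDimensional ℝ V]

/-- Positivity of the transform lets its integral be identified with its L¹ norm, hence with the
normalising constants in `totalMass`. -/
theorem IsRegularDensity.fourier_eq_norm {p : V → ℝ} (hp : IsRegularDensity p) (ξ : V) :
    fourierReal p ξ = (‖fourierReal p ξ‖ : ℂ) := by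
  have h := hp.fourier_pos ξ
  have : fourierReal p ξ = ((fourierReal p ξ).re : ℂ) := by
    apply Complex.ext <;> simp [h.1]
  rw [this, Complex.norm_real, Real.norm_of_nonneg h.2.le]

theorem IsRegularDensity.integral_norm_fourier_pos {p : V → ℝ} (hp : IsRegularDensity p) :
    0 < ∫ ξ, ‖fourierReal p ξ‖ := by
  rw [integral_pos_iff_support_of_nonneg (fun _ => norm_nonneg _) hp.fourier_integrable.norm]
  have : (Function.support fun ξ => ‖fourierReal p ξ‖) = univ := by
    ext ξ
    have := (hp.fourier_pos ξ).2
    simp only [Function.mem_support, ne_eq, norm_eq_zero, mem_univ, iff_true]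
    intro h; simp [h] at this
  rw [this]
  exact Measure.measure_univ_pos.2 (NeZero.ne _)

/-- Averages of a Lipschitz function against a concentrating kernel. -/
theorem norm_integral_dilation_sub_le {g : V → ℝ} {Λ : ℝ} (hgc : Continuous g)
    (hg : ∀ x y, |g x - g y| ≤ Λ * ‖x - y‖) {G : V → ℂ} (hG : Integrable G)
    (hG1 : Integrable fun z => ‖z‖ * ‖G z‖) (x : V) {c : ℝ} (hc : c ≠ 0) :
    ‖(((|c| ^ Module.finrank ℝ V : ℝ) : ℂ) * ∫ y, (g y : ℂ) * G (c • (y - x))) -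
      g x * ∫ z, G z‖ ≤ Λ / |c| * ∫ z, ‖z‖ * ‖G z‖ := by
  have h1 : ∫ y, (g y : ℂ) * G (c • (y - x)) =
      (|(c ^ Module.finrank ℝ V)⁻¹| : ℝ) • ∫ z, (g (c⁻¹ • z + x) : ℂ) * G z := by
    rw [← Measure.integral_comp_smul volume (fun z => (g (c⁻¹ • z + x) : ℂ) * G z) c,
      ← integral_add_right_eq_self _ x]
    congr 1; ext y
    rw [smul_smul, inv_mul_cancel₀ hc, one_smul, add_sub_cancel_right]
  have hb (z : V) : |g (c⁻¹ • z + x) - g x| ≤ Λ / |c| * ‖z‖ := by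
    refine (hg _ _).trans_eq ?_
    rw [add_sub_cancel_right, norm_smul, norm_inv, Real.norm_eq_abs]
    ring
  have hdom : Integrable fun z => Λ / |c| * (‖z‖ * ‖G z‖) := hG1.const_mul _
  have hd : Integrable fun z => ((g (c⁻¹ • z + x) - g x : ℝ) : ℂ) * G z := by
    refine hdom.mono' (.mul (by fun_prop) hG.aestronglyMeasurable) (ae_of_all _ fun z => ?_)
    rw [norm_mul, Complex.norm_real, Real.norm_eq_abs, ← mul_assoc]
    gcongr; exact hb z
  -- After the substitution z = c(y - x), freezing g at x gives the main term; the remainder is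
  -- controlled by the first moment of G.
  have h2 : ∫ z, (g (c⁻¹ • z + x) : ℂ) * G z =
      (∫ z, ((g (c⁻¹ • z + x) - g x : ℝ) : ℂ) * G z) + g x * ∫ z, G z := by
    rw [← integral_const_mul, ← integral_add hd (hG.const_mul _)]
    congr 1; ext z; push_cast; ring
  rw [h1, abs_inv, abs_pow, Complex.real_smul, ← mul_assoc, ← Complex.ofReal_mul,
    mul_inv_cancel₀ (by positivity), Complex.ofReal_one, one_mul, h2, add_sub_cancel_right,
    ← integral_const_mul]
  refine norm_integral_le_of_norm_le hdom (ae_of_all _ fun z => ?_)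
  rw [norm_mul, Complex.norm_real, Real.norm_eq_abs, ← mul_assoc]
  gcongr; exact hb z

variable {φ : ℝ → ℝ} {φhat : ℝ → ℂ} {ψ : 𝓢(ℝ, ℝ)} {m : ℕ}

/-- Fubini over (w, ξ, y): the exponential has modulus one, so |symbol(ξ)| |g(y)| dominates the
integrand and is integrable against the finite measure. -/
theorem integral_ridgeKernel_eq {μ : Measure V} [IsFiniteMeasure μ] (hφ : IsGenFourier m φ φhat)
    (hψ : VanishesToOrder (2 * m) (fourierReal ψ)) {g : V → ℝ} (hg : Integrable g) (x : V) :
    Integrable (fun ξ : ℝ => symbol φhat ψ ξ * ∫ y, (g y : ℂ) *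
        ∫ w, Complex.exp (Complex.I * ((inner ℝ w (ξ • (x - y)) : ℝ) : ℂ)) ∂μ) ∧
    ((∫ w, ∫ y, g y * ridgeKernel φ ψ (inner ℝ w (x - y)) ∂volume ∂μ : ℝ) : ℂ) =
      ∫ ξ : ℝ, symbol φhat ψ ξ * ∫ y, (g y : ℂ) *
        ∫ w, Complex.exp (Complex.I * ((inner ℝ w (ξ • (x - y)) : ℝ) : ℂ)) ∂μ := by
  have hs := integrable_symbol hφ hψ
  set F : V → (ℝ × V) → ℂ := fun w q => (symbol φhat ψ q.1 * (g q.2 : ℂ)) *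
    Complex.exp (Complex.I * ((inner ℝ w (q.1 • (x - q.2)) : ℝ) : ℂ))
  have hsg : Integrable (fun q : ℝ × V => symbol φhat ψ q.1 * (g q.2 : ℂ)) :=
    hs.mul_prod hg.ofReal
  have hnorm (r : ℝ) : ‖Complex.exp (Complex.I * (r : ℂ))‖ = 1 := by rw [Complex.norm_exp]; simp
  have hF : Integrable (Function.uncurry F) (μ.prod volume) := by
    have h1 : Integrable (fun z : V × (ℝ × V) => (1 : ℂ) * (symbol φhat ψ z.2.1 * (g z.2.2 : ℂ)))
        (μ.prod volume) := (integrable_const (1 : ℂ)).mul_prod hsg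
    refine (h1.mul_bdd (c := 1) (g := fun z : V × (ℝ × V) => Complex.exp
      (Complex.I * ((inner ℝ z.1 (z.2.1 • (x - z.2.2)) : ℝ) : ℂ))) (by fun_prop)
      (ae_of_all _ fun z => (hnorm _).le)).congr (ae_of_all _ fun z => ?_)
    simp [F, Function.uncurry]
  have hFq : Integrable (fun q : ℝ × V => ∫ w, F w q ∂μ) := hF.integral_prod_right
  have e1 (ξ : ℝ) : ∫ y, ∫ w, F w (ξ, y) ∂μ = symbol φhat ψ ξ * ∫ y, (g y : ℂ) *
      ∫ w, Complex.exp (Complex.I * ((inner ℝ w (ξ • (x - y)) : ℝ) : ℂ)) ∂μ := by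
    rw [← integral_const_mul]
    congr 1; ext y
    simp only [F]
    rw [integral_const_mul, mul_assoc]
  constructor
  · exact hFq.integral_prod_left.congr (ae_of_all _ e1)
  · rw [← integral_congr_ae (ae_of_all _ e1)]
    rw [← integral_prod (fun q : ℝ × V => ∫ w, F w q ∂μ) hFq, ← Measure.volume_eq_prod,
      ← integral_integral_swap hF, ← integral_complex_ofReal]
    congr 1; ext w
    have hFw : Integrable (F w) := by
      refine (hsg.mul_bdd (c := 1) (g := fun z : ℝ × V => Complex.exp
        (Complex.I * ((inner ℝ w (z.1 • (x - z.2)) : ℝ) : ℂ))) (by fun_prop)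
        (ae_of_all _ fun z => (hnorm _).le))
    rw [Measure.volume_eq_prod] at hFw ⊢
    rw [integral_prod_symm _ hFw, ← integral_complex_ofReal]
    congr 1; ext y
    rw [Complex.ofReal_mul, ridgeKernel_eq hφ hψ, ← integral_const_mul]
    congr 1; ext ξ
    simp only [F, inner_smul_right]
    rw [mul_comm ξ]
    push_cast; ring

/-- For each ξ ≠ 0 the y-integral is an average of g against p̂_w dilated by σξ. Its mass
contributes |ξ|^{-d}, which the normalisation of the pair integrates to 1; the Lipschitz error
contributes one more factor 1/(σ|ξ|), hence the weight |ξ|^{-(d+1)}. -/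
theorem abs_reconstruction_sub_le {d : ℕ} (hφψ : IsRidgeletPair d φ φhat ψ) {pw : E d → ℝ}
    (hp : IsRegularDensity pw) (hp1 : Integrable fun z => ‖z‖ * ‖fourierReal pw z‖)
    {g : E d → ℝ} (hgi : Integrable g) (hgc : Continuous g) {Λ : ℝ}
    (hg : ∀ x y, |g x - g y| ≤ Λ * ‖x - y‖) (x : E d) {σ : ℝ} (hσ : 0 < σ) :
    |σ ^ d / (∫ z, ‖fourierReal pw z‖) *
        (∫ w, ∫ y, g y * ridgeKernel φ ψ (inner ℝ w (x - y)) ∂volume ∂scaledLaw σ pw) - g x| ≤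
      ((2 * Real.pi) ^ ((d : ℝ) / 2) * (∫ ξ : ℝ, (|ξ| ^ (d + 1))⁻¹ * ‖symbol φhat ψ ξ‖) *
        ((∫ z, ‖z‖ * ‖fourierReal pw z‖) / ∫ z, ‖fourierReal pw z‖)) * (Λ / σ) := by
  obtain ⟨m, hgen, hvan⟩ := hφψ.order
  have hs := integrable_symbol hgen hvan
  have := isProbabilityMeasure_scaledLaw hσ hp
  obtain ⟨hAi, hA⟩ := integral_ridgeKernel_eq (μ := scaledLaw σ pw) hgen hvan hgi x
  set A : ℝ → ℂ := fun ξ : ℝ => symbol φhat ψ ξ * ∫ y, (g y : ℂ) *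
        ∫ w, Complex.exp (Complex.I * ((inner ℝ w (ξ • (x - y)) : ℝ) : ℂ)) ∂scaledLaw σ pw with hAdef
  set Q : ℝ := ∫ z, ‖fourierReal pw z‖ with hQ
  have hQ0 : 0 < Q := hp.integral_norm_fourier_pos
  have hQc : ∫ z, fourierReal pw z = (Q : ℂ) := by
    rw [hQ, ← integral_complex_ofReal]
    exact integral_congr_ae (ae_of_all _ hp.fourier_eq_norm)
  set κ : ℝ := (2 * Real.pi) ^ ((d : ℝ) / 2) with hκ
  have hκ0 : 0 < κ := by positivity
  have hnz : ∀ᵐ ξ : ℝ, ξ ≠ 0 := by simp [ae_iff, measure_singleton]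
  have hmeas (k : ℕ) : Measurable fun ξ : ℝ => (|ξ| ^ k)⁻¹ := by fun_prop
  have hsm : AEStronglyMeasurable (symbol φhat ψ) volume := hs.aestronglyMeasurable
  have hdom0 : Integrable fun ξ : ℝ =>
      ‖symbol φhat ψ ξ‖ + (|ξ| ^ (d + 2))⁻¹ * ‖symbol φhat ψ ξ‖ := hs.norm.add hφψ.integrable
  -- Since |ξ|^{-k} ≤ 1 + |ξ|^{-(d+2)}, large frequencies are handled by integrability of the symbol
  -- and small ones by the hypothesis on the pair.
  have hinterp (k : ℕ) (hk : k ≤ d + 2) : Integrable fun ξ : ℝ =>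
      (|ξ| ^ k)⁻¹ * ‖symbol φhat ψ ξ‖ := by
    refine hdom0.mono' ((hmeas k).aestronglyMeasurable.mul hsm.norm) ?_
    filter_upwards [hnz] with ξ hξ
    have hpos : 0 < |ξ| := abs_pos.2 hξ
    rw [Real.norm_of_nonneg (by positivity), ← one_add_mul]
    gcongr
    rcases le_total 1 |ξ| with h | h
    · have : (|ξ| ^ k)⁻¹ ≤ 1 := inv_le_one_of_one_le₀ (one_le_pow₀ h)
      have : 0 ≤ (|ξ| ^ (d + 2))⁻¹ := by positivity
      linarith
    · have : (|ξ| ^ k)⁻¹ ≤ (|ξ| ^ (d + 2))⁻¹ :=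
        inv_anti₀ (by positivity) (pow_le_pow_of_le_one hpos.le h hk)
      linarith
  have hB : Integrable fun ξ : ℝ => (((|ξ| ^ d)⁻¹ : ℝ) : ℂ) * symbol φhat ψ ξ := by
    refine (hinterp d (by omega)).mono' (.mul ?_ hsm) (ae_of_all _ fun ξ => ?_)
    · exact (Complex.measurable_ofReal.comp (hmeas d)).aestronglyMeasurable
    · rw [norm_mul, Complex.norm_real, Real.norm_of_nonneg (by positivity)]
  have hnorm1 : (κ : ℂ) * ∫ ξ : ℝ, (((|ξ| ^ d)⁻¹ : ℝ) : ℂ) * symbol φhat ψ ξ = 1 :=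
    hφψ.normalised
  -- The normalisation writes g(x) itself as an integral over ξ, so the two terms can be compared
  -- frequency by frequency.
  have hdiff : ((σ ^ d / Q * (∫ w, ∫ y, g y * ridgeKernel φ ψ (inner ℝ w (x - y)) ∂volume
      ∂scaledLaw σ pw) - g x : ℝ) : ℂ) =
      ∫ ξ : ℝ, (((σ ^ d / Q : ℝ) : ℂ) * A ξ -
        (g x * κ : ℂ) * ((((|ξ| ^ d)⁻¹ : ℝ) : ℂ) * symbol φhat ψ ξ)) := by
    rw [integral_sub (hAi.const_mul _) (hB.const_mul _), integral_const_mul, integral_const_mul,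
      mul_assoc, hnorm1, Complex.ofReal_sub, Complex.ofReal_mul, hA, mul_one]
  rw [← Real.norm_eq_abs, ← Complex.norm_real, hdiff]
  set m1 : ℝ := ∫ z, ‖z‖ * ‖fourierReal pw z‖
  have hfin : Integrable fun ξ : ℝ =>
      κ * (m1 / Q) * (Λ / σ) * ((|ξ| ^ (d + 1))⁻¹ * ‖symbol φhat ψ ξ‖) :=
    (hinterp (d + 1) (by omega)).const_mul _
  refine (norm_integral_le_of_norm_le hfin ?_).trans_eq ?_
  · filter_upwards [hnz] with ξ hξ
    have hpos : 0 < |ξ| := abs_pos.2 hξ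
    have hc : σ * ξ ≠ 0 := mul_ne_zero hσ.ne' hξ
    have key := norm_integral_dilation_sub_le hgc hg hp.fourier_integrable hp1 x hc
    rw [hQc, abs_mul, abs_of_pos hσ, finrank_euclideanSpace_fin] at key
    have e : ((σ ^ d / Q : ℝ) : ℂ) * A ξ -
        (g x * κ : ℂ) * ((((|ξ| ^ d)⁻¹ : ℝ) : ℂ) * symbol φhat ψ ξ) =
        ((κ / Q * (|ξ| ^ d)⁻¹ : ℝ) : ℂ) * symbol φhat ψ ξ *
        (((((σ * |ξ|) ^ d : ℝ) : ℂ) * ∫ y, (g y : ℂ) * fourierReal pw ((σ * ξ) • (y - x))) -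
          g x * Q) := by
      have e1 (y : E d) : ∫ w, Complex.exp (Complex.I * ((inner ℝ w (ξ • (x - y)) : ℝ) : ℂ))
          ∂scaledLaw σ pw = κ * fourierReal pw ((σ * ξ) • (y - x)) := by
        rw [integral_exp_inner_scaledLaw hσ hp, finrank_euclideanSpace_fin, smul_smul, ← smul_neg,
          neg_sub]
      have e2 : ∫ y, (g y : ℂ) * ((κ : ℂ) * fourierReal pw ((σ * ξ) • (y - x))) =
          κ * ∫ y, (g y : ℂ) * fourierReal pw ((σ * ξ) • (y - x)) := by
        rw [← integral_const_mul]; congr 1; ext y; ring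
      simp only [hAdef, e1, e2]
      have hQc0 : (Q : ℂ) ≠ 0 := by exact_mod_cast hQ0.ne'
      have hξc : ((|ξ| : ℝ) : ℂ) ≠ 0 := by exact_mod_cast hpos.ne'
      push_cast
      field_simp
      ring
    rw [e, norm_mul, norm_mul, Complex.norm_real, Real.norm_of_nonneg (by positivity)]
    calc _ ≤ κ / Q * (|ξ| ^ d)⁻¹ * ‖symbol φhat ψ ξ‖ * (Λ / (σ * |ξ|) * m1) := by gcongr
      _ = _ := by field_simp; ring
  · rw [integral_const_mul]; ring

end Reconstruction

/-! ### The bias density: value at the origin and Lipschitz bound. -/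

section BiasDensity
open scoped FourierTransform

/-- Fourier inversion at the origin, with the modulus dropped because the transform is positive. It
turns the factor ‖p̂_b‖₁ of `totalMass` into p_b(0). -/
theorem IsRegularDensity.integral_norm_fourier_eq {p : ℝ → ℝ} (hp : IsRegularDensity p)
    (hc : Continuous p) : ∫ ξ, ‖fourierReal p ξ‖ = (2 * Real.pi) ^ (1 / 2 : ℝ) * p 0 := by
  set k : ℝ := (2 * Real.pi) ^ (1 / 2 : ℝ) with hk
  have hk0 : 0 < k := by positivity
  have hkk : k * k = 2 * Real.pi := by
    rw [hk, ← Real.rpow_add (by positivity)]; norm_num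
  -- Conversion from the e^{-2πi xη} convention to the unitary one; the Jacobian 1/(2π) and the
  -- factor k combine below to 1/k.
  have hF (η : ℝ) : 𝓕 (fun x => (p x : ℂ)) η = k * fourierReal p (2 * Real.pi * η) := by
    rw [Real.fourier_eq', fourierReal, fourier, ← mul_assoc, ← Complex.ofReal_mul, hk,
      ← Real.rpow_add (by positivity)]
    simp only [Module.finrank_self, Nat.cast_one, neg_div, add_neg_cancel, Real.rpow_zero,
      Complex.ofReal_one, one_mul, smul_eq_mul]
    congr 1; ext x
    rw [mul_comm]
    congr 2
    simp
    ring
  have hFi : Integrable (𝓕 (fun x => (p x : ℂ))) := by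
    rw [funext hF]
    exact (hp.fourier_integrable.comp_mul_left' (by positivity)).const_mul _
  have hinv := Continuous.fourierInv_fourier_eq (f := fun x => (p x : ℂ)) (by fun_prop)
    hp.integrable.ofReal hFi
  have h0 := congrFun hinv 0
  rw [Real.fourierInv_eq'] at h0
  simp only [inner_zero_right, mul_zero, Complex.ofReal_zero, zero_mul, Complex.exp_zero,
    one_smul, hF] at h0
  rw [integral_const_mul, Measure.integral_comp_mul_left (fun ξ => fourierReal p ξ),
    integral_congr_ae (ae_of_all _ hp.fourier_eq_norm), integral_complex_ofReal,
    abs_of_pos (by positivity), Complex.real_smul, ← Complex.ofReal_mul, ← Complex.ofReal_mul,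
    Complex.ofReal_inj, ← hkk] at h0
  rw [← h0]
  field_simp

theorem exists_ae_norm_le_of_memLp_top {f : ℝ → ℝ} (hb : MemLp f ∞ volume) :
    ∃ B : ℝ, ∀ᵐ x, ‖f x‖ ≤ B := by
  have h := hb.2
  rw [eLpNorm_exponent_top] at h
  refine ⟨(eLpNormEssSup f volume).toReal, ?_⟩
  filter_upwards [ae_le_eLpNormEssSup (f := f) (μ := volume)] with x hx
  rw [← toReal_enorm]
  exact ENNReal.toReal_mono h.ne hx

theorem exists_lipschitz_of_deriv_bounded {p : ℝ → ℝ} (hd : Differentiable ℝ p)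
    (hb : MemLp (deriv p) ∞ volume) : ∃ B, 0 ≤ B ∧ ∀ s t, |p s - p t| ≤ B * |s - t| := by
  obtain ⟨B, hB⟩ := exists_ae_norm_le_of_memLp_top hb
  refine ⟨max B 0, le_max_right _ _, fun s t => ?_⟩
  have hint : IntervalIntegrable (deriv p) volume t s :=
    ((hb.locallyIntegrable le_top).integrableOn_isCompact isCompact_uIcc).intervalIntegrable
  rw [← intervalIntegral.integral_deriv_eq_sub (fun x _ => hd x) hint, ← Real.norm_eq_abs]
  refine intervalIntegral.norm_integral_le_of_norm_le_const_ae ?_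
  filter_upwards [hB] with x hx _ using hx.trans (le_max_left _ _)

end BiasDensity

/-! ### Trading the growth of φ for the decay of ψ. -/

section Growth

variable {V : Type*} [NormedAddCommGroup V] [InnerProductSpace ℝ V]

theorem abs_le_of_lipschitz {φ : ℝ → ℝ} {L : NNReal} (hL : LipschitzWith L φ) (t : ℝ) :
    |φ t| ≤ (|φ 0| + L) * (1 + |t|) := by
  have h : |φ t - φ 0| ≤ L * |t - 0| := by simpa [Real.dist_eq] using hL.dist_le_mul t 0
  have h2 := abs_sub_abs_le_abs_sub (φ t) (φ 0)
  rw [sub_zero] at h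
  nlinarith [abs_nonneg t, abs_nonneg (φ 0), L.coe_nonneg, mul_nonneg (abs_nonneg (φ 0)) (abs_nonneg t)]

/-- The arguments w·x+b and w·y+b differ by at most 2R‖w‖. This moves the growth of φ at x to the
point y, where ψ(w·y+b) decays, so no power of b survives. -/
theorem one_add_abs_inner_add_le {R : ℝ} {w x y : V} {b : ℝ} (hx : ‖x‖ ≤ R) (hy : ‖y‖ ≤ R) :
    1 + |inner ℝ w x + b| ≤ (1 + 2 * R) * (1 + ‖w‖) * (1 + |inner ℝ w y + b|) := by
  have hR : 0 ≤ R := (norm_nonneg _).trans hx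
  have h1 : |inner ℝ w x| ≤ ‖w‖ * R := (abs_real_inner_le_norm _ _).trans (by gcongr)
  have h2 : |inner ℝ w y| ≤ ‖w‖ * R := (abs_real_inner_le_norm _ _).trans (by gcongr)
  have h3 : |inner ℝ w x + b| ≤ 2 * R * ‖w‖ + |inner ℝ w y + b| := by
    have : inner ℝ w x + b = inner ℝ w x - inner ℝ w y + (inner ℝ w y + b) := by ring
    rw [this]
    refine (abs_add_le _ _).trans (add_le_add_left ((abs_sub _ _).trans ?_) _)
    linarith
  set s := |inner ℝ w y + b|
  have hs : 0 ≤ s := abs_nonneg _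
  have hw := norm_nonneg w
  nlinarith [mul_nonneg hR hw, mul_nonneg hR hs, mul_nonneg hw hs, mul_nonneg (mul_nonneg hR hw) hs]

theorem one_add_abs_le {R : ℝ} {w y : V} {b : ℝ} (hy : ‖y‖ ≤ R) :
    1 + |b| ≤ (1 + 2 * R) * (1 + ‖w‖) * (1 + |inner ℝ w y + b|) := by
  simpa using one_add_abs_inner_add_le (x := 0) (b := b)
    (by simpa using (norm_nonneg _).trans hy) hy

theorem abs_neuron_le {φ : ℝ → ℝ} {L : NNReal} {R : ℝ} (hL : LipschitzWith L φ) {w x y : V} {b : ℝ} (hx : ‖x‖ ≤ R)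
    (hy : ‖y‖ ≤ R) : |φ (inner ℝ w x + b)| ≤
      (|φ 0| + L) * ((1 + 2 * R) * (1 + ‖w‖) * (1 + |inner ℝ w y + b|)) :=
  (abs_le_of_lipschitz hL _).trans (by gcongr; exact one_add_abs_inner_add_le hx hy)

end Growth

/-! ### Flattening the density of b. -/

section BiasBound

variable {V : Type*} [NormedAddCommGroup V] [InnerProductSpace ℝ V] [MeasurableSpace V]
  [BorelSpace V] [FiniteDimensional ℝ V]

theorem integrable_mul_comp_inner_add {g : V → ℝ} (hg : Integrable g) (hgc : Continuous g)
    {ρ : ℝ → ℝ} (hρ : Integrable ρ) (hρc : Continuous ρ) (w : V) :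
    Integrable (fun q : V × ℝ => g q.1 * ρ (inner ℝ w q.1 + q.2)) (volume.prod volume) ∧
    ∫ q : V × ℝ, g q.1 * ρ (inner ℝ w q.1 + q.2) ∂(volume.prod volume) = (∫ y, g y) * ∫ s, ρ s := by
  have h : Integrable (fun q : V × ℝ => g q.1 * ρ (inner ℝ w q.1 + q.2)) (volume.prod volume) := by
    rw [integrable_prod_iff (by fun_prop : Continuous _).aestronglyMeasurable]
    refine ⟨ae_of_all _ fun y => (hρ.comp_add_left (inner ℝ w y)).const_mul (g y), ?_⟩
    simp only [norm_mul]
    simp_rw [integral_const_mul, integral_add_left_eq_self (fun b => ‖ρ b‖)]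
    exact hg.norm.mul_const _
  refine ⟨h, ?_⟩
  rw [integral_prod _ h]
  simp_rw [integral_const_mul, integral_add_left_eq_self ρ]
  exact integral_mul_const _ _

theorem integrable_one_add_abs_pow_mul (ψ : 𝓢(ℝ, ℝ)) (k : ℕ) :
    Integrable fun s => (1 + |s|) ^ k * |ψ s| := by
  have h1 := (ψ.integrable (μ := volume)).norm.const_mul (2 ^ k : ℝ)
  have h2 := (ψ.integrable_pow_mul volume k).const_mul (2 ^ k : ℝ)
  refine (h1.add h2).mono' (by fun_prop) (ae_of_all _ fun s => ?_)
  rw [Real.norm_of_nonneg (by positivity)]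
  simp only [Pi.add_apply, Real.norm_eq_abs]
  rw [← mul_assoc, ← add_mul]
  gcongr
  rcases le_total |s| 1 with h | h
  · calc (1 + |s|) ^ k ≤ 2 ^ k := by gcongr; linarith
      _ ≤ _ := le_add_of_nonneg_right (by positivity)
  · calc (1 + |s|) ^ k ≤ (2 * |s|) ^ k := by gcongr; linarith
      _ = 2 ^ k * |s| ^ k := mul_pow _ _ _
      _ ≤ _ := le_add_of_nonneg_left (by positivity)

theorem exists_one_add_abs_mul_le (ψ : 𝓢(ℝ, ℝ)) : ∃ c, 0 ≤ c ∧ ∀ s, (1 + |s|) * |ψ s| ≤ c := by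
  obtain ⟨c0, h0⟩ := ψ.decay 0 0
  obtain ⟨c1, h1⟩ := ψ.decay 1 0
  simp only [norm_iteratedFDeriv_zero, pow_zero, one_mul, pow_one, Real.norm_eq_abs] at h0 h1
  have h (s : ℝ) : (1 + |s|) * |ψ s| ≤ c0 + c1 := by linarith [h0.2 s, h1.2 s]
  exact ⟨c0 + c1, (h 0).trans' (by positivity), h⟩

/-- The ridgelet coefficient `∫ g(y) ψ(w·y + b) dy`. -/
def coefficient (g : V → ℝ) (ψ : ℝ → ℝ) (θ : V × ℝ) : ℝ := ∫ y, g y * ψ (inner ℝ θ.1 y + θ.2)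

variable {φ : ℝ → ℝ} {ψ : 𝓢(ℝ, ℝ)} {L : NNReal} {g : V → ℝ} {R : ℝ}

theorem measurable_coefficient (hgc : Continuous g) : Measurable (coefficient g ψ) := by
  have : StronglyMeasurable fun z : (V × ℝ) × V => g z.2 * ψ (inner ℝ z.1.1 z.2 + z.1.2) := by
    apply Continuous.stronglyMeasurable
    have := ψ.continuous
    fun_prop
  exact this.integral_prod_right.measurable

/-- The bound is free of b: the decay of ψ at w·y+b absorbs the linear growth of φ at w·x+b, at the
price of one factor 1+‖w‖. -/
theorem abs_coefficient_mul_neuron_le (hL : LipschitzWith L φ) (hg : Integrable g)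
    (hgR : ∀ y, g y ≠ 0 → ‖y‖ ≤ R) {x : V} (hx : ‖x‖ ≤ R) {c : ℝ}
    (hc : ∀ s, (1 + |s|) * |ψ s| ≤ c) (θ : V × ℝ) :
    |coefficient g ψ θ * φ (inner ℝ θ.1 x + θ.2)| ≤
      (|φ 0| + L) * (1 + 2 * R) * c * (∫ y, |g y|) * (1 + ‖θ.1‖) := by
  rw [coefficient, ← integral_mul_const, ← Real.norm_eq_abs]
  have hdom : Integrable fun y => (|φ 0| + L) * (1 + 2 * R) * c * (1 + ‖θ.1‖) * |g y| :=
    hg.abs.const_mul _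
  refine (norm_integral_le_of_norm_le hdom (ae_of_all _ fun y => ?_)).trans_eq ?_
  · by_cases hy : g y = 0
    · simp [hy]
    have hR : 0 ≤ R := (norm_nonneg _).trans hx
    have h1 := abs_neuron_le (w := θ.1) (b := θ.2) hL hx (hgR y hy)
    rw [norm_mul, norm_mul, Real.norm_eq_abs, Real.norm_eq_abs, Real.norm_eq_abs]
    calc _ ≤ |g y| * |ψ (inner ℝ θ.1 y + θ.2)| * ((|φ 0| + L) * ((1 + 2 * R) * (1 + ‖θ.1‖) *
          (1 + |inner ℝ θ.1 y + θ.2|))) := by gcongr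
      _ = (|φ 0| + L) * (1 + 2 * R) * ((1 + |inner ℝ θ.1 y + θ.2|) *
          |ψ (inner ℝ θ.1 y + θ.2)|) * (1 + ‖θ.1‖) * |g y| := by ring
      _ ≤ _ := by gcongr; exact hc _
  · rw [integral_const_mul]; ring

/-- For r = 1 the two integrals agree, by Fubini and the translation s = w·y+b. The deviation B|b|
of r from 1 and the growth of φ each cost a factor (1+‖w‖)(1+|w·y+b|); this explains both squares,
and two powers are absorbed by ψ. -/
theorem abs_integral_density_sub_le (hL : LipschitzWith L φ) (hg : Integrable g)
    (hgc : Continuous g) (hgR : ∀ y, g y ≠ 0 → ‖y‖ ≤ R) {x : V} (hx : ‖x‖ ≤ R) {r : ℝ → ℝ}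
    (hrc : Continuous r) {B : ℝ} (hr : ∀ b, |r b - 1| ≤ B * |b|) (w : V) :
    |(∫ b, r b * (coefficient g ψ (w, b) * φ (inner ℝ w x + b))) -
        ∫ y, g y * ridgeKernel φ ψ (inner ℝ w (x - y))| ≤
      B * ((|φ 0| + L) * (1 + 2 * R) ^ 2 * (∫ s, (1 + |s|) ^ 2 * |ψ s|)) * (∫ y, |g y|) *
        (1 + ‖w‖) ^ 2 := by
  have hR : 0 ≤ R := (norm_nonneg _).trans hx
  have hB : 0 ≤ B := by simpa using (abs_nonneg _).trans (hr 1)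
  have hφ := hL.continuous
  have hψ := ψ.continuous
  set A : ℝ := |φ 0| + L
  have hA : 0 ≤ A := by positivity
  set H : V × ℝ → ℝ := fun q => g q.1 * ψ (inner ℝ w q.1 + q.2) * φ (inner ℝ w x + q.2)
  have hHc : Continuous H := by fun_prop
  obtain ⟨hd, hdi⟩ := integrable_mul_comp_inner_add hg.abs hgc.abs
    (integrable_one_add_abs_pow_mul ψ 2) (by fun_prop) w
  have hHb (q : V × ℝ) : (1 + |q.2|) * |H q| ≤ A * (1 + 2 * R) ^ 2 * (1 + ‖w‖) ^ 2 *
      (|g q.1| * ((1 + |inner ℝ w q.1 + q.2|) ^ 2 * |ψ (inner ℝ w q.1 + q.2)|)) := by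
    by_cases hy : g q.1 = 0
    · simp [H, hy]
    have h1 := abs_neuron_le (w := w) (b := q.2) hL hx (hgR _ hy)
    have h2 := one_add_abs_le (w := w) (b := q.2) (hgR _ hy)
    simp only [H, abs_mul]
    calc _ ≤ ((1 + 2 * R) * (1 + ‖w‖) * (1 + |inner ℝ w q.1 + q.2|)) *
          (|g q.1| * |ψ (inner ℝ w q.1 + q.2)| * (A * ((1 + 2 * R) * (1 + ‖w‖) *
          (1 + |inner ℝ w q.1 + q.2|)))) := by gcongr
      _ = _ := by ring
  have hdom := hd.const_mul (A * (1 + 2 * R) ^ 2 * (1 + ‖w‖) ^ 2)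
  have hH : Integrable H (volume.prod volume) :=
    hdom.mono' hHc.aestronglyMeasurable (ae_of_all _ fun q =>
      (show ‖H q‖ ≤ (1 + |q.2|) * |H q| from
        le_mul_of_one_le_left (abs_nonneg _) (by simp)).trans (hHb q))
  have hrb (q : V × ℝ) : ‖(r q.2 - 1) * H q‖ ≤ B * (A * (1 + 2 * R) ^ 2 * (1 + ‖w‖) ^ 2 *
      (|g q.1| * ((1 + |inner ℝ w q.1 + q.2|) ^ 2 * |ψ (inner ℝ w q.1 + q.2)|))) := by
    rw [norm_mul, Real.norm_eq_abs, Real.norm_eq_abs]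
    calc _ ≤ B * (1 + |q.2|) * |H q| := by
          gcongr; exact (hr _).trans (by gcongr; simp)
      _ = B * ((1 + |q.2|) * |H q|) := by ring
      _ ≤ _ := mul_le_mul_of_nonneg_left (hHb q) hB
  have hrH : Integrable (fun q : V × ℝ => (r q.2 - 1) * H q) (volume.prod volume) :=
    (hdom.const_mul B).mono' (by fun_prop) (ae_of_all _ hrb)
  have hsplit : ∫ b, r b * (coefficient g ψ (w, b) * φ (inner ℝ w x + b)) =
      (∫ q : V × ℝ, (r q.2 - 1) * H q ∂(volume.prod volume)) + ∫ q, H q ∂(volume.prod volume) := by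
    have hadd : Integrable (fun q : V × ℝ => (r q.2 - 1) * H q + H q) (volume.prod volume) :=
      hrH.add hH
    rw [← integral_add hrH hH, integral_prod_symm _ hadd]
    congr 1; ext b
    rw [coefficient, ← integral_mul_const, ← integral_const_mul]
    congr 1; ext y
    simp only [H]; ring
  have hker : ∫ q, H q ∂(volume.prod volume) =
      ∫ y, g y * ridgeKernel φ ψ (inner ℝ w (x - y)) := by
    rw [integral_prod _ hH]
    congr 1; ext y
    rw [ridgeKernel, ← integral_add_left_eq_self (fun s => ψ s * φ (s + inner ℝ w (x - y)))
      (inner ℝ w y), ← integral_const_mul]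
    congr 1; ext b
    simp only [H]
    rw [inner_sub_right, mul_assoc]
    congr 3; ring
  rw [hsplit, hker, add_sub_cancel_right, ← Real.norm_eq_abs]
  refine (norm_integral_le_of_norm_le (hdom.const_mul B) (ae_of_all _ hrb)).trans_eq ?_
  rw [integral_const_mul, integral_const_mul, hdi]
  ring

end BiasBound

/-! ### The bias of the finite-bandwidth reconstruction. -/

section Bias

variable {V : Type*} [NormedAddCommGroup V] [InnerProductSpace ℝ V] [MeasurableSpace V]
  [BorelSpace V] [FiniteDimensional ℝ V]

theorem integrable_one_add_norm_scaledLaw {p : V → ℝ} {σ : ℝ} (hσ : 0 < σ)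
    (hp : IsRegularDensity p) : Integrable (fun x => 1 + ‖x‖) (scaledLaw σ p) :=
  (integrable_one_add_norm_sq_scaledLaw hσ hp).mono' (by fun_prop) (ae_of_all _ fun x => by
    rw [Real.norm_of_nonneg (by positivity)]
    exact le_self_pow₀ (by simp) two_ne_zero)

theorem exists_integral_one_add_norm_scaledLaw_le {p : V → ℝ} (hp : IsRegularDensity p) :
    ∃ c : ℝ, 0 ≤ c ∧ ∀ σ : ℝ, 0 < σ → ∫ x, (1 + ‖x‖) ∂scaledLaw σ p ≤ c * (1 + σ) := by
  obtain ⟨c, hc0, hc⟩ := exists_integral_one_add_norm_sq_scaledLaw_le hp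
  refine ⟨c + 1, by positivity, fun σ hσ => ?_⟩
  have := isProbabilityMeasure_scaledLaw hσ hp
  have h2 := integrable_one_add_norm_sq_scaledLaw hσ hp
  -- Weighted AM-GM, with weight 1+σ chosen so that the quadratic moment bound returns one that is
  -- linear in 1+σ.
  calc ∫ x, (1 + ‖x‖) ∂scaledLaw σ p
      ≤ ∫ x, ((1 + ‖x‖) ^ 2 / (1 + σ) + (1 + σ)) ∂scaledLaw σ p := by
        refine integral_mono (integrable_one_add_norm_scaledLaw hσ hp)
          ((h2.div_const _).add (integrable_const _)) fun x => ?_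
        have h1 : 0 < 1 + σ := by positivity
        have h3 : 0 < 1 + ‖x‖ := by positivity
        simp only
        rw [div_add' _ _ _ h1.ne', le_div_iff₀ h1]
        nlinarith [sq_nonneg (1 + ‖x‖ - (1 + σ)), mul_pos h1 h3]
    _ = (∫ x, (1 + ‖x‖) ^ 2 ∂scaledLaw σ p) / (1 + σ) + (1 + σ) := by
        rw [integral_add (h2.div_const _) (integrable_const _), integral_div]; simp
    _ ≤ c * (1 + σ) ^ 2 / (1 + σ) + (1 + σ) := by gcongr; exact hc σ hσ
    _ = _ := by field_simp

theorem integral_scaledLaw_real {p : ℝ → ℝ} {σ : ℝ} (hσ : 0 < σ) (hp : IsRegularDensity p)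
    (F : ℝ → ℝ) : ∫ b, F b ∂scaledLaw σ p = σ⁻¹ * ∫ b, p (σ⁻¹ * b) * F b := by
  rw [integral_scaledLaw hσ hp]
  have h := Measure.integral_comp_smul (volume : Measure ℝ) (fun b => p (σ⁻¹ * b) * F b) σ
  rw [Module.finrank_self, pow_one, abs_of_pos (by positivity)] at h
  rw [smul_eq_mul] at h
  rw [← h]
  congr 1; ext b
  simp [hσ.ne']

variable {φ : ℝ → ℝ} {φhat : ℝ → ℂ} {ψ : 𝓢(ℝ, ℝ)} {L : NNReal} {R : ℝ}

theorem integrable_prod_scaledLaw {pw : V → ℝ} {pb : ℝ → ℝ} (hw : IsRegularDensity pw)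
    (hb : IsRegularDensity pb) {σw σb : ℝ} (hσw : 0 < σw) (hσb : 0 < σb) :
    Integrable (fun θ : V × ℝ => (1 + ‖θ.1‖) ^ 2 * (1 + ‖θ.2‖))
      ((scaledLaw σw pw).prod (scaledLaw σb pb)) :=
  (integrable_one_add_norm_sq_scaledLaw hσw hw).mul_prod (integrable_one_add_norm_scaledLaw hσb hb)

theorem integrable_one_add_norm_fst {pw : V → ℝ} {pb : ℝ → ℝ} (hw : IsRegularDensity pw)
    (hb : IsRegularDensity pb) {σw σb : ℝ} (hσw : 0 < σw) (hσb : 0 < σb) :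
    Integrable (fun θ : V × ℝ => 1 + ‖θ.1‖) ((scaledLaw σw pw).prod (scaledLaw σb pb)) := by
  have := isProbabilityMeasure_scaledLaw hσb hb
  exact (integrable_one_add_norm_scaledLaw hσw hw).comp_fst _

theorem integrable_coefficient_mul_neuron {pw : V → ℝ} {pb : ℝ → ℝ} (hw : IsRegularDensity pw)
    (hb : IsRegularDensity pb) (hL : LipschitzWith L φ) {g : V → ℝ} (hg : Integrable g)
    (hgc : Continuous g) (hgR : ∀ y, g y ≠ 0 → ‖y‖ ≤ R) {x : V} (hx : ‖x‖ ≤ R) {σw σb : ℝ}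
    (hσw : 0 < σw) (hσb : 0 < σb) :
    Integrable (fun θ : V × ℝ => coefficient g ψ θ * φ (inner ℝ θ.1 x + θ.2))
      ((scaledLaw σw pw).prod (scaledLaw σb pb)) := by
  obtain ⟨c, -, hc⟩ := exists_one_add_abs_mul_le ψ
  refine ((integrable_one_add_norm_fst hw hb hσw hσb).const_mul _).mono' ?_
    (ae_of_all _ fun θ => abs_coefficient_mul_neuron_le hL hg hgR hx hc θ)
  refine ((measurable_coefficient hgc).mul ?_).aestronglyMeasurable
  have := hL.continuous
  exact (by fun_prop : Continuous _).measurable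

theorem measurable_ridgeKernel (hφ : Continuous φ) : Measurable (ridgeKernel φ ψ) := by
  have : StronglyMeasurable fun z : ℝ × ℝ => ψ z.2 * φ (z.2 + z.1) := by
    apply Continuous.stronglyMeasurable
    have := ψ.continuous
    fun_prop
  exact this.integral_prod_right.measurable

/-- The bias of the ridgelet reconstruction with finite bandwidth. -/
theorem exists_bias_bound {d : ℕ} (hφψ : IsRidgeletPair d φ φhat ψ) (hL : LipschitzWith L φ)
    {pw : E d → ℝ} {pb : ℝ → ℝ} (hp : IsFiniteBandwidth pw pb) (hR : 0 ≤ R) :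
    ∃ C, 0 ≤ C ∧ ∀ (g : E d → ℝ) (Λ : ℝ), 0 ≤ Λ → Integrable g → Continuous g →
      (∀ x y, |g x - g y| ≤ Λ * ‖x - y‖) → (∀ y, g y ≠ 0 → ‖y‖ ≤ R) →
      ∀ x, ‖x‖ ≤ R → ∀ σw σb : ℝ, 0 < σw → 0 < σb →
      |totalMass pw pb σw σb * (∫ θ, coefficient g ψ θ * φ (inner ℝ θ.1 x + θ.2)
          ∂(scaledLaw σw pw).prod (scaledLaw σb pb)) - g x| ≤
        C * (Λ / σw + (∫ y, |g y|) * (σw ^ d * (σw + 1) ^ 2 / σb)) := by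
  have hw := hp.regular_w
  have hb := hp.regular_b
  obtain ⟨m, hgen, hvan⟩ := hφψ.order
  obtain ⟨B, hB0, hB⟩ := exists_lipschitz_of_deriv_bounded hp.differentiable_b hp.deriv_bounded
  obtain ⟨cw, hcw0, hcw⟩ := exists_integral_one_add_norm_sq_scaledLaw_le hw
  have hpbc := hp.differentiable_b.continuous
  have hpb := hb.integral_norm_fourier_eq hpbc
  have hQb := hb.integral_norm_fourier_pos
  have hp0 : 0 < pb 0 := by
    rw [hpb] at hQb
    exact pos_of_mul_pos_right hQb (by positivity)
  set Q : ℝ := ∫ z, ‖fourierReal pw z‖ with hQ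
  have hQ0 : 0 < Q := hw.integral_norm_fourier_pos
  -- The first moment of p̂_w follows from its mass and second moment, since ‖z‖ ≤ 1 + ‖z‖².
  have hp1 : Integrable fun z => ‖z‖ * ‖fourierReal pw z‖ := by
    refine (hw.fourier_integrable.norm.add hp.fourier_second_moment).mono'
      (continuous_norm.aestronglyMeasurable.mul hw.fourier_integrable.aestronglyMeasurable.norm)
      (ae_of_all _ fun z => ?_)
    have : (fourierReal pw z).re = ‖fourierReal pw z‖ := by
      have h := congrArg Complex.re (hw.fourier_eq_norm z)
      simpa using h
    simp only [Pi.add_apply, this]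
    rw [Real.norm_of_nonneg (by positivity), ← one_add_mul]
    gcongr
    nlinarith [sq_nonneg (‖z‖ - 1), norm_nonneg z]
  set K1 : ℝ := (2 * Real.pi) ^ ((d : ℝ) / 2) * (∫ ξ : ℝ, (|ξ| ^ (d + 1))⁻¹ * ‖symbol φhat ψ ξ‖) *
        ((∫ z, ‖z‖ * ‖fourierReal pw z‖) / Q)
  have hK1 : 0 ≤ K1 := by positivity
  set K2 : ℝ := (|φ 0| + L) * (1 + 2 * R) ^ 2 * (∫ s, (1 + |s|) ^ 2 * |ψ s|)
  have hK2 : 0 ≤ K2 := by positivity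
  refine ⟨K1 + Q⁻¹ * (B / pb 0 * K2 * cw), by positivity, ?_⟩
  intro g Λ hΛ hgi hgc hg hgR x hx σw σb hσw hσb
  have := isProbabilityMeasure_scaledLaw hσw hw
  have := isProbabilityMeasure_scaledLaw hσb hb
  have hΛ' : 0 ≤ Λ / σw := by positivity
  -- The density of b divided by its value p_b(0)/σ_b at the origin; the Lipschitz bound on p_b
  -- keeps it within O(|b|/σ_b) of 1.
  set ρ : ℝ → ℝ := fun b => pb (σb⁻¹ * b) / pb 0
  have hρc : Continuous ρ := by fun_prop
  have hρ (b : ℝ) : |ρ b - 1| ≤ B / pb 0 / σb * |b| := by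
    have h1 := hB (σb⁻¹ * b) 0
    have h2 : ρ b - 1 = (pb (σb⁻¹ * b) - pb 0) / pb 0 := by simp only [ρ]; field_simp
    rw [h2, abs_div, abs_of_pos hp0, div_le_iff₀ hp0]
    rw [sub_zero, abs_mul, abs_inv, abs_of_pos hσb] at h1
    refine h1.trans_eq ?_
    field_simp
  set F : E d → ℝ → ℝ := fun w b => coefficient g ψ (w, b) * φ (inner ℝ w x + b)
  have hFi : Integrable (Function.uncurry F) ((scaledLaw σw pw).prod (scaledLaw σb pb)) :=
    integrable_coefficient_mul_neuron hw hb hL hgi hgc hgR hx hσw hσb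
  set J : E d → ℝ := fun w => ∫ y, g y * ridgeKernel φ ψ (inner ℝ w (x - y))
  have hJi : Integrable J (scaledLaw σw pw) := by
    refine Integrable.of_bound (C := (∫ y, |g y|) * ∫ ξ, ‖symbol φhat ψ ξ‖) ?_
      (ae_of_all _ fun w => ?_)
    · have hm : Measurable fun z : E d × E d =>
          g z.2 * ridgeKernel φ ψ (inner ℝ z.1 (x - z.2)) :=
        (hgc.measurable.comp measurable_snd).mul
          ((measurable_ridgeKernel hL.continuous).comp (by fun_prop : Continuous _).measurable)
      exact hm.stronglyMeasurable.integral_prod_right.aestronglyMeasurable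
    · rw [← integral_mul_const]
      refine norm_integral_le_of_norm_le (hgi.abs.mul_const _) (ae_of_all _ fun y => ?_)
      rw [norm_mul, Real.norm_eq_abs, Real.norm_eq_abs]
      gcongr
      exact abs_ridgeKernel_le hgen hvan _
  have hinner (w : E d) : ∫ b, F w b ∂scaledLaw σb pb = pb 0 / σb * ∫ b, ρ b * F w b := by
    rw [integral_scaledLaw_real hσb hb, div_eq_mul_inv, mul_comm (pb 0), mul_assoc,
      ← integral_const_mul (pb 0)]
    congr 2; ext b
    simp only [ρ]; field_simp
  -- The inner integral is a constant multiple of a section integral of F under the law of b, so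
  -- integrability comes from the product law.
  have hGi : Integrable (fun w => ∫ b, ρ b * F w b) (scaledLaw σw pw) := by
    have h := hFi.integral_prod_left.const_mul (σb / pb 0)
    refine h.congr (ae_of_all _ fun w => ?_)
    change σb / pb 0 * ∫ b, F w b ∂scaledLaw σb pb = _
    rw [hinner]; field_simp
  -- The factor p_b(0)/σ_b cancels against `totalMass` by the inversion formula, leaving the
  -- constant of `abs_reconstruction_sub_le`.
  have hZ : totalMass pw pb σw σb * (∫ θ, coefficient g ψ θ * φ (inner ℝ θ.1 x + θ.2)
          ∂(scaledLaw σw pw).prod (scaledLaw σb pb)) =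
      σw ^ d / Q * ∫ w, ∫ b, ρ b * F w b ∂volume ∂scaledLaw σw pw := by
    have h1 : ∫ θ, coefficient g ψ θ * φ (inner ℝ θ.1 x + θ.2)
          ∂(scaledLaw σw pw).prod (scaledLaw σb pb) =
        ∫ w, ∫ b, F w b ∂scaledLaw σb pb ∂scaledLaw σw pw := integral_prod _ hFi
    rw [h1]
    simp_rw [hinner]
    rw [integral_const_mul, totalMass, hpb, ← hQ]
    field_simp
  have hdiff : |∫ w, ((∫ b, ρ b * F w b) - J w) ∂scaledLaw σw pw| ≤
      B / pb 0 / σb * K2 * (∫ y, |g y|) * (cw * (1 + σw) ^ 2) := by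
    have h2 := (integrable_one_add_norm_sq_scaledLaw hσw hw).const_mul
      (B / pb 0 / σb * K2 * (∫ y, |g y|))
    rw [← Real.norm_eq_abs]
    refine (norm_integral_le_of_norm_le h2 (ae_of_all _ fun w =>
      abs_integral_density_sub_le hL hgi hgc hgR hx hρc hρ w)).trans ?_
    rw [integral_const_mul]
    gcongr
    exact hcw σw hσw
  rw [integral_sub hGi hJi] at hdiff
  have hrec := abs_reconstruction_sub_le hφψ hw hp1 hgi hgc hg x hσw
  rw [hZ]
  set X := ∫ w, ∫ b, ρ b * F w b ∂volume ∂scaledLaw σw pw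
  set Y := ∫ w, J w ∂scaledLaw σw pw
  have e : σw ^ d / Q * X - g x = σw ^ d / Q * (X - Y) + (σw ^ d / Q * Y - g x) := by ring
  rw [e]
  set G := ∫ y, |g y|
  have hG : 0 ≤ G := integral_nonneg fun _ => abs_nonneg _
  set T := σw ^ d * (σw + 1) ^ 2 / σb
  have hT : 0 ≤ T := by positivity
  have hK3 : 0 ≤ Q⁻¹ * (B / pb 0 * K2 * cw) := by positivity
  calc _ ≤ |σw ^ d / Q * (X - Y)| + |σw ^ d / Q * Y - g x| := abs_add_le _ _
    _ ≤ σw ^ d / Q * (B / pb 0 / σb * K2 * G * (cw * (1 + σw) ^ 2)) + K1 * (Λ / σw) := by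
        rw [abs_mul, abs_of_nonneg (by positivity : 0 ≤ σw ^ d / Q)]
        gcongr
    _ = Q⁻¹ * (B / pb 0 * K2 * cw) * (G * T) + K1 * (Λ / σw) := by
        simp only [T]; field_simp; ring
    _ ≤ _ := by nlinarith [mul_nonneg hK1 (mul_nonneg hG hT), mul_nonneg hK3 hΛ']

end Bias

/-! ### The left endpoint rule on the cube. -/

section Grid

variable {d : ℕ} {S : ℝ}

theorem norm_le_sqrt_mul {y : E d} {c : ℝ} (hc : 0 ≤ c) (h : ∀ i, |y i| ≤ c) :
    ‖y‖ ≤ √d * c := by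
  rw [EuclideanSpace.norm_eq, ← Real.sqrt_sq hc, ← Real.sqrt_mul (by positivity)]
  refine Real.sqrt_le_sqrt ?_
  calc ∑ i, ‖y i‖ ^ 2 ≤ ∑ _i : Fin d, c ^ 2 := by
        gcongr with i; simpa using h i
    _ = _ := by simp

theorem norm_le_of_mem_cube (hS : 0 ≤ S) {y : E d} (hy : y ∈ cube d S) : ‖y‖ ≤ √d * S :=
  norm_le_sqrt_mul hS fun i => abs_le.2 (hy i)

theorem isClosed_cube : IsClosed (cube d S) := by
  have : cube d S = ⋂ i, (fun x : E d => x i) ⁻¹' Icc (-S) S := by ext; simp [cube]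
  rw [this]
  exact isClosed_iInter fun i => isClosed_Icc.preimage (by fun_prop)

theorem isCompact_cube (hS : 0 ≤ S) : IsCompact (cube d S) :=
  Metric.isCompact_of_isClosed_isBounded isClosed_cube
    (isBounded_iff_forall_norm_le.2 ⟨√d * S, fun _ hy => norm_le_of_mem_cube hS hy⟩)

/-- The half-open cell of the grid with lower left corner `gridNode S n j`. -/
def gridCell (S : ℝ) (n : ℕ) (j : Fin d → Fin n) : Set (E d) :=
  WithLp.ofLp ⁻¹' Set.pi univ fun i =>
    Ico (gridNode S n j i) (gridNode S n j i + 2 * S / n)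

theorem mem_gridCell {n : ℕ} {j : Fin d → Fin n} {y : E d} : y ∈ gridCell S n j ↔
    ∀ i, gridNode S n j i ≤ y i ∧ y i < gridNode S n j i + 2 * S / n := by
  simp [gridCell, Set.mem_pi]

theorem gridNode_apply {n : ℕ} (j : Fin d → Fin n) (i : Fin d) :
    gridNode S n j i = -S + 2 * S * ((j i : ℕ) : ℝ) / n := rfl

theorem gridNode_mem_cube (hS : 0 ≤ S) {n : ℕ} (hn : 1 ≤ n) (j : Fin d → Fin n) :
    gridNode S n j ∈ cube d S := by
  intro i
  have hn' : (0 : ℝ) < n := by exact_mod_cast hn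
  have hj : ((j i : ℕ) : ℝ) ≤ n := by exact_mod_cast (j i).2.le
  rw [gridNode_apply]
  constructor
  · have : 0 ≤ 2 * S * ((j i : ℕ) : ℝ) / n := by positivity
    linarith
  · have : 2 * S * ((j i : ℕ) : ℝ) / n ≤ 2 * S := by
      rw [div_le_iff₀ hn']; gcongr
    linarith

theorem measurableSet_gridCell {n : ℕ} (j : Fin d → Fin n) :
    MeasurableSet (gridCell S n j) := by
  exact (PiLp.volume_preserving_ofLp (Fin d)).measurable
    (MeasurableSet.univ_pi fun i => measurableSet_Ico)

theorem volume_real_gridCell (hS : 0 ≤ S) {n : ℕ} (j : Fin d → Fin n) :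
    volume.real (gridCell S n j) = (2 * S / n) ^ d := by
  rw [measureReal_def, gridCell, (PiLp.volume_preserving_ofLp (Fin d)).measure_preimage
    (MeasurableSet.univ_pi fun i => measurableSet_Ico).nullMeasurableSet, Real.volume_pi_Ico_toReal]
  · simp [div_pow]
  · intro i; simp; positivity

theorem pairwise_disjoint_gridCell (hS : 0 < S) {n : ℕ} (hn : 1 ≤ n) :
    Pairwise (Function.onFun Disjoint (gridCell (d := d) S n)) := by
  intro j k hjk
  rw [Function.onFun, Set.disjoint_left]
  intro y hj hk
  rw [mem_gridCell] at hj hk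
  apply hjk
  ext i
  have hn' : (0 : ℝ) < n := by exact_mod_cast hn
  have hc : 0 < 2 * S / n := by positivity
  have key (a b : Fin d → Fin n) (ha : gridNode S n a i ≤ y i)
      (hb : y i < gridNode S n b i + 2 * S / n) : (a i : ℕ) ≤ b i := by
    have h := ha.trans_lt hb
    have e (k : ℝ) : 2 * S * k / n = 2 * S / n * k := by ring
    rw [gridNode_apply, gridNode_apply, e, e, add_assoc,
      add_lt_add_iff_left, ← mul_add_one, mul_lt_mul_iff_right₀ hc] at h
    have h1 : ((a i : ℕ) : ℝ) < ((b i : ℕ) : ℝ) + 1 := h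
    have h2 : (a i : ℕ) < (b i : ℕ) + 1 := by exact_mod_cast h1
    omega
  exact le_antisymm (key j k (hj i).1 (hk i).2) (key k j (hk i).1 (hj i).2)

theorem exists_mem_gridCell (hS : 0 < S) {n : ℕ} (hn : 1 ≤ n) {y : E d}
    (hy : ∀ i, -S ≤ y i ∧ y i < S) : ∃ j, y ∈ gridCell S n j := by
  have hn' : (0 : ℝ) < n := by exact_mod_cast hn
  have hc : 0 < 2 * S / n := by positivity
  have h0 (i : Fin d) : 0 ≤ (y i + S) / (2 * S / n) := div_nonneg (by linarith [(hy i).1]) hc.le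
  have hlt (i : Fin d) : ⌊(y i + S) / (2 * S / n)⌋₊ < n := by
    rw [Nat.floor_lt (h0 i), div_lt_iff₀ hc]
    have : (n : ℝ) * (2 * S / n) = 2 * S := by field_simp
    linarith [(hy i).2]
  refine ⟨fun i => ⟨_, hlt i⟩, mem_gridCell.2 fun i => ?_⟩
  have h1 := Nat.floor_le (h0 i)
  have h2 := Nat.lt_floor_add_one ((y i + S) / (2 * S / n))
  rw [le_div_iff₀ hc] at h1
  rw [div_lt_iff₀ hc] at h2
  rw [gridNode_apply, mul_div_right_comm]
  constructor <;> linarith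

/-- The error of the left endpoint rule for Lipschitz functions vanishing off the cube. -/
theorem abs_integral_sub_grid_sum_le (hS : 0 < S) {n : ℕ} (hn : 1 ≤ n) {G : E d → ℝ} {Λ : ℝ}
    (hG : ∀ y z, |G y - G z| ≤ Λ * ‖y - z‖) (hG0 : ∀ y ∉ cube d S, G y = 0) (hΛ : 0 ≤ Λ)
    (hGi : Integrable G) :
    |(∫ y, G y) - ∑ j : Fin d → Fin n, (2 * S / n) ^ d * G (gridNode S n j)| ≤
      Λ * (√d * (2 * S / n)) * (2 * S) ^ d := by
  have hn' : (0 : ℝ) < n := by exact_mod_cast hn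
  have hc : 0 < 2 * S / n := by positivity
  -- Half-open cells miss the faces y_i = S. There G vanishes too: a step ε/(Λ+1) in direction i
  -- leaves the cube, so |G y| ≤ ε for every ε > 0.
  have hout (y : E d) (hy : y ∉ ⋃ j, gridCell S n j) : G y = 0 := by
    by_cases hyc : y ∈ cube d S
    · obtain ⟨i, hi⟩ : ∃ i, S ≤ y i := by
        by_contra! h
        exact hy (mem_iUnion.2 (exists_mem_gridCell hS hn fun i => ⟨(hyc i).1, h i⟩))
      refine abs_eq_zero.1 (le_antisymm (le_of_forall_pos_le_add fun ε hε => ?_) (abs_nonneg _))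
      have hpos : 0 < ε / (Λ + 1) := by positivity
      have hz := hG0 (y + EuclideanSpace.single i (ε / (Λ + 1))) fun h => by
        have := (h i).2
        simp at this
        linarith
      have h := hG y (y + EuclideanSpace.single i (ε / (Λ + 1)))
      rw [hz, sub_zero, sub_add_cancel_left, norm_neg, PiLp.norm_single,
        Real.norm_of_nonneg hpos.le] at h
      refine h.trans ?_
      rw [zero_add, mul_div_assoc', div_le_iff₀ (by positivity)]
      nlinarith
    · exact hG0 y hyc
  have hsum : ∫ y, G y = ∑ j : Fin d → Fin n, ∫ y in gridCell S n j, G y := by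
    rw [← integral_iUnion_fintype (fun j => measurableSet_gridCell j)
      (pairwise_disjoint_gridCell hS hn) fun j => hGi.integrableOn]
    exact (setIntegral_eq_integral_of_forall_compl_eq_zero hout).symm
  have hvol (j : Fin d → Fin n) := volume_real_gridCell hS.le j
  have hfin (j : Fin d → Fin n) : volume (gridCell S n j) < ∞ := by
    refine lt_top_iff_ne_top.2 fun h => ?_
    have := hvol j
    rw [measureReal_def, h, ENNReal.toReal_top] at this
    exact (pow_pos hc d).ne this
  -- Each point of a cell lies within √d·2S/n of its node, so the Lipschitz bound gives the error
  -- per unit volume.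
  have hcell (j : Fin d → Fin n) : |(∫ y in gridCell S n j, G y) -
      (2 * S / n) ^ d * G (gridNode S n j)| ≤ Λ * (√d * (2 * S / n)) * (2 * S / n) ^ d := by
    have h1 : (2 * S / n) ^ d * G (gridNode S n j) =
        ∫ _y in gridCell S n j, G (gridNode S n j) := by
      rw [setIntegral_const, hvol, smul_eq_mul]
    rw [h1, ← integral_sub hGi.integrableOn (integrableOn_const (hfin j).ne), ← hvol j,
      ← Real.norm_eq_abs]
    refine norm_setIntegral_le_of_norm_le_const (hfin j) fun y hy => ?_
    refine (hG _ _).trans ?_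
    gcongr
    refine norm_le_sqrt_mul hc.le fun i => ?_
    have := mem_gridCell.1 hy i
    rw [PiLp.sub_apply, abs_le]
    constructor <;> linarith [this.1, this.2]
  rw [hsum, ← Finset.sum_sub_distrib]
  calc _ ≤ ∑ _j : Fin d → Fin n, Λ * (√d * (2 * S / n)) * (2 * S / n) ^ d :=
        (Finset.abs_sum_le_sum_abs _ _).trans (Finset.sum_le_sum fun j _ => hcell j)
    _ = _ := by
        simp only [Finset.sum_const, Finset.card_univ, Fintype.card_fun, Fintype.card_fin,
          nsmul_eq_mul]
        push_cast
        rw [div_pow]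
        field_simp

end Grid

/-! ### Lipschitz bounds for the mollified target. -/

section Target

variable {d : ℕ} {S : ℝ} {f : E d → ℝ}

theorem abs_le_M1Star (hM : M1Star S f < ∞) {x : E d} (hx : x ∈ cube d S) :
    |f x| ≤ (M1Star S f).toReal := by
  rw [← Real.norm_eq_abs, ← toReal_enorm]
  exact ENNReal.toReal_mono hM.ne
    ((le_iSup₂ (f := fun x (_ : x ∈ cube d S) => ‖f x‖ₑ) x hx).trans (le_max_left _ _))

theorem abs_partial_le_M1Star (hM : M1Star S f < ∞) {x : E d} (hx : x ∈ cube d S) (i : Fin d) :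
    |fderiv ℝ f x (EuclideanSpace.single i 1)| ≤ (M1Star S f).toReal := by
  rw [← Real.norm_eq_abs, ← toReal_enorm]
  refine ENNReal.toReal_mono hM.ne (le_trans ?_ (le_max_right _ _))
  exact (le_iSup₂ (f := fun x (_ : x ∈ cube d S) =>
    ‖fderiv ℝ f x (EuclideanSpace.single i 1)‖ₑ) x hx).trans
    (le_iSup (fun i : Fin d => ⨆ x ∈ cube d S, ‖fderiv ℝ f x (EuclideanSpace.single i 1)‖ₑ) i)

theorem norm_fderiv_le_M1Star (hM : M1Star S f < ∞) {x : E d} (hx : x ∈ cube d S) :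
    ‖fderiv ℝ f x‖ ≤ d * (M1Star S f).toReal := by
  refine ContinuousLinearMap.opNorm_le_bound _ (by positivity) fun v => ?_
  have hv : v = ∑ i, v i • EuclideanSpace.single i (1 : ℝ) := by
    ext k; simp [Finset.sum_apply, Pi.single_apply]
  have h1 : fderiv ℝ f x v = ∑ i, v i * fderiv ℝ f x (EuclideanSpace.single i 1) := by
    conv_lhs => rw [hv]
    simp
  rw [h1]
  calc _ ≤ ∑ i, ‖v i * fderiv ℝ f x (EuclideanSpace.single i 1)‖ := norm_sum_le _ _
    _ ≤ ∑ _i : Fin d, ‖v‖ * (M1Star S f).toReal := by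
        gcongr with i
        rw [norm_mul]
        gcongr
        · exact PiLp.norm_apply_le v i
        · exact abs_partial_le_M1Star hM hx i
    _ = _ := by simp; ring

/-- On the cube the product rule bounds the derivative of χf by `M1Star`; off the closed cube χf is
locally zero. The derivative bound is thus global, although f is controlled only on the cube, and
the mean value inequality applies on the whole space. -/
theorem IsMollifier.exists_lipschitz_mul {𝒳 : Set (E d)} {χ : E d → ℝ} (hS : 0 ≤ S)
    (hχ : IsMollifier S 𝒳 χ) : ∃ K, 0 ≤ K ∧ ∀ f : E d → ℝ, ContDiff ℝ 1 f → M1Star S f < ∞ →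
      ∀ x y, |χ x * f x - χ y * f y| ≤ K * (M1Star S f).toReal * ‖x - y‖ := by
  have hsupp : HasCompactSupport χ := HasCompactSupport.intro (isCompact_cube hS) hχ.eq_zero
  have hχ1 : ContDiff ℝ 1 χ := hχ.smooth.of_le (by exact_mod_cast le_top)
  obtain ⟨K, hK⟩ := (hsupp.fderiv (𝕜 := ℝ)).exists_bound_of_continuous
    (hχ1.continuous_fderiv one_ne_zero)
  have hK0 : 0 ≤ K := (norm_nonneg _).trans (hK 0)
  refine ⟨d + K, by positivity, fun f hf hM x y => ?_⟩
  have hd : Differentiable ℝ fun x => χ x * f x :=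
    (hχ1.differentiable one_ne_zero).mul (hf.differentiable one_ne_zero)
  have hbound (z : E d) : ‖fderiv ℝ (fun x => χ x * f x) z‖ ≤ (d + K) * (M1Star S f).toReal := by
    by_cases hz : z ∈ cube d S
    · rw [fderiv_fun_mul (hχ1.differentiable one_ne_zero z) (hf.differentiable one_ne_zero z)]
      refine (norm_add_le _ _).trans ?_
      rw [norm_smul, norm_smul, add_mul, Real.norm_of_nonneg (hχ.mem_Icc z).1, mul_comm K]
      exact add_le_add ((mul_le_of_le_one_left (norm_nonneg _) (hχ.mem_Icc z).2).trans
        (norm_fderiv_le_M1Star hM hz))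
        (mul_le_mul (abs_le_M1Star hM hz) (hK z) (norm_nonneg _) ENNReal.toReal_nonneg)
    · have : (fun x => χ x * f x) =ᶠ[𝓝 z] fun _ => 0 := by
        filter_upwards [isClosed_cube.isOpen_compl.mem_nhds hz] with w hw
        simp [hχ.eq_zero w hw]
      rw [this.fderiv_eq]
      simp; positivity
  simpa [Real.norm_eq_abs] using Convex.norm_image_sub_le_of_norm_fderiv_le (𝕜 := ℝ)
    (f := fun x => χ x * f x) (fun z _ => hd z) (fun z _ => hbound z) convex_univ
    (mem_univ y) (mem_univ x)

end Target

/-! ### Discretised coefficients and the mean of the operator. -/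

section GridCoefficient

variable {d : ℕ} {S : ℝ} {𝒳 : Set (E d)} {χ f : E d → ℝ} {φ : ℝ → ℝ} {φhat : ℝ → ℂ}
  {ψ : 𝓢(ℝ, ℝ)} {L : NNReal}

/-- The discretisation of the ridgelet coefficient of `χ f` on the grid. -/
def gridCoefficient (S : ℝ) (χ : E d → ℝ) (n : ℕ) (f : E d → ℝ) (ψ : ℝ → ℝ) (θ : E d × ℝ) : ℝ :=
  ∑ j, gridWeight S χ n j * f (gridNode S n j) * ψ (inner ℝ θ.1 (gridNode S n j) + θ.2)

theorem continuous_gridCoefficient (n : ℕ) : Continuous (gridCoefficient S χ n f ψ) := by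
  have := ψ.continuous
  unfold gridCoefficient
  fun_prop

theorem abs_mollified_le (hχ : IsMollifier S 𝒳 χ) (hM : M1Star S f < ∞) (y : E d) :
    |χ y * f y| ≤ χ y * (M1Star S f).toReal := by
  have h0 := (hχ.mem_Icc y).1
  by_cases hy : y ∈ cube d S
  · rw [abs_mul, abs_of_nonneg h0]
    gcongr
    exact abs_le_M1Star hM hy
  · simp [hχ.eq_zero y hy]

theorem abs_mollified_le' (hχ : IsMollifier S 𝒳 χ) (hM : M1Star S f < ∞) (y : E d) :
    |χ y * f y| ≤ (M1Star S f).toReal :=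
  (abs_mollified_le hχ hM y).trans
    (mul_le_of_le_one_left ENNReal.toReal_nonneg (hχ.mem_Icc y).2)

theorem gridCoefficient_eq (n : ℕ) (θ : E d × ℝ) : gridCoefficient S χ n f ψ θ =
    ∑ j : Fin d → Fin n, (2 * S / n) ^ d * (χ (gridNode S n j) * f (gridNode S n j) *
      ψ (inner ℝ θ.1 (gridNode S n j) + θ.2)) := by
  refine Finset.sum_congr rfl fun j _ => ?_
  rw [gridWeight, div_pow]
  push_cast
  ring

theorem sum_grid_const {n : ℕ} (hn : 1 ≤ n) (c : ℝ) :
    ∑ _j : Fin d → Fin n, (2 * S / n) ^ d * c = (2 * S) ^ d * c := by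
  have hn' : (0 : ℝ) < n := by exact_mod_cast hn
  simp only [Finset.sum_const, Finset.card_univ, Fintype.card_fun, Fintype.card_fin,
    nsmul_eq_mul]
  push_cast
  rw [div_pow]
  field_simp

/-- The values of ψ are kept, since the second moment estimate needs their decay;
`abs_gridCoefficient_le` is the cruder uniform version. -/
theorem abs_gridCoefficient_mul_le (hS : 0 ≤ S) (hχ : IsMollifier S 𝒳 χ) (hM : M1Star S f < ∞)
    (n : ℕ) (θ : E d × ℝ) : |gridCoefficient S χ n f ψ θ| ≤ (M1Star S f).toReal *
      ∑ j : Fin d → Fin n, (2 * S / n) ^ d * |ψ (inner ℝ θ.1 (gridNode S n j) + θ.2)| := by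
  rw [gridCoefficient_eq, Finset.mul_sum]
  refine (Finset.abs_sum_le_sum_abs _ _).trans (Finset.sum_le_sum fun j _ => ?_)
  rw [abs_mul, abs_mul (χ _ * _), abs_of_nonneg (by positivity : 0 ≤ (2 * S / n) ^ d)]
  calc _ ≤ (2 * S / n) ^ d * ((M1Star S f).toReal *
        |ψ (inner ℝ θ.1 (gridNode S n j) + θ.2)|) := by
        gcongr; exact abs_mollified_le' hχ hM _
    _ = _ := by ring

theorem abs_gridCoefficient_le (hS : 0 ≤ S) (hχ : IsMollifier S 𝒳 χ) (hM : M1Star S f < ∞)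
    {n : ℕ} (hn : 1 ≤ n) {c : ℝ} (hc : ∀ s, |ψ s| ≤ c) (θ : E d × ℝ) :
    |gridCoefficient S χ n f ψ θ| ≤ (M1Star S f).toReal * ((2 * S) ^ d * c) := by
  refine (abs_gridCoefficient_mul_le hS hχ hM n θ).trans ?_
  rw [← sum_grid_const hn]
  gcongr
  exact hc _

theorem exists_abs_le_schwartz (ψ : 𝓢(ℝ, ℝ)) : ∃ c, 0 < c ∧ ∀ s, |ψ s| ≤ c := by
  obtain ⟨c, hc0, hc⟩ := exists_one_add_abs_mul_le ψ
  exact ⟨c + 1, by positivity, fun s => ((le_mul_of_one_le_left (abs_nonneg _) (by simp)).trans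
    (hc s)).trans (by simp)⟩

theorem exists_lipschitz_schwartz (ψ : 𝓢(ℝ, ℝ)) :
    ∃ c, 0 ≤ c ∧ ∀ s t, |ψ s - ψ t| ≤ c * |s - t| := by
  obtain ⟨c, hc0, hc⟩ := ψ.decay 0 1
  simp only [pow_zero, one_mul, norm_iteratedFDeriv_one] at hc
  refine ⟨c, hc0.le, fun s t => ?_⟩
  simpa [Real.norm_eq_abs] using Convex.norm_image_sub_le_of_norm_fderiv_le (𝕜 := ℝ)
    (f := ψ) (fun z _ => ψ.differentiableAt) (fun z _ => hc z) convex_univ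
    (mem_univ t) (mem_univ s)

theorem integrable_mollified (hS : 0 ≤ S) (hχ : IsMollifier S 𝒳 χ) (hf : Continuous f) :
    Integrable fun y => χ y * f y := by
  refine (hχ.smooth.continuous.mul hf).integrable_of_hasCompactSupport ?_
  exact HasCompactSupport.intro (isCompact_cube hS) fun y hy => by simp [hχ.eq_zero y hy]

theorem integrable_mollifier (hS : 0 ≤ S) (hχ : IsMollifier S 𝒳 χ) : Integrable χ := by
  simpa using integrable_mollified (f := fun _ => 1) hS hχ continuous_const

/-- The error of discretising the ridgelet coefficient. -/
theorem exists_abs_coefficient_sub_grid_le (hS : 0 < S) (hχ : IsMollifier S 𝒳 χ)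
    (ψ : 𝓢(ℝ, ℝ)) : ∃ C, 0 ≤ C ∧ ∀ f : E d → ℝ, ContDiff ℝ 1 f → M1Star S f < ∞ →
      ∀ n : ℕ, 1 ≤ n → ∀ θ : E d × ℝ,
      |coefficient (fun y => χ y * f y) ψ θ - gridCoefficient S χ n f ψ θ| ≤
        C * (M1Star S f).toReal * (1 + ‖θ.1‖) / n := by
  obtain ⟨K, hK0, hK⟩ := hχ.exists_lipschitz_mul hS.le
  obtain ⟨c0, hc0, hψ0⟩ := exists_abs_le_schwartz ψ
  obtain ⟨c1, hc1, hψ1⟩ := exists_lipschitz_schwartz ψ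
  refine ⟨(K * c0 + c1) * (√d * (2 * S)) * (2 * S) ^ d, by positivity, fun f hf hM n hn θ => ?_⟩
  set M := (M1Star S f).toReal
  have hM0 : 0 ≤ M := ENNReal.toReal_nonneg
  set G : E d → ℝ := fun y => χ y * f y * ψ (inner ℝ θ.1 y + θ.2)
  -- Product rule for differences; the factor ‖w‖ is the Lipschitz constant of y ↦ w·y+b.
  have hGL (y z : E d) : |G y - G z| ≤ (K * c0 + c1) * M * (1 + ‖θ.1‖) * ‖y - z‖ := by
    have e : G y - G z = (χ y * f y - χ z * f z) * ψ (inner ℝ θ.1 y + θ.2) +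
        χ z * f z * (ψ (inner ℝ θ.1 y + θ.2) - ψ (inner ℝ θ.1 z + θ.2)) := by
      simp only [G]; ring
    have h2 : |ψ (inner ℝ θ.1 y + θ.2) - ψ (inner ℝ θ.1 z + θ.2)| ≤ c1 * (‖θ.1‖ * ‖y - z‖) := by
      refine (hψ1 _ _).trans ?_
      rw [add_sub_add_right_eq_sub, ← inner_sub_right]
      gcongr
      exact abs_real_inner_le_norm _ _
    rw [e]
    refine (abs_add_le _ _).trans ?_
    rw [abs_mul, abs_mul (χ z * f z)]
    calc _ ≤ K * M * ‖y - z‖ * c0 + M * (c1 * (‖θ.1‖ * ‖y - z‖)) := by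
          refine add_le_add (mul_le_mul (hK f hf hM y z) (hψ0 _) (abs_nonneg _) (by positivity))
            (mul_le_mul (abs_mollified_le' hχ hM z) h2 (abs_nonneg _) hM0)
      _ ≤ _ := by
          have h3 : 0 ≤ K * c0 * M * ‖θ.1‖ * ‖y - z‖ := by positivity
          have h4 : 0 ≤ c1 * M * ‖y - z‖ := by positivity
          nlinarith
  have hG0 (y : E d) (hy : y ∉ cube d S) : G y = 0 := by simp [G, hχ.eq_zero y hy]
  have hGc : Continuous G := by
    have := ψ.continuous
    have := hχ.smooth.continuous
    have := hf.continuous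
    fun_prop
  have hGi : Integrable G := hGc.integrable_of_hasCompactSupport
    (HasCompactSupport.intro (isCompact_cube hS.le) hG0)
  rw [gridCoefficient_eq]
  refine (abs_integral_sub_grid_sum_le hS hn hGL hG0 (by positivity) hGi).trans_eq ?_
  ring

theorem abs_neuron_le_mul (hL : LipschitzWith L φ) {R : ℝ} {x : E d} (hx : ‖x‖ ≤ R)
    (θ : E d × ℝ) : |φ (inner ℝ θ.1 x + θ.2)| ≤
      (|φ 0| + L) * (1 + R) * ((1 + ‖θ.1‖) * (1 + ‖θ.2‖)) := by
  have hR : 0 ≤ R := (norm_nonneg _).trans hx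
  refine (abs_le_of_lipschitz hL _).trans ?_
  rw [mul_assoc]
  gcongr
  have h1 : |inner ℝ θ.1 x| ≤ ‖θ.1‖ * R := (abs_real_inner_le_norm _ _).trans (by gcongr)
  have h2 := abs_add_le (inner ℝ θ.1 x) θ.2
  have hw := norm_nonneg θ.1
  have hb := norm_nonneg θ.2
  rw [Real.norm_eq_abs] at hb ⊢
  nlinarith [mul_nonneg hR hw, mul_nonneg hR hb, mul_nonneg hw hb,
    mul_nonneg (mul_nonneg hR hw) hb]

theorem totalMass_eq (pw : E d → ℝ) (pb : ℝ → ℝ) (σw σb : ℝ) : totalMass pw pb σw σb =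
    totalMass pw pb 1 1 * (σw ^ d * σb) := by
  simp only [totalMass]; ring

theorem totalMass_pos {pw : E d → ℝ} {pb : ℝ → ℝ} (hp : IsFiniteBandwidth pw pb) {σw σb : ℝ}
    (hσw : 0 < σw) (hσb : 0 < σb) : 0 < totalMass pw pb σw σb := by
  have h1 := hp.regular_w.integral_norm_fourier_pos
  have h2 := hp.regular_b.integral_norm_fourier_pos
  unfold totalMass
  positivity

/-- The error of the expectation of the discretised ridgelet operator. -/
theorem exists_mean_bound (hS : 0 < S) (hχ : IsMollifier S 𝒳 χ) (hφψ : IsRidgeletPair d φ φhat ψ)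
    (hL : LipschitzWith L φ) {pw : E d → ℝ} {pb : ℝ → ℝ} (hp : IsFiniteBandwidth pw pb) :
    ∃ C, 0 ≤ C ∧ ∀ f : E d → ℝ, ContDiff ℝ 1 f → M1Star S f < ∞ → ∀ x ∈ cube d S,
      ∀ σw σb : ℝ, 0 < σw → 0 < σb → ∀ n : ℕ, 1 ≤ n →
      |totalMass pw pb σw σb * (∫ θ, gridCoefficient S χ n f ψ θ * φ (inner ℝ θ.1 x + θ.2)
          ∂(scaledLaw σw pw).prod (scaledLaw σb pb)) - χ x * f x| ≤
        C * (M1Star S f).toReal * (1 / σw + σw ^ d * (σw + 1) ^ 2 / σb +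
          σb * (σb + 1) * σw ^ d * (σw + 1) ^ 2 / n) := by
  have hw := hp.regular_w
  have hb := hp.regular_b
  set R := √d * S
  have hR : 0 ≤ R := by positivity
  obtain ⟨K, hK0, hK⟩ := hχ.exists_lipschitz_mul hS.le
  obtain ⟨C1, hC1, hbias⟩ := exists_bias_bound hφψ hL hp hR
  obtain ⟨C2, hC2, hdisc⟩ := exists_abs_coefficient_sub_grid_le hS hχ ψ
  obtain ⟨cw, hcw0, hcw⟩ := exists_integral_one_add_norm_sq_scaledLaw_le hw
  obtain ⟨cb, hcb0, hcb⟩ := exists_integral_one_add_norm_scaledLaw_le hb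
  obtain ⟨c0, hc0, hψ0⟩ := exists_abs_le_schwartz ψ
  set X : ℝ := ∫ y, χ y
  have hX : 0 ≤ X := integral_nonneg fun y => (hχ.mem_Icc y).1
  set Z1 := totalMass pw pb 1 1
  have hZ1 : 0 ≤ Z1 := (totalMass_pos hp one_pos one_pos).le
  set A : ℝ := (|φ 0| + L) * (1 + R)
  have hA : 0 ≤ A := by positivity
  refine ⟨C1 * K + C1 * X + Z1 * (C2 * A * (cw * cb)), by positivity, ?_⟩
  intro f hf hM x hx σw σb hσw hσb n hn
  have hn' : (0 : ℝ) < n := by exact_mod_cast hn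
  have := isProbabilityMeasure_scaledLaw hσw hw
  have := isProbabilityMeasure_scaledLaw hσb hb
  set μ := (scaledLaw σw pw).prod (scaledLaw σb pb)
  set M := (M1Star S f).toReal
  have hM0 : 0 ≤ M := ENNReal.toReal_nonneg
  have hxR : ‖x‖ ≤ R := norm_le_of_mem_cube hS.le hx
  set g : E d → ℝ := fun y => χ y * f y
  have hgc : Continuous g := hχ.smooth.continuous.mul hf.continuous
  have hgi : Integrable g := integrable_mollified hS.le hχ hf.continuous
  have hgR (y : E d) (hy : g y ≠ 0) : ‖y‖ ≤ R := by
    refine norm_le_of_mem_cube hS.le ?_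
    by_contra h
    exact hy (by simp [g, hχ.eq_zero y h])
  have hgint : ∫ y, |g y| ≤ X * M := by
    rw [← integral_mul_const]
    exact integral_mono hgi.abs ((integrable_mollifier hS.le hχ).mul_const M)
      fun y => abs_mollified_le hχ hM y
  have hb1 := hbias g (K * M) (by positivity) hgi hgc (hK f hf hM) hgR x hxR σw σb hσw hσb
  have hI1 : Integrable (fun θ => coefficient g ψ θ * φ (inner ℝ θ.1 x + θ.2)) μ :=
    integrable_coefficient_mul_neuron hw hb hL hgi hgc hgR hxR hσw hσb
  have hdom := integrable_prod_scaledLaw hw hb hσw hσb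
  have hφ := hL.continuous
  have hI2 : Integrable (fun θ => gridCoefficient S χ n f ψ θ * φ (inner ℝ θ.1 x + θ.2)) μ := by
    refine (hdom.const_mul (M * ((2 * S) ^ d * c0) * A)).mono' ?_ (ae_of_all _ fun θ => ?_)
    · have := continuous_gridCoefficient (S := S) (χ := χ) (f := f) (ψ := ψ) n
      exact (by fun_prop : Continuous _).aestronglyMeasurable
    · rw [norm_mul, Real.norm_eq_abs, Real.norm_eq_abs]
      calc _ ≤ M * ((2 * S) ^ d * c0) * (A * ((1 + ‖θ.1‖) * (1 + ‖θ.2‖))) :=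
            mul_le_mul (abs_gridCoefficient_le hS.le hχ hM hn hψ0 θ) (abs_neuron_le_mul hL hxR θ)
              (abs_nonneg _) (by positivity)
        _ ≤ M * ((2 * S) ^ d * c0) * (A * ((1 + ‖θ.1‖) ^ 2 * (1 + ‖θ.2‖))) := by
            gcongr
            exact le_self_pow₀ (by simp) two_ne_zero
        _ = _ := by ring
  -- One factor 1+‖w‖ comes from the quadrature error, the other and 1+|b| from the growth of φ;
  -- averaging gives (1+σ_w)²(1+σ_b), and Z adds σ_w^d σ_b.
  have hd1 : |(∫ θ, gridCoefficient S χ n f ψ θ * φ (inner ℝ θ.1 x + θ.2) ∂μ) -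
      ∫ θ, coefficient g ψ θ * φ (inner ℝ θ.1 x + θ.2) ∂μ| ≤
      C2 * M / n * A * (cw * (1 + σw) ^ 2 * (cb * (1 + σb))) := by
    rw [← integral_sub hI2 hI1, ← Real.norm_eq_abs]
    refine (norm_integral_le_of_norm_le (hdom.const_mul (C2 * M / n * A))
      (ae_of_all _ fun θ => ?_)).trans ?_
    · rw [← sub_mul, norm_mul, Real.norm_eq_abs, Real.norm_eq_abs, abs_sub_comm]
      calc _ ≤ (C2 * M * (1 + ‖θ.1‖) / n) * (A * ((1 + ‖θ.1‖) * (1 + ‖θ.2‖))) :=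
            mul_le_mul (hdisc f hf hM n hn θ) (abs_neuron_le_mul hL hxR θ)
              (abs_nonneg _) (by positivity)
        _ = _ := by ring
    · rw [integral_const_mul]
      have hprod : ∫ θ : E d × ℝ, (1 + ‖θ.1‖) ^ 2 * (1 + ‖θ.2‖) ∂μ =
          (∫ w, (1 + ‖w‖) ^ 2 ∂scaledLaw σw pw) * ∫ b, (1 + ‖b‖) ∂scaledLaw σb pb :=
        integral_prod_mul (fun w : E d => (1 + ‖w‖) ^ 2) fun b : ℝ => 1 + ‖b‖
      rw [hprod]
      gcongr
      · exact hcw σw hσw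
      · exact hcb σb hσb
  set I2 := ∫ θ, gridCoefficient S χ n f ψ θ * φ (inner ℝ θ.1 x + θ.2) ∂μ
  set I1 := ∫ θ, coefficient g ψ θ * φ (inner ℝ θ.1 x + θ.2) ∂μ
  have hZ := totalMass_eq pw pb σw σb
  have hZ0 := (totalMass_pos hp hσw hσb).le
  set Z := totalMass pw pb σw σb
  have e : Z * I2 - χ x * f x = Z * (I2 - I1) + (Z * I1 - g x) := by simp only [g]; ring
  set T1 := 1 / σw
  set T2 := σw ^ d * (σw + 1) ^ 2 / σb
  set T3 := σb * (σb + 1) * σw ^ d * (σw + 1) ^ 2 / n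
  have hT1 : 0 ≤ T1 := by positivity
  have hT2 : 0 ≤ T2 := by positivity
  have hT3 : 0 ≤ T3 := by positivity
  rw [e]
  refine (abs_add_le _ _).trans ?_
  rw [abs_mul, abs_of_nonneg hZ0]
  calc _ ≤ Z1 * (σw ^ d * σb) * (C2 * M / n * A * (cw * (1 + σw) ^ 2 * (cb * (1 + σb)))) +
        C1 * (K * M / σw + X * M * T2) := by
        rw [← hZ]
        refine add_le_add (by gcongr) (hb1.trans (by gcongr))
    _ = Z1 * (C2 * A * (cw * cb)) * M * T3 + C1 * K * M * T1 + C1 * X * M * T2 := by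
        simp only [T3, T1]; field_simp; ring
    _ ≤ (C1 * K + C1 * X + Z1 * (C2 * A * (cw * cb))) * M * T3 +
        (C1 * K + C1 * X + Z1 * (C2 * A * (cw * cb))) * M * T1 +
        (C1 * K + C1 * X + Z1 * (C2 * A * (cw * cb))) * M * T2 := by
        have h1 : 0 ≤ C1 * K := by positivity
        have h2 : 0 ≤ C1 * X := by positivity
        have h3 : 0 ≤ Z1 * (C2 * A * (cw * cb)) := by positivity
        gcongr <;> linarith
    _ = _ := by ring

end GridCoefficient

/-! ### Rademacher sums and contraction. -/

section Rademacher

/-- The sign `±1` attached to a Boolean. -/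
def sgn (b : Bool) : ℝ := if b then 1 else -1

@[simp] theorem sgn_true : sgn true = 1 := rfl
@[simp] theorem sgn_false : sgn false = -1 := rfl
theorem abs_sgn (b : Bool) : |sgn b| = 1 := by cases b <;> simp

theorem sum_fin_succ_bool {M : Type*} [AddCommMonoid M] {n : ℕ} (F : (Fin (n + 1) → Bool) → M) :
    ∑ ε, F ε = ∑ ε : Fin n → Bool, (F (Fin.cons true ε) + F (Fin.cons false ε)) := by
  rw [← (Fin.consEquiv fun _ => Bool).sum_comp, Fintype.sum_prod_type, Fintype.sum_bool,
    ← Finset.sum_add_distrib]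
  rfl

/-- Orthogonality of signs, by induction: the two values of the first sign pair up under the
parallelogram law. The offset `u` carries the induction. -/
theorem sum_signs_norm_sq {H : Type*} [NormedAddCommGroup H] [InnerProductSpace ℝ H] {n : ℕ}
    (u : H) (v : Fin n → H) :
    ∑ ε : Fin n → Bool, ‖u + ∑ i, sgn (ε i) • v i‖ ^ 2 = 2 ^ n * (‖u‖ ^ 2 + ∑ i, ‖v i‖ ^ 2) := by
  induction n generalizing u with
  | zero => simp
  | succ n ih =>
    rw [sum_fin_succ_bool]
    simp only [Fin.sum_univ_succ, Fin.cons_zero, Fin.cons_succ, sgn_true, sgn_false, one_smul,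
      neg_smul, ← add_assoc]
    rw [Finset.sum_add_distrib, ih, ih]
    have := parallelogram_law_with_norm ℝ u (v 0)
    rw [← sub_eq_add_neg, pow_succ (2 : ℝ) n]
    linear_combination 2 ^ n * this

theorem sum_signs_norm_le {H : Type*} [NormedAddCommGroup H] [InnerProductSpace ℝ H] {n : ℕ}
    (v : Fin n → H) :
    ∑ ε : Fin n → Bool, ‖∑ i, sgn (ε i) • v i‖ ≤ 2 ^ n * √(∑ i, ‖v i‖ ^ 2) := by
  have h := sum_signs_norm_sq 0 v
  have h2 := sq_sum_le_card_mul_sum_sq (s := (Finset.univ : Finset (Fin n → Bool)))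
    (f := fun ε => ‖∑ i, sgn (ε i) • v i‖)
  simp only [zero_add, norm_zero, ne_eq, OfNat.ofNat_ne_zero, not_false_eq_true, zero_pow] at h
  simp only [h, Finset.card_univ, Fintype.card_fun, Fintype.card_bool, Fintype.card_fin] at h2
  refine abs_le_of_sq_le_sq' ?_ (by positivity) |>.2
  rw [mul_pow, Real.sq_sqrt (by positivity)]
  push_cast at h2
  linarith

variable {T : Type*}

/-- For a pair s, t the left side is at most B s + B t + |z s - z t|, and the sign of z s - z t
decides which point is placed in which supremum on the right. -/
theorem ciSup_contraction_step [Nonempty T] {B c z : T → ℝ} (hp : BddAbove (range (B + z)))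
    (hm : BddAbove (range (B - z))) (hcz : ∀ s t, |c s - c t| ≤ |z s - z t|) :
    (⨆ t, (B t + c t)) + (⨆ t, (B t - c t)) ≤ (⨆ t, (B t + z t)) + ⨆ t, (B t - z t) := by
  refine ciSup_add_ciSup_le fun s t => ?_
  have h1 (t) : B t + z t ≤ ⨆ t, (B t + z t) := le_ciSup hp t
  have h2 (t) : B t - z t ≤ ⨆ t, (B t - z t) := le_ciSup hm t
  have h3 := (le_abs_self _).trans (hcz s t)
  rcases abs_cases (z s - z t) with h | h <;> linarith [h1 s, h2 s, h1 t, h2 t]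

theorem bddAbove_of_abs_le {f : T → ℝ} {C : ℝ} (h : ∀ t, |f t| ≤ C) : BddAbove (range f) :=
  ⟨C, by rintro _ ⟨t, rfl⟩; exact (le_abs_self _).trans (h t)⟩

/-- The contraction principle for Rademacher sums. -/
theorem sum_signs_ciSup_le [Nonempty T] {n : ℕ} {A : T → ℝ} {c z : Fin n → T → ℝ}
    (hA : ∃ C, ∀ t, |A t| ≤ C) (hc : ∀ i, ∃ C, ∀ t, |c i t| ≤ C)
    (hz : ∀ i, ∃ C, ∀ t, |z i t| ≤ C) (hcz : ∀ i s t, |c i s - c i t| ≤ |z i s - z i t|) :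
    ∑ ε : Fin n → Bool, ⨆ t, (A t + ∑ i, sgn (ε i) * c i t) ≤
      ∑ ε : Fin n → Bool, ⨆ t, (A t + ∑ i, sgn (ε i) * z i t) := by
  induction n generalizing A with
  | zero => simp
  | succ n ih =>
    obtain ⟨CA, hCA⟩ := hA
    obtain ⟨Cc, hCc⟩ := hc 0
    choose Cz hCz using hz
    have hsum (ε : Fin n → Bool) (t : T) :
        |∑ i, sgn (ε i) * z i.succ t| ≤ ∑ i : Fin n, Cz i.succ :=
      (Finset.abs_sum_le_sum_abs _ _).trans <| Finset.sum_le_sum fun i _ => by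
        rw [abs_mul, abs_sgn, one_mul]; exact hCz _ t
    have hB (ε : Fin n → Bool) (t : T) :
        |A t + ∑ i, sgn (ε i) * z i.succ t| ≤ CA + ∑ i : Fin n, Cz i.succ :=
      (abs_add_le _ _).trans (add_le_add (hCA t) (hsum ε t))
    rw [sum_fin_succ_bool, sum_fin_succ_bool]
    simp only [Fin.sum_univ_succ, Fin.cons_zero, Fin.cons_succ, sgn_true, sgn_false, one_mul,
      neg_mul, ← add_assoc]
    -- The induction hypothesis, with ±`c 0` absorbed into the offset, replaces all later
    -- coordinates; the one-step lemma then replaces coordinate 0.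
    calc _ ≤ ∑ ε : Fin n → Bool, ((⨆ t, (A t + c 0 t + ∑ i, sgn (ε i) * z i.succ t)) +
          ⨆ t, (A t + -c 0 t + ∑ i, sgn (ε i) * z i.succ t)) := by
          rw [Finset.sum_add_distrib, Finset.sum_add_distrib]
          refine add_le_add ?_ ?_
          · exact ih ⟨CA + Cc, fun t => (abs_add_le _ _).trans (add_le_add (hCA t) (hCc t))⟩
              (fun i => hc _) (fun i => ⟨_, hCz i.succ⟩) (fun i => hcz _)
          · exact ih ⟨CA + Cc, fun t => (abs_add_le _ _).trans
              (add_le_add (hCA t) (by rw [abs_neg]; exact hCc t))⟩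
              (fun i => hc _) (fun i => ⟨_, hCz i.succ⟩) (fun i => hcz _)
      _ ≤ _ := by
          refine Finset.sum_le_sum fun ε _ => ?_
          have := ciSup_contraction_step (B := fun t => A t + ∑ i, sgn (ε i) * z i.succ t)
            (c := c 0) (z := z 0)
            (bddAbove_of_abs_le fun t => (abs_add_le _ _).trans (add_le_add (hB ε t) (hCz 0 t)))
            (bddAbove_of_abs_le fun t => (abs_sub _ _).trans (add_le_add (hB ε t) (hCz 0 t)))
            (hcz 0)
          simpa only [add_right_comm, ← sub_eq_add_neg, sub_add_eq_add_sub] using this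

/-- A uniform bound for the Rademacher sums of functions dominated by inner products. -/
theorem exists_signs_bound {H : Type*} [NormedAddCommGroup H] [InnerProductSpace ℝ H]
    {s : Set H} (h0 : (0 : H) ∈ s) {R : ℝ} (hR : ∀ x ∈ s, ‖x‖ ≤ R) {n : ℕ} (v : Fin n → H)
    {c : Fin n → H → ℝ} (hc0 : ∀ i, c i 0 = 0)
    (hc : ∀ i, ∀ x ∈ s, ∀ y ∈ s, |c i x - c i y| ≤ |inner ℝ (v i) x - inner ℝ (v i) y|) :
    ∃ U : (Fin n → Bool) → ℝ, (∀ ε, 0 ≤ U ε) ∧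
      (∀ ε, ∀ x ∈ s, |∑ i, sgn (ε i) * c i x| ≤ U ε) ∧
      ∑ ε, U ε ≤ 2 ^ n * (2 * R * √(∑ i, ‖v i‖ ^ 2)) := by
  have hR0 : 0 ≤ R := (norm_nonneg _).trans (hR 0 h0)
  have : Nonempty s := ⟨⟨0, h0⟩⟩
  have hzb (i : Fin n) (x : s) : |inner ℝ (v i) (x : H)| ≤ ‖v i‖ * R :=
    (abs_real_inner_le_norm _ _).trans (by gcongr; exact hR _ x.2)
  have hcb (i : Fin n) (x : s) : |c i x| ≤ ‖v i‖ * R := by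
    have := hc i x x.2 0 h0
    rw [hc0, sub_zero, inner_zero_right, sub_zero] at this
    exact this.trans (hzb i x)
  have hb (ε : Fin n → Bool) (x : s) : |∑ i, sgn (ε i) * c i x| ≤ ∑ i, ‖v i‖ * R :=
    (Finset.abs_sum_le_sum_abs _ _).trans <| Finset.sum_le_sum fun i _ => by
      rw [abs_mul, abs_sgn, one_mul]; exact hcb i x
  -- Contraction bounds one-sided suprema only, so c and -c are treated separately. Both suprema are
  -- nonnegative because c vanishes at 0 ∈ s, so their sum dominates the absolute value; this costs
  -- the factor 2.
  set P : (Fin n → Bool) → ℝ := fun ε => ⨆ x : s, (0 + ∑ i, sgn (ε i) * c i x)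
  set Q : (Fin n → Bool) → ℝ := fun ε => ⨆ x : s, (0 + ∑ i, sgn (ε i) * (-c i x))
  have hPle (ε) (x : s) : ∑ i, sgn (ε i) * c i x ≤ P ε := by
    refine (zero_add (∑ i, sgn (ε i) * c i x)).ge.trans ?_
    exact le_ciSup (f := fun x : s => 0 + ∑ i, sgn (ε i) * c i x)
      (bddAbove_of_abs_le fun x => by rw [zero_add]; exact hb ε x) x
  have hQle (ε) (x : s) : -∑ i, sgn (ε i) * c i x ≤ Q ε := by
    refine (le_of_eq ?_).trans (le_ciSup (f := fun x : s => 0 + ∑ i, sgn (ε i) * (-c i x))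
      (bddAbove_of_abs_le (C := ∑ i, ‖v i‖ * R) fun x => ?_) x)
    · simp
    · simp only [mul_neg, Finset.sum_neg_distrib, zero_add, abs_neg]; exact hb ε x
  have hP0 (ε) : 0 ≤ P ε := by simpa [hc0] using hPle ε ⟨0, h0⟩
  have hQ0 (ε) : 0 ≤ Q ε := by simpa [hc0] using hQle ε ⟨0, h0⟩
  have hlin : ∑ ε : Fin n → Bool, ⨆ x : s, (0 + ∑ i, sgn (ε i) * inner ℝ (v i) (x : H)) ≤
      2 ^ n * (R * √(∑ i, ‖v i‖ ^ 2)) := by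
    calc _ ≤ ∑ ε : Fin n → Bool, R * ‖∑ i, sgn (ε i) • v i‖ := by
          refine Finset.sum_le_sum fun ε _ => ciSup_le fun x => ?_
          have h : ∑ i, sgn (ε i) * inner ℝ (v i) (x : H) =
              inner ℝ (∑ i, sgn (ε i) • v i) (x : H) := by
            simp [sum_inner, inner_smul_left]
          rw [zero_add, h, mul_comm]
          exact (real_inner_le_norm _ _).trans (by gcongr; exact hR _ x.2)
      _ ≤ R * (2 ^ n * √(∑ i, ‖v i‖ ^ 2)) := by
          rw [← Finset.mul_sum]; gcongr; exact sum_signs_norm_le v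
      _ = _ := by ring
  refine ⟨fun ε => P ε + Q ε, fun ε => add_nonneg (hP0 ε) (hQ0 ε), fun ε x hx => ?_, ?_⟩
  · rw [abs_le]
    constructor <;> linarith [hPle ε ⟨x, hx⟩, hQle ε ⟨x, hx⟩, hP0 ε, hQ0 ε]
  · rw [Finset.sum_add_distrib]
    have e1 := sum_signs_ciSup_le (T := s) (A := fun _ => 0) (c := fun i x => c i x)
      (z := fun i x => inner ℝ (v i) (x : H)) ⟨0, by simp⟩ (fun i => ⟨_, hcb i⟩)
      (fun i => ⟨_, hzb i⟩) (fun i x y => hc i x x.2 y y.2)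
    have e2 := sum_signs_ciSup_le (T := s) (A := fun _ => 0) (c := fun i x => -c i x)
      (z := fun i x => inner ℝ (v i) (x : H)) ⟨0, by simp⟩
      (fun i => ⟨_, fun x => by rw [abs_neg]; exact hcb i x⟩)
      (fun i => ⟨_, hzb i⟩) (fun i x y => by
        rw [neg_sub_neg, abs_sub_comm]; exact hc i x x.2 y y.2)
    calc _ ≤ _ := add_le_add (e1.trans hlin) (e2.trans hlin)
      _ = _ := by ring

end Rademacher

/-! ### Symmetrisation and the uniform fluctuation of neurons. -/

section Symmetrisation

variable {X T : Type*} [MeasurableSpace X] [Countable T]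

/-- Symmetrisation of the empirical process indexed by a countable family of functions. -/
theorem lintegral_iSup_centred_le (μ : Measure X) [IsProbabilityMeasure μ] {h : T → X → ℝ}
    (hm : ∀ t, Measurable (h t)) (hi : ∀ t, Integrable (h t) μ) (N : ℕ) :
    2 ^ N * ∫⁻ θ, ⨆ t, ‖∑ i : Fin N, (h t (θ i) - ∫ y, h t y ∂μ)‖ₑ ∂Measure.pi (fun _ => μ) ≤
      2 * ∑ ε : Fin N → Bool, ∫⁻ θ, ⨆ t, ‖∑ i, sgn (ε i) * h t (θ i)‖ₑ
        ∂Measure.pi (fun _ => μ) := by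
  set ν : Measure (Fin N → X) := Measure.pi (fun _ => μ)
  set ρ : Measure (Fin N → X × X) := Measure.pi (fun _ => μ.prod μ)
  have hfst : MeasurePreserving (fun η : Fin N → X × X => fun i => (η i).1) ρ ν :=
    measurePreserving_pi _ _ fun _ => measurePreserving_fst
  have hsnd : MeasurePreserving (fun η : Fin N → X × X => fun i => (η i).2) ρ ν :=
    measurePreserving_pi _ _ fun _ => measurePreserving_snd
  set F : (Fin N → X × X) → ℝ≥0∞ := fun η => ⨆ t, ‖∑ i, (h t (η i).1 - h t (η i).2)‖ₑ
  have hF : Measurable F := Measurable.iSup fun t => by fun_prop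
  have hG (ε : Fin N → Bool) :
      Measurable fun θ : Fin N → X => ⨆ t, ‖∑ i, sgn (ε i) * h t (θ i)‖ₑ :=
    Measurable.iSup fun t => by fun_prop
  -- The mean is the integral over an independent copy θ', and a supremum of integrals is at most
  -- the integral of the supremum.
  have step1 (θ : Fin N → X) : (⨆ t, ‖∑ i : Fin N, (h t (θ i) - ∫ y, h t y ∂μ)‖ₑ) ≤
      ∫⁻ θ', ⨆ t, ‖∑ i, (h t (θ i) - h t (θ' i))‖ₑ ∂ν := by
    refine iSup_le fun t => ?_
    have hint (i : Fin N) : Integrable (fun θ' : Fin N → X => h t (θ' i)) ν :=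
      (measurePreserving_eval (fun _ : Fin N => μ) i).integrable_comp_of_integrable (hi t)
    have heq : ∑ i : Fin N, (h t (θ i) - ∫ y, h t y ∂μ) =
        ∫ θ', ∑ i, (h t (θ i) - h t (θ' i)) ∂ν := by
      have hint' (i : Fin N) : Integrable (fun θ' : Fin N → X => h t (θ i) - h t (θ' i)) ν :=
        (integrable_const _).sub (hint i)
      rw [integral_finsetSum _ fun i _ => hint' i]
      refine Finset.sum_congr rfl fun i _ => ?_
      rw [integral_sub (integrable_const _) (hint i), integral_const]
      simp only [probReal_univ, one_smul]
      rw [integral_comp_eval (μ := fun _ : Fin N => μ) (i := i) (hm t).aestronglyMeasurable]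
    rw [heq]
    exact (enorm_integral_le_lintegral_enorm _).trans
      (lintegral_mono fun θ' => le_iSup (fun t => ‖∑ i, (h t (θ i) - h t (θ' i))‖ₑ) t)
  have step2 : ∫⁻ θ, ⨆ t, ‖∑ i : Fin N, (h t (θ i) - ∫ y, h t y ∂μ)‖ₑ ∂ν ≤ ∫⁻ η, F η ∂ρ := by
    refine (lintegral_mono step1).trans_eq ?_
    have hmeas : Measurable fun q : (Fin N → X) × (Fin N → X) =>
        ⨆ t, ‖∑ i, (h t (q.1 i) - h t (q.2 i))‖ₑ := Measurable.iSup fun t => by fun_prop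
    rw [← lintegral_prod _ hmeas.aemeasurable]
    exact ((measurePreserving_arrowProdEquivProdArrow X X (Fin N) (fun _ => μ)
      (fun _ => μ)).lintegral_comp hmeas).symm
  -- Exchanging the two copies at the indices with negative sign preserves ρ and inserts the signs;
  -- the triangle inequality then separates the copies.
  have step3 (ε : Fin N → Bool) : ∫⁻ η, F η ∂ρ ≤
      2 * ∫⁻ θ, ⨆ t, ‖∑ i, sgn (ε i) * h t (θ i)‖ₑ ∂ν := by
    have hS : MeasurePreserving
        (fun η : Fin N → X × X => fun i => if ε i then η i else (η i).swap) ρ ρ := by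
      refine measurePreserving_pi _ _ (f := fun i (z : X × X) => if ε i then z else z.swap) fun i => ?_
      cases ε i
      · simpa using Measure.measurePreserving_swap (μ := μ) (ν := μ)
      · simp only [if_true]; exact MeasurePreserving.id _
    rw [← hS.lintegral_comp hF, two_mul]
    nth_rw 1 [← hfst.lintegral_comp (hG ε)]
    rw [← hsnd.lintegral_comp (hG ε), ← lintegral_add_left (μ := ρ)
      (f := fun η : Fin N → X × X => ⨆ t, ‖∑ i, sgn (ε i) * h t (η i).1‖ₑ)
      ((hG ε).comp hfst.measurable)]
    refine lintegral_mono fun η => iSup_le fun t => ?_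
    have : ∑ i, (h t (if ε i then η i else (η i).swap).1 -
        h t (if ε i then η i else (η i).swap).2) =
        ∑ i, sgn (ε i) * h t (η i).1 - ∑ i, sgn (ε i) * h t (η i).2 := by
      rw [← Finset.sum_sub_distrib]
      refine Finset.sum_congr rfl fun i _ => ?_
      cases ε i
      · simp; ring
      · simp
    rw [this]
    exact (enorm_sub_le).trans (add_le_add
      (le_iSup (fun t => ‖∑ i, sgn (ε i) * h t (η i).1‖ₑ) t)
      (le_iSup (fun t => ‖∑ i, sgn (ε i) * h t (η i).2‖ₑ) t))
  calc _ ≤ 2 ^ N * ∫⁻ η, F η ∂ρ := by gcongr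
    _ = ∑ _ε : Fin N → Bool, ∫⁻ η, F η ∂ρ := by simp
    _ ≤ _ := by rw [Finset.mul_sum]; exact Finset.sum_le_sum fun ε _ => step3 ε

end Symmetrisation

/-- Subtracting φ(b) makes each summand vanish at x = 0, and it is LA-Lipschitz in w·x. Contraction
thus reduces it to the linear class x ↦ LA w·x, whose Rademacher average is of order
R·LA·(∑‖w_i‖²)^{1/2}. The constant 4 is 2 from symmetrisation times 2 from the absolute value. -/
theorem lintegral_iSup_neuron_le {d : ℕ} (μ : Measure (E d × ℝ)) [IsProbabilityMeasure μ]
    (hw : Integrable (fun θ => ‖θ.1‖ ^ 2) μ) {s : ℝ} (hs : 0 < s)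
    (hms : ∫ θ, ‖θ.1‖ ^ 2 ∂μ ≤ s ^ 2) {a : E d × ℝ → ℝ} (ha : Continuous a) {A : ℝ}
    (haA : ∀ θ, |a θ| ≤ A) {φ : ℝ → ℝ} {L : NNReal} (hL : LipschitzWith L φ) {T : Type*}
    [Countable T] {x : T → E d} {R : ℝ} (hR : 0 ≤ R) (hx : ∀ t, ‖x t‖ ≤ R) {N : ℕ} (hN : 1 ≤ N) :
    ∫⁻ θ, ⨆ t, ‖∑ i : Fin N, (a (θ i) * (φ (inner ℝ (θ i).1 (x t) + (θ i).2) - φ (θ i).2) -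
        ∫ θ, a θ * (φ (inner ℝ θ.1 (x t) + θ.2) - φ θ.2) ∂μ)‖ₑ ∂Measure.pi (fun _ => μ) ≤
      ENNReal.ofReal (4 * R * L * A * (√N * s)) := by
  have hA : 0 ≤ A := (abs_nonneg _).trans (haA 0)
  have hφ := hL.continuous
  have hφd (u v : ℝ) : |φ u - φ v| ≤ L * |u - v| := by
    simpa [Real.dist_eq] using hL.dist_le_mul u v
  have hcont (t : T) : Continuous
      fun θ : E d × ℝ => a θ * (φ (inner ℝ θ.1 (x t) + θ.2) - φ θ.2) := by fun_prop
  have hbd (t : T) (θ : E d × ℝ) : |a θ * (φ (inner ℝ θ.1 (x t) + θ.2) - φ θ.2)| ≤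
      A * (L * (‖θ.1‖ * R)) := by
    rw [abs_mul]
    gcongr
    · exact haA θ
    · refine (hφd _ _).trans ?_
      rw [add_sub_cancel_right]
      gcongr
      exact (abs_real_inner_le_norm _ _).trans (by gcongr; exact hx t)
  have hw1 : Integrable (fun θ : E d × ℝ => ‖θ.1‖) μ := by
    refine ((integrable_const (1 : ℝ)).add hw).mono' (by fun_prop) (ae_of_all _ fun θ => ?_)
    simp only [norm_norm, Pi.add_apply]
    nlinarith [sq_nonneg (‖θ.1‖ - 1), norm_nonneg θ.1]
  have hi (t : T) : Integrable
      (fun θ : E d × ℝ => a θ * (φ (inner ℝ θ.1 (x t) + θ.2) - φ θ.2)) μ :=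
    (((hw1.mul_const R).const_mul (L : ℝ)).const_mul A).mono'
      (hcont t).aestronglyMeasurable (ae_of_all _ (hbd t))
  have hsym := lintegral_iSup_centred_le μ (fun t => (hcont t).measurable) hi N
  set ν : Measure (Fin N → E d × ℝ) := Measure.pi (fun _ => μ)
  have hpt (θ : Fin N → E d × ℝ) : ∑ ε : Fin N → Bool, (⨆ t, ‖∑ i, sgn (ε i) *
      (a (θ i) * (φ (inner ℝ (θ i).1 (x t) + (θ i).2) - φ (θ i).2))‖ₑ) ≤
      ENNReal.ofReal (2 ^ N * (R * (L * A) * ((∑ i, ‖(θ i).1‖ ^ 2) / (√N * s) + √N * s))) := by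
    obtain ⟨U, hU0, hU, hsum⟩ := exists_signs_bound (s := Metric.closedBall (0 : E d) R) (R := R)
      (by simpa using hR) (by simp) (fun i => (L * A : ℝ) • (θ i).1)
      (c := fun i y => a (θ i) * (φ (inner ℝ (θ i).1 y + (θ i).2) - φ (θ i).2))
      (by simp) (by
        intro i y _ z _
        rw [← mul_sub, sub_sub_sub_cancel_right, abs_mul, real_inner_smul_left,
          real_inner_smul_left, ← mul_sub, abs_mul, abs_of_nonneg (mul_nonneg L.coe_nonneg hA)]
        calc _ ≤ A * (L * |inner ℝ (θ i).1 y + (θ i).2 - (inner ℝ (θ i).1 z + (θ i).2)|) :=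
              mul_le_mul (haA _) (hφd _ _) (abs_nonneg _) hA
          _ = _ := by rw [add_sub_add_right_eq_sub]; ring)
    calc _ ≤ ∑ ε : Fin N → Bool, ENNReal.ofReal (U ε) := by
          refine Finset.sum_le_sum fun ε _ => iSup_le fun t => ?_
          rw [Real.enorm_eq_ofReal_abs]
          exact ENNReal.ofReal_le_ofReal (hU ε _ (by simpa using hx t))
      _ = ENNReal.ofReal (∑ ε, U ε) := (ENNReal.ofReal_sum_of_nonneg fun ε _ => hU0 ε).symm
      _ ≤ _ := by
          refine ENNReal.ofReal_le_ofReal (hsum.trans ?_)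
          have hc : 0 < √N * s := by positivity
          have hG : 0 ≤ ∑ i, ‖(θ i).1‖ ^ 2 := by positivity
          have e : √(∑ i, ‖(L * A : ℝ) • (θ i).1‖ ^ 2) = (L * A) * √(∑ i, ‖(θ i).1‖ ^ 2) := by
            simp_rw [norm_smul, mul_pow]
            rw [← Finset.mul_sum, Real.sqrt_mul (by positivity), Real.sqrt_sq (by positivity),
              Real.norm_of_nonneg (by positivity)]
          -- AM-GM takes the place of Jensen's inequality: only ‖w‖² has to be integrated, and the
          -- weight √N s is optimal when its mean is s².
          have e2 : 2 * √(∑ i, ‖(θ i).1‖ ^ 2) ≤ (∑ i, ‖(θ i).1‖ ^ 2) / (√N * s) + √N * s := by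
            rw [div_add' _ _ _ hc.ne', le_div_iff₀ hc]
            nlinarith [sq_nonneg (√(∑ i, ‖(θ i).1‖ ^ 2) - √N * s), Real.sq_sqrt hG]
          rw [e]
          calc _ = 2 ^ N * (R * (L * A) * (2 * √(∑ i, ‖(θ i).1‖ ^ 2))) := by ring
            _ ≤ _ := by gcongr
  have hint (i : Fin N) : Integrable (fun θ : Fin N → E d × ℝ => ‖(θ i).1‖ ^ 2) ν :=
    (measurePreserving_eval (fun _ : Fin N => μ) i).integrable_comp_of_integrable hw
  have hval : ∫⁻ θ, ENNReal.ofReal (2 ^ N * (R * (L * A) * ((∑ i, ‖(θ i).1‖ ^ 2) / (√N * s) +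
      √N * s))) ∂ν ≤ ENNReal.ofReal (2 ^ N * (R * (L * A) * (2 * (√N * s)))) := by
    have hI : Integrable (fun θ : Fin N → E d × ℝ => (∑ i, ‖(θ i).1‖ ^ 2) / (√N * s) + √N * s) ν :=
      (((integrable_finsetSum Finset.univ fun i _ => hint i).div_const (√N * s)).add
      (integrable_const (√N * s)))
    rw [← ofReal_integral_eq_lintegral_ofReal ((hI.const_mul (R * (L * A))).const_mul (2 ^ N))
      (ae_of_all _ fun θ => by simp only [Pi.zero_apply]; positivity)]
    refine ENNReal.ofReal_le_ofReal ?_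
    rw [integral_const_mul, integral_const_mul, integral_add
      ((integrable_finsetSum Finset.univ fun i _ => hint i).div_const _) (integrable_const _),
      integral_div, integral_finsetSum _ fun i _ => hint i]
    have hone (i : Fin N) : ∫ θ, ‖(θ i).1‖ ^ 2 ∂ν = ∫ θ, ‖θ.1‖ ^ 2 ∂μ :=
      integral_comp_eval (μ := fun _ : Fin N => μ) (i := i) hw.aestronglyMeasurable
    simp only [hone, Finset.sum_const, Finset.card_univ, Fintype.card_fin, integral_const,
      probReal_univ, one_smul, nsmul_eq_mul]
    gcongr
    rw [two_mul]
    gcongr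
    have hc : 0 < √N * s := by positivity
    rw [div_le_iff₀ hc]
    calc (N : ℝ) * ∫ θ, ‖θ.1‖ ^ 2 ∂μ ≤ N * s ^ 2 := by gcongr
      _ = _ := by rw [mul_mul_mul_comm, Real.mul_self_sqrt (by positivity)]; ring
  have hGm (ε : Fin N → Bool) : Measurable fun θ : Fin N → E d × ℝ => ⨆ t, ‖∑ i, sgn (ε i) *
      (a (θ i) * (φ (inner ℝ (θ i).1 (x t) + (θ i).2) - φ (θ i).2))‖ₑ :=
    Measurable.iSup fun t => by
      have := (hcont t).measurable
      fun_prop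
  have hfin := hsym.trans (b := _) (c := 2 * ENNReal.ofReal (2 ^ N * (R * (L * A) * (2 * (√N * s)))))
    (by
      gcongr
      rw [← lintegral_finsetSum _ fun ε _ => hGm ε]
      exact (lintegral_mono hpt).trans hval)
  have h2 : (2 : ℝ≥0∞) * ENNReal.ofReal (2 ^ N * (R * (L * A) * (2 * (√N * s)))) =
      2 ^ N * ENNReal.ofReal (4 * R * L * A * (√N * s)) := by
    have : (2 : ℝ≥0∞) = ENNReal.ofReal 2 := by simp
    rw [this, ← ENNReal.ofReal_pow (by norm_num), ← ENNReal.ofReal_mul (by norm_num),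
      ← ENNReal.ofReal_mul (by positivity)]
    congr 1; ring
  rw [h2] at hfin
  exact (ENNReal.mul_le_mul_iff_right (by simp) (by simp)).1 hfin

/-! ### Second moments of the part independent of x. -/

section Variance

variable {d : ℕ} {S : ℝ} {𝒳 : Set (E d)} {χ : E d → ℝ} {φ : ℝ → ℝ} {L : NNReal}

/-- Continuity upgrades the essential bound to a pointwise one: the exceptional set is open and
null, hence empty. -/
theorem IsFiniteBandwidth.exists_le_pb {pw : E d → ℝ} {pb : ℝ → ℝ} (hp : IsFiniteBandwidth pw pb) :
    ∃ B, 0 ≤ B ∧ ∀ b, pb b ≤ B := by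
  obtain ⟨B, hB⟩ := exists_ae_norm_le_of_memLp_top hp.regular_b.bounded
  have hopen : IsOpen {b | B < pb b} :=
    isOpen_lt continuous_const hp.differentiable_b.continuous
  have hnull : volume {b | B < pb b} = 0 := by
    rw [← nonpos_iff_eq_zero, ← ae_iff.1 hB]
    refine measure_mono fun b (hb : B < pb b) => ?_
    exact not_le.2 (hb.trans_le (le_abs_self _))
  have hle (b : ℝ) : pb b ≤ B := by
    by_contra! h
    have : b ∈ {b | B < pb b} := h
    rw [hopen.eq_empty_of_measure_zero hnull] at this
    exact this
  exact ⟨B, (hp.regular_b.nonneg 0).trans (hle 0), hle⟩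

theorem integral_scaledLaw_comp_add_le {p : ℝ → ℝ} (hp : IsRegularDensity p) {B : ℝ}
    (hB : ∀ b, p b ≤ B) {ρ : ℝ → ℝ} (hρ : Integrable ρ) (hρ0 : ∀ s, 0 ≤ ρ s) (c : ℝ) {σ : ℝ}
    (hσ : 0 < σ) : ∫ b, ρ (c + b) ∂scaledLaw σ p ≤ σ⁻¹ * (B * ∫ s, ρ s) := by
  rw [integral_scaledLaw_real hσ hp, ← integral_add_left_eq_self ρ c, ← integral_const_mul B]
  gcongr ?_ * ?_
  exact integral_mono_of_nonneg (ae_of_all _ fun b => mul_nonneg (hp.nonneg _) (hρ0 _))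
    ((hρ.comp_add_left c).const_mul B)
    (ae_of_all _ fun b => mul_le_mul_of_nonneg_right (hB _) (hρ0 _))

/-- Second moments of the random neuron at the origin. -/
theorem exists_second_moment_le (hS : 0 < S) (hχ : IsMollifier S 𝒳 χ) (hL : LipschitzWith L φ)
    {pw : E d → ℝ} {pb : ℝ → ℝ} (hp : IsFiniteBandwidth pw pb) (ψ : 𝓢(ℝ, ℝ)) :
    ∃ C, 0 < C ∧ ∀ f : E d → ℝ, M1Star S f < ∞ → ∀ σw σb : ℝ, 0 < σw → 0 < σb →
      ∀ n : ℕ, 1 ≤ n →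
      MemLp (fun θ => gridCoefficient S χ n f ψ θ * φ θ.2) 2
        ((scaledLaw σw pw).prod (scaledLaw σb pb)) ∧
      ∫ θ, (gridCoefficient S χ n f ψ θ * φ θ.2) ^ 2
        ∂(scaledLaw σw pw).prod (scaledLaw σb pb) ≤ C * (M1Star S f).toReal ^ 2 * (1 + σw) ^ 2 ∧
      ∫ θ, (gridCoefficient S χ n f ψ θ * φ θ.2) ^ 2
        ∂(scaledLaw σw pw).prod (scaledLaw σb pb) ≤
          C * (M1Star S f).toReal ^ 2 * (1 + σw) ^ 2 * (1 / σb) := by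
  have hw := hp.regular_w
  have hb := hp.regular_b
  set R := √d * S
  have hR : 0 ≤ R := by positivity
  obtain ⟨c, hc0, hc⟩ := exists_one_add_abs_mul_le ψ
  obtain ⟨cw, hcw0, hcw⟩ := exists_integral_one_add_norm_sq_scaledLaw_le hw
  obtain ⟨B, hB0, hB⟩ := hp.exists_le_pb
  set A : ℝ := (|φ 0| + L) * (1 + 2 * R)
  have hA : 0 ≤ A := by positivity
  set ρ : ℝ → ℝ := fun s => (1 + |s|) * |ψ s|
  have hρ0 (s : ℝ) : 0 ≤ ρ s := by positivity
  have hρi : Integrable ρ := by simpa using integrable_one_add_abs_pow_mul ψ 1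
  have hψc := ψ.continuous
  have hρc : Continuous ρ := by fun_prop
  set Γ := ∫ s, ρ s
  have hΓ : 0 ≤ Γ := integral_nonneg hρ0
  set C1 := (A * ((2 * S) ^ d * c)) ^ 2 * cw
  set C2 := A * ((2 * S) ^ d * c) * A * cw * ((2 * S) ^ d * (B * Γ))
  have hC1 : 0 ≤ C1 := by positivity
  have hC2 : 0 ≤ C2 := by positivity
  refine ⟨C1 + C2 + 1, by positivity, ?_⟩
  intro f hM σw σb hσw hσb n hn
  have := isProbabilityMeasure_scaledLaw hσw hw
  have := isProbabilityMeasure_scaledLaw hσb hb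
  set μ := (scaledLaw σw pw).prod (scaledLaw σb pb)
  set M := (M1Star S f).toReal
  have hM0 : 0 ≤ M := ENNReal.toReal_nonneg
  set k : E d × ℝ → ℝ := fun θ => gridCoefficient S χ n f ψ θ * φ θ.2
  have hkc : Continuous k := by
    have := continuous_gridCoefficient (S := S) (χ := χ) (f := f) (ψ := ψ) n
    have := hL.continuous
    fun_prop
  -- The grid average of (1+|s|)|ψ(s)| at s = w·x_j+b. It is bounded uniformly, while its average
  -- over b is O(1/σ_b) because the density of b is O(1/σ_b).
  set r : E d → ℝ → ℝ := fun w b =>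
    ∑ j : Fin d → Fin n, (2 * S / n) ^ d * ρ (inner ℝ w (gridNode S n j) + b)
  have hr0 (w : E d) (b : ℝ) : 0 ≤ r w b :=
    Finset.sum_nonneg fun j _ => mul_nonneg (by positivity) (hρ0 _)
  have hrle (w : E d) (b : ℝ) : r w b ≤ (2 * S) ^ d * c := by
    rw [← sum_grid_const hn]
    exact Finset.sum_le_sum fun j _ => mul_le_mul_of_nonneg_left (hc _) (by positivity)
  have hk1 (θ : E d × ℝ) : |k θ| ≤ M * A * (1 + ‖θ.1‖) * r θ.1 θ.2 := by
    simp only [k, abs_mul]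
    calc _ ≤ (M * ∑ j : Fin d → Fin n, (2 * S / n) ^ d *
          |ψ (inner ℝ θ.1 (gridNode S n j) + θ.2)|) * ((|φ 0| + L) * (1 + |θ.2|)) :=
          mul_le_mul (abs_gridCoefficient_mul_le hS.le hχ hM n θ) (abs_le_of_lipschitz hL _)
            (abs_nonneg _) (by positivity)
      _ = ∑ j : Fin d → Fin n, M * (|φ 0| + L) * (2 * S / n) ^ d *
          |ψ (inner ℝ θ.1 (gridNode S n j) + θ.2)| * (1 + |θ.2|) := by
          rw [Finset.mul_sum, Finset.sum_mul]
          exact Finset.sum_congr rfl fun j _ => by ring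
      _ ≤ ∑ j : Fin d → Fin n, M * (|φ 0| + L) * (2 * S / n) ^ d *
          |ψ (inner ℝ θ.1 (gridNode S n j) + θ.2)| * ((1 + 2 * R) * (1 + ‖θ.1‖) *
          (1 + |inner ℝ θ.1 (gridNode S n j) + θ.2|)) := by
          gcongr with j
          exact one_add_abs_le (norm_le_of_mem_cube hS.le (gridNode_mem_cube hS.le hn j))
      _ = _ := by
          simp only [r, ρ, A]
          rw [Finset.mul_sum]
          exact Finset.sum_congr rfl fun j _ => by ring
  have hk2 (θ : E d × ℝ) : |k θ| ≤ M * (A * ((2 * S) ^ d * c)) * (1 + ‖θ.1‖) := by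
    refine (hk1 θ).trans ?_
    calc _ ≤ M * A * (1 + ‖θ.1‖) * ((2 * S) ^ d * c) := by gcongr; exact hrle _ _
      _ = _ := by ring
  have hsq : Integrable (fun θ : E d × ℝ => (1 + ‖θ.1‖) ^ 2) μ :=
    (integrable_one_add_norm_sq_scaledLaw hσw hw).comp_fst _
  have hksq1 (θ : E d × ℝ) : k θ ^ 2 ≤ (M * (A * ((2 * S) ^ d * c))) ^ 2 * (1 + ‖θ.1‖) ^ 2 := by
    rw [← sq_abs, ← mul_pow]
    exact pow_le_pow_left₀ (abs_nonneg _) (hk2 θ) 2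
  -- One factor |k| is bounded uniformly in b and the other keeps `r`; integrating `r` over b yields
  -- the gain 1/σ_b.
  have hksq2 (θ : E d × ℝ) : k θ ^ 2 ≤
      M ^ 2 * (A * ((2 * S) ^ d * c) * A) * ((1 + ‖θ.1‖) ^ 2 * r θ.1 θ.2) := by
    rw [← sq_abs, sq]
    calc _ ≤ (M * (A * ((2 * S) ^ d * c)) * (1 + ‖θ.1‖)) * (M * A * (1 + ‖θ.1‖) * r θ.1 θ.2) :=
          mul_le_mul (hk2 θ) (hk1 θ) (abs_nonneg _) (by positivity)
      _ = _ := by ring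
  have hk2i : Integrable (fun θ => k θ ^ 2) μ :=
    (hsq.const_mul _).mono' (hkc.pow 2).aestronglyMeasurable (ae_of_all _ fun θ => by
      rw [Real.norm_of_nonneg (sq_nonneg _)]; exact hksq1 θ)
  have hwi : ∫ θ : E d × ℝ, (1 + ‖θ.1‖) ^ 2 ∂μ ≤ cw * (1 + σw) ^ 2 := by
    refine le_trans (le_of_eq ?_) (hcw σw hσw)
    have h := integral_prod_mul (μ := scaledLaw σw pw) (ν := scaledLaw σb pb)
      (fun w : E d => (1 + ‖w‖) ^ 2) fun _ : ℝ => (1 : ℝ)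
    simpa using h
  have hM2 : 0 ≤ M ^ 2 * (1 + σw) ^ 2 := by positivity
  refine ⟨(memLp_two_iff_integrable_sq hkc.aestronglyMeasurable).2 hk2i, ?_, ?_⟩
  · calc ∫ θ, k θ ^ 2 ∂μ ≤ ∫ θ, (M * (A * ((2 * S) ^ d * c))) ^ 2 * (1 + ‖θ.1‖) ^ 2 ∂μ :=
          integral_mono hk2i (hsq.const_mul _) hksq1
      _ ≤ (M * (A * ((2 * S) ^ d * c))) ^ 2 * (cw * (1 + σw) ^ 2) := by
          rw [integral_const_mul]; gcongr
      _ = C1 * (M ^ 2 * (1 + σw) ^ 2) := by simp only [C1]; ring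
      _ ≤ (C1 + C2 + 1) * (M ^ 2 * (1 + σw) ^ 2) := by gcongr; linarith
      _ = _ := by ring
  · have hrc : Continuous (Function.uncurry r) := by
      simp only [r, Function.uncurry_def]; fun_prop
    have hdi : Integrable (fun θ : E d × ℝ => (1 + ‖θ.1‖) ^ 2 * r θ.1 θ.2) μ :=
      hsq.mul_bdd (c := (2 * S) ^ d * c) hrc.aestronglyMeasurable
        (ae_of_all _ fun θ => by rw [Real.norm_of_nonneg (hr0 _ _)]; exact hrle _ _)
    have hrint (w : E d) : ∫ b, r w b ∂scaledLaw σb pb ≤ (2 * S) ^ d * (B * Γ) * (1 / σb) := by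
      have hji (j : Fin d → Fin n) : Integrable
          (fun b => (2 * S / n) ^ d * ρ (inner ℝ w (gridNode S n j) + b)) (scaledLaw σb pb) :=
        (Integrable.of_bound (C := c) (by fun_prop) (ae_of_all _ fun b => by
          rw [Real.norm_of_nonneg (hρ0 _)]; exact hc _)).const_mul _
      simp only [r]
      rw [integral_finsetSum _ fun j _ => hji j, mul_assoc, ← sum_grid_const hn]
      refine Finset.sum_le_sum fun j _ => ?_
      rw [integral_const_mul]
      gcongr
      refine (integral_scaledLaw_comp_add_le hb hB hρi hρ0 _ hσb).trans_eq ?_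
      rw [one_div, mul_comm]
    calc ∫ θ, k θ ^ 2 ∂μ
        ≤ ∫ θ, M ^ 2 * (A * ((2 * S) ^ d * c) * A) * ((1 + ‖θ.1‖) ^ 2 * r θ.1 θ.2) ∂μ :=
          integral_mono hk2i (hdi.const_mul _) hksq2
      _ = M ^ 2 * (A * ((2 * S) ^ d * c) * A) *
          ∫ w, (1 + ‖w‖) ^ 2 * ∫ b, r w b ∂scaledLaw σb pb ∂scaledLaw σw pw := by
          rw [integral_const_mul, integral_prod _ hdi]
          simp only [integral_const_mul]
      _ ≤ M ^ 2 * (A * ((2 * S) ^ d * c) * A) *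
          ((cw * (1 + σw) ^ 2) * ((2 * S) ^ d * (B * Γ) * (1 / σb))) := by
          gcongr
          have hi2 := (integrable_one_add_norm_sq_scaledLaw hσw hw).mul_const
            ((2 * S) ^ d * (B * Γ) * (1 / σb))
          refine (integral_mono_of_nonneg (ae_of_all _ fun w => mul_nonneg (by positivity)
            (integral_nonneg (hr0 w))) hi2 (ae_of_all _ fun w =>
            mul_le_mul_of_nonneg_left (hrint w) (by positivity))).trans ?_
          rw [integral_mul_const]
          gcongr
          exact hcw σw hσw
      _ = C2 * (M ^ 2 * (1 + σw) ^ 2) * (1 / σb) := by simp only [C2]; ring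
      _ ≤ (C1 + C2 + 1) * (M ^ 2 * (1 + σw) ^ 2) * (1 / σb) := by gcongr; linarith
      _ = _ := by ring

end Variance

/-! ### Deviation probabilities. -/

section Tail

variable {d : ℕ}

theorem measure_le_abs_sum_sub_le {X : Type*} [MeasurableSpace X] (μ : Measure X)
    [IsProbabilityMeasure μ] {k : X → ℝ} (hk : MemLp k 2 μ) {v : ℝ} (hv : ∫ θ, k θ ^ 2 ∂μ ≤ v)
    (N : ℕ) {t : ℝ} (ht : 0 < t) :
    Measure.pi (fun _ : Fin N => μ) {θ | t ≤ |∑ i, (k (θ i) - ∫ y, k y ∂μ)|} ≤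
      ENNReal.ofReal (N * v / t ^ 2) := by
  set ν : Measure (Fin N → X) := Measure.pi fun _ => μ
  have hmp (i : Fin N) : MeasurePreserving (Function.eval i) ν μ :=
    measurePreserving_eval (fun _ : Fin N => μ) i
  have hki (i : Fin N) : MemLp (fun θ : Fin N → X => k (θ i)) 2 ν :=
    hk.comp_measurePreserving (hmp i)
  have hmean : ∫ θ, (∑ i, fun θ : Fin N → X => k (θ i)) θ ∂ν = ∑ _i : Fin N, ∫ y, k y ∂μ := by
    simp only [Finset.sum_apply]
    rw [integral_finsetSum _ fun i _ => (hki i).integrable one_le_two]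
    exact Finset.sum_congr rfl fun i _ =>
      integral_comp_eval (μ := fun _ : Fin N => μ) (i := i) hk.aestronglyMeasurable
  have hvar : Var[∑ i, fun θ : Fin N → X => k (θ i); ν] ≤ N * v := by
    rw [variance_sum_pi fun _ : Fin N => hk]
    calc ∑ _i : Fin N, Var[k; μ] ≤ ∑ _i : Fin N, v :=
          Finset.sum_le_sum fun i _ => (variance_le_expectation_sq hk.aestronglyMeasurable).trans hv
      _ = N * v := by simp
  have h := meas_ge_le_variance_div_sq (memLp_finsetSum' Finset.univ fun i _ => hki i) ht
  rw [hmean] at h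
  simp only [Finset.sum_apply, ← Finset.sum_sub_distrib] at h
  exact h.trans (ENNReal.ofReal_le_ofReal (by gcongr))

/-- A uniform deviation bound for random sums of neurons. -/
theorem measure_exists_lt_abs_sum_neuron_le (μ : Measure (E d × ℝ)) [IsProbabilityMeasure μ]
    (hw : Integrable (fun θ => ‖θ.1‖ ^ 2) μ) {s : ℝ} (hs : 0 < s)
    (hms : ∫ θ, ‖θ.1‖ ^ 2 ∂μ ≤ s ^ 2) {a : E d × ℝ → ℝ} (ha : Continuous a) {A : ℝ}
    (haA : ∀ θ, |a θ| ≤ A) {φ : ℝ → ℝ} {L : NNReal} (hL : LipschitzWith L φ) {T : Type*}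
    [Countable T] {x : T → E d} {R : ℝ} (hR : 0 ≤ R) (hx : ∀ t, ‖x t‖ ≤ R)
    (hk : MemLp (fun θ => a θ * φ θ.2) 2 μ) {v : ℝ} (hv : ∫ θ, (a θ * φ θ.2) ^ 2 ∂μ ≤ v)
    {N : ℕ} (hN : 1 ≤ N) {δ t₁ t₂ : ℝ} (hδ : 0 ≤ δ) (ht₁ : 0 < t₁) (ht₂ : 0 < t₂)
    (h₁ : 4 * R * L * A * (√N * s) ≤ δ / 2 * t₁) (h₂ : N * v ≤ δ / 2 * t₂ ^ 2) :
    Measure.pi (fun _ : Fin N => μ) {θ | ∃ t, t₁ + t₂ <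
      |∑ i, a (θ i) * φ (inner ℝ (θ i).1 (x t) + (θ i).2) -
        N * ∫ θ, a θ * φ (inner ℝ θ.1 (x t) + θ.2) ∂μ|} ≤ ENNReal.ofReal δ := by
  set ν : Measure (Fin N → E d × ℝ) := Measure.pi fun _ => μ
  set h : T → E d × ℝ → ℝ := fun t θ => a θ * (φ (inner ℝ θ.1 (x t) + θ.2) - φ θ.2)
  set k : E d × ℝ → ℝ := fun θ => a θ * φ θ.2
  have hA : 0 ≤ A := (abs_nonneg _).trans (haA 0)
  have hφ := hL.continuous
  have hhc (t : T) : Continuous (h t) := by fun_prop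
  have hhb (t : T) (θ : E d × ℝ) : ‖h t θ‖ ≤ A * L * R * (1 + ‖θ.1‖ ^ 2) := by
    have h1 : |φ (inner ℝ θ.1 (x t) + θ.2) - φ θ.2| ≤ L * |inner ℝ θ.1 (x t)| := by
      simpa [Real.dist_eq] using hL.dist_le_mul (inner ℝ θ.1 (x t) + θ.2) θ.2
    have h2 : |inner ℝ θ.1 (x t)| ≤ ‖θ.1‖ * R :=
      (abs_real_inner_le_norm _ _).trans (by gcongr; exact hx t)
    have h3 : ‖θ.1‖ ≤ 1 + ‖θ.1‖ ^ 2 := by nlinarith [sq_nonneg (‖θ.1‖ - 1), norm_nonneg θ.1]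
    rw [norm_mul, Real.norm_eq_abs, Real.norm_eq_abs]
    calc _ ≤ A * (L * ((1 + ‖θ.1‖ ^ 2) * R)) := by
          refine mul_le_mul (haA θ) (h1.trans ?_) (abs_nonneg _) hA
          gcongr
          exact h2.trans (by gcongr)
      _ = _ := by ring
  have hhi (t : T) : Integrable (h t) μ :=
    (((integrable_const 1).add hw).const_mul (A * L * R)).mono' (hhc t).aestronglyMeasurable
      (ae_of_all _ (hhb t))
  have hki : Integrable k μ := hk.integrable one_le_two
  set D : (Fin N → E d × ℝ) → ℝ≥0∞ := fun θ =>
    ⨆ t, ‖∑ i : Fin N, (h t (θ i) - ∫ y, h t y ∂μ)‖ₑ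
  have hD := lintegral_iSup_neuron_le μ hw hs hms ha haA hL hR hx hN
  have hDm : Measurable D := Measurable.iSup fun t => by
    have := (hhc t).measurable
    fun_prop
  -- Markov's inequality for the supremum; Chebyshev's inequality follows for the part independent
  -- of x. Each event receives half of δ.
  have hE1 : ν {θ | ENNReal.ofReal t₁ ≤ D θ} ≤ ENNReal.ofReal (δ / 2) := by
    refine (meas_ge_le_lintegral_div hDm.aemeasurable (by simpa using ht₁)
      ENNReal.ofReal_ne_top).trans ?_
    refine ENNReal.div_le_of_le_mul (hD.trans ?_)
    rw [← ENNReal.ofReal_mul (by positivity)]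
    exact ENNReal.ofReal_le_ofReal h₁
  have hE2 : ν {θ | t₂ ≤ |∑ i, (k (θ i) - ∫ y, k y ∂μ)|} ≤ ENNReal.ofReal (δ / 2) := by
    refine (measure_le_abs_sum_sub_le μ hk hv N ht₂).trans (ENNReal.ofReal_le_ofReal ?_)
    rwa [div_le_iff₀ (by positivity)]
  have hsub : {θ : Fin N → E d × ℝ | ∃ t, t₁ + t₂ <
      |∑ i, a (θ i) * φ (inner ℝ (θ i).1 (x t) + (θ i).2) -
        N * ∫ θ, a θ * φ (inner ℝ θ.1 (x t) + θ.2) ∂μ|} ⊆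
      {θ | ENNReal.ofReal t₁ ≤ D θ} ∪ {θ | t₂ ≤ |∑ i, (k (θ i) - ∫ y, k y ∂μ)|} := by
    rintro θ ⟨t, ht⟩
    by_contra hcon
    simp only [mem_union, mem_ofPred_eq, not_or, not_le] at hcon
    have h3 : |∑ i : Fin N, (h t (θ i) - ∫ y, h t y ∂μ)| < t₁ := by
      have := (le_iSup (fun t => ‖∑ i : Fin N, (h t (θ i) - ∫ y, h t y ∂μ)‖ₑ) t).trans_lt hcon.1
      rw [Real.enorm_eq_ofReal_abs] at this
      exact (ENNReal.ofReal_lt_ofReal_iff ht₁).1 this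
    have h4 : ∫ θ, a θ * φ (inner ℝ θ.1 (x t) + θ.2) ∂μ = (∫ y, h t y ∂μ) + ∫ y, k y ∂μ := by
      rw [← integral_add (hhi t) hki]
      congr 1; ext θ
      simp only [h, k]; ring
    have h5 : ∑ i, a (θ i) * φ (inner ℝ (θ i).1 (x t) + (θ i).2) -
        N * ∫ θ, a θ * φ (inner ℝ θ.1 (x t) + θ.2) ∂μ =
        (∑ i : Fin N, (h t (θ i) - ∫ y, h t y ∂μ)) + ∑ i, (k (θ i) - ∫ y, k y ∂μ) := by
      rw [h4, ← Finset.sum_add_distrib]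
      have h6 : (N : ℝ) * ((∫ y, h t y ∂μ) + ∫ y, k y ∂μ) =
          ∑ _i : Fin N, ((∫ y, h t y ∂μ) + ∫ y, k y ∂μ) := by simp [mul_add]
      rw [h6, ← Finset.sum_sub_distrib]
      exact Finset.sum_congr rfl fun i _ => by simp only [h, k]; ring
    rw [h5] at ht
    linarith [abs_add_le (∑ i : Fin N, (h t (θ i) - ∫ y, h t y ∂μ))
      (∑ i, (k (θ i) - ∫ y, k y ∂μ)), hcon.2]
  calc _ ≤ _ := measure_mono hsub
    _ ≤ ENNReal.ofReal (δ / 2) + ENNReal.ofReal (δ / 2) :=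
        (measure_union_le _ _).trans (add_le_add hE1 hE2)
    _ = _ := by rw [← ENNReal.ofReal_add (by positivity) (by positivity), add_halves]

end Tail

/-! ### Matching the fluctuation to the stated terms. -/

section Combination

variable {d : ℕ} {S : ℝ} {𝒳 : Set (E d)} {χ f : E d → ℝ} {φ : ℝ → ℝ} {φhat : ℝ → ℂ}
  {ψ : 𝓢(ℝ, ℝ)} {L : NNReal}

/-- Let Y be the last term of the error. If σ_w ≥ 1 then 1+σ_w ≤ 2σ_w, and the left side is at most
4Y². If σ_w < 1 this fails, but the gain 1/σ_b bounds the left side by 4Y/σ_w, a product of two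
admissible terms. -/
theorem fluctuation_le {N : ℕ} (hN : 1 ≤ N) {σw σb δ : ℝ} (hσw : 0 < σw) (hσb : 0 < σb)
    (hδ : 0 < δ) (hδ1 : δ ≤ 1) :
    (σw ^ d) ^ 2 * σb ^ 2 * ((1 + σw) ^ 2 * (if 1 ≤ σw then 1 else 1 / σb)) / (N * δ) ≤
      4 * (1 / σw + σb * σw ^ (d + 1) / (δ * √N)) ^ 2 := by
  have hN' : (1 : ℝ) ≤ N := by exact_mod_cast hN
  set r := √(N : ℝ)
  have hr : 1 ≤ r := Real.one_le_sqrt.2 hN'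
  have hr2 : (N : ℝ) = r ^ 2 := (Real.sq_sqrt (by positivity)).symm
  set Y := σb * σw ^ (d + 1) / (δ * r) with hY
  have hY0 : 0 < Y := by positivity
  have hσi : 0 < 1 / σw := by positivity
  rw [hr2]
  split_ifs with h
  · calc _ ≤ (σw ^ d) ^ 2 * σb ^ 2 * ((2 * σw) ^ 2 * 1) / (r ^ 2 * δ ^ 2) := by
          gcongr
          · linarith
          · nlinarith
      _ = 4 * Y ^ 2 := by rw [hY, pow_succ]; field_simp; ring
      _ ≤ _ := by gcongr; linarith
  · have hd1 : σw ^ d ≤ 1 := pow_le_one₀ hσw.le (not_le.1 h).le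
    calc _ ≤ (σw ^ d * 1) * σb ^ 2 * (2 ^ 2 * (1 / σb)) / (r * δ) := by
          rw [sq (σw ^ d)]
          gcongr
          · linarith
          · nlinarith
      _ = 4 * (1 / σw * Y) := by rw [hY, pow_succ]; field_simp; ring
      _ ≤ _ := by gcongr; nlinarith

theorem ridgeletOperator_eq (pw : E d → ℝ) (pb : ℝ → ℝ) (σw σb : ℝ) (n N : ℕ)
    (θ : Fin N → E d × ℝ) (x : E d) : ridgeletOperator S χ φ ψ pw pb σw σb n N θ f x =
      totalMass pw pb σw σb / N *
        ∑ i, gridCoefficient S χ n f ψ (θ i) * φ (inner ℝ (θ i).1 x + (θ i).2) := by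
  rw [ridgeletOperator, discretised, Finset.mul_sum]
  refine Finset.sum_congr rfl fun i _ => ?_
  rw [gridCoefficient, div_eq_mul_inv, mul_assoc]

theorem continuous_ridgeletOperator (hφ : Continuous φ) (pw : E d → ℝ) (pb : ℝ → ℝ)
    (σw σb : ℝ) (n N : ℕ) (θ : Fin N → E d × ℝ) :
    Continuous (ridgeletOperator S χ φ ψ pw pb σw σb n N θ f) := by
  simp_rw [funext (ridgeletOperator_eq (S := S) (χ := χ) (φ := φ) (ψ := ψ) (f := f) pw pb σw σb n N θ)]
  fun_prop

theorem integrable_norm_sq_fst {pw : E d → ℝ} {pb : ℝ → ℝ} (hw : IsRegularDensity pw)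
    (hb : IsRegularDensity pb) {σw σb : ℝ} (hσw : 0 < σw) (hσb : 0 < σb) :
    Integrable (fun θ : E d × ℝ => ‖θ.1‖ ^ 2) ((scaledLaw σw pw).prod (scaledLaw σb pb)) ∧
    ∫ θ : E d × ℝ, ‖θ.1‖ ^ 2 ∂(scaledLaw σw pw).prod (scaledLaw σb pb) =
      σw ^ 2 * ∫ x, ‖x‖ ^ 2 * pw x := by
  have := isProbabilityMeasure_scaledLaw hσw hw
  have := isProbabilityMeasure_scaledLaw hσb hb
  refine ⟨(integrable_norm_sq_scaledLaw hσw hw).comp_fst _, ?_⟩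
  rw [← integral_norm_sq_scaledLaw hσw hw]
  have h := integral_prod_mul (μ := scaledLaw σw pw) (ν := scaledLaw σb pb)
    (fun w : E d => ‖w‖ ^ 2) fun _ : ℝ => (1 : ℝ)
  simpa using h

/-- The deviation of the discretised ridgelet operator from its mean, on a countable set. -/
theorem exists_deviation_bound (hd : 1 ≤ d) (hS : 0 < S) (hχ : IsMollifier S 𝒳 χ)
    (hL : LipschitzWith L φ) {pw : E d → ℝ} {pb : ℝ → ℝ} (hp : IsFiniteBandwidth pw pb)
    (ψ : 𝓢(ℝ, ℝ)) :
    ∃ C, 0 ≤ C ∧ ∀ f : E d → ℝ, M1Star S f < ∞ → 0 < (M1Star S f).toReal →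
      ∀ σw σb : ℝ, 0 < σw → 0 < σb → ∀ δ : ℝ, 0 < δ → δ ≤ 1 → ∀ n N : ℕ, 1 ≤ n → 1 ≤ N →
      ∀ t : Set (E d), t.Countable → t ⊆ cube d S →
      Measure.pi (fun _ : Fin N => (scaledLaw σw pw).prod (scaledLaw σb pb)) {θ | ∃ x : t,
        C * (M1Star S f).toReal * (1 / σw + σb * σw ^ (d + 1) / (δ * √N)) <
        |ridgeletOperator S χ φ ψ pw pb σw σb n N θ f x - totalMass pw pb σw σb *
          ∫ θ, gridCoefficient S χ n f ψ θ * φ (inner ℝ θ.1 (x : E d) + θ.2)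
            ∂(scaledLaw σw pw).prod (scaledLaw σb pb)|} ≤ ENNReal.ofReal δ := by
  have hw := hp.regular_w
  have hb := hp.regular_b
  set R := √d * S
  have hR : 0 < R := mul_pos (Real.sqrt_pos.2 (by exact_mod_cast hd)) hS
  obtain ⟨c0, hc0, hψ0⟩ := exists_abs_le_schwartz ψ
  obtain ⟨C0, hC0, hvar⟩ := exists_second_moment_le hS hχ hL hp ψ
  set m2 := ∫ x, ‖x‖ ^ 2 * pw x
  have hm2 : 0 ≤ m2 := integral_nonneg fun x => mul_nonneg (by positivity) (hw.nonneg x)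
  set m := √(m2 + 1)
  have hm : 0 < m := Real.sqrt_pos.2 (by positivity)
  set Z1 := totalMass pw pb 1 1
  have hZ1 : 0 < Z1 := totalMass_pos hp one_pos one_pos
  set K1 := 8 * R * (L + 1) * ((2 * S) ^ d * c0) * m
  have hK1 : 0 < K1 := by positivity
  refine ⟨Z1 * (K1 + √(8 * C0)), by positivity, ?_⟩
  intro f hM hMpos σw σb hσw hσb δ hδ hδ1 n N hn hN t htc htS
  have := isProbabilityMeasure_scaledLaw hσw hw
  have := isProbabilityMeasure_scaledLaw hσb hb
  have : Countable t := htc.to_subtype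
  have hN' : (0 : ℝ) < N := by exact_mod_cast hN
  set μ := (scaledLaw σw pw).prod (scaledLaw σb pb)
  set M := (M1Star S f).toReal
  -- Selects which of the two second moment bounds is used, as in `fluctuation_le`.
  set q : ℝ := if 1 ≤ σw then 1 else 1 / σb
  have hq : 0 < q := by simp only [q]; split_ifs <;> positivity
  set v := C0 * M ^ 2 * (1 + σw) ^ 2 * q
  have hv : 0 < v := by positivity
  set r := √(N : ℝ)
  have hr : 0 < r := Real.sqrt_pos.2 hN'
  have hr2 : (N : ℝ) = r ^ 2 := (Real.sq_sqrt hN'.le).symm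
  set Y := σb * σw ^ (d + 1) / (δ * r)
  have hY : 0 < Y := by positivity
  -- Both thresholds solve the conditions h₁ and h₂ of the deviation bound. Writing L+1 for L, and
  -- adding 1 under the root in `m`, keeps `t₁` positive in degenerate cases.
  set t₁ := 8 * R * (L + 1) * (M * ((2 * S) ^ d * c0)) * (r * (σw * m)) / δ
  set t₂ := √(2 * N * v / δ)
  have ht₁ : 0 < t₁ := by positivity
  have ht₂ : 0 < t₂ := Real.sqrt_pos.2 (by positivity)
  obtain ⟨hk, hv1, hv2⟩ := hvar f hM σw σb hσw hσb n hn
  obtain ⟨hwi, hwm⟩ := integrable_norm_sq_fst hw hb hσw hσb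
  have hkv : ∫ θ, (gridCoefficient S χ n f ψ θ * φ θ.2) ^ 2 ∂μ ≤ v := by
    simp only [v, q]
    split_ifs
    · rw [mul_one]; exact hv1
    · exact hv2
  have key := measure_exists_lt_abs_sum_neuron_le μ hwi (s := σw * m) (by positivity)
    (by
      rw [hwm, mul_pow, Real.sq_sqrt (by positivity)]
      gcongr; linarith)
    (continuous_gridCoefficient n) (abs_gridCoefficient_le hS.le hχ hM hn hψ0) hL
    (x := fun y : t => (y : E d)) hR.le (fun y => norm_le_of_mem_cube hS.le (htS y.2)) hk hkv hN
    hδ.le ht₁ ht₂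
    (by
      have e : δ / 2 * t₁ = 4 * R * (L + 1) * (M * ((2 * S) ^ d * c0)) * (r * (σw * m)) := by
        simp only [t₁]; field_simp; ring
      rw [e]
      gcongr; linarith)
    (by
      rw [Real.sq_sqrt (by positivity)]
      exact le_of_eq (by field_simp))
  refine (measure_mono ?_).trans key
  rintro θ ⟨x, hx⟩
  refine ⟨x, ?_⟩
  set I := ∫ θ, gridCoefficient S χ n f ψ θ * φ (inner ℝ θ.1 (x : E d) + θ.2) ∂μ
  have hZ : totalMass pw pb σw σb = Z1 * (σw ^ d * σb) := totalMass_eq pw pb σw σb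
  set Z := totalMass pw pb σw σb
  have hZ0 : 0 < Z := totalMass_pos hp hσw hσb
  set sm := ∑ i, gridCoefficient S χ n f ψ (θ i) * φ (inner ℝ (θ i).1 (x : E d) + (θ i).2)
  have e : ridgeletOperator S χ φ ψ pw pb σw σb n N θ f x - Z * I = Z / N * (sm - N * I) := by
    rw [ridgeletOperator_eq]
    change Z / N * sm - Z * I = _
    field_simp
  rw [e, abs_mul, abs_of_pos (by positivity)] at hx
  have h1 : Z / N * t₁ = Z1 * K1 * M * Y := by
    rw [hZ, hr2]
    simp only [t₁, K1, Y, pow_succ σw]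
    field_simp
  have h2 : Z / N * t₂ ≤ Z1 * √(8 * C0) * M * (1 / σw + Y) := by
    have hfl := fluctuation_le (d := d) hN hσw hσb hδ hδ1
    have h3 : σw ^ d * σb / N * t₂ ≤ √(8 * C0) * M * (1 / σw + Y) := by
      refine (pow_le_pow_iff_left₀ (by positivity) (by positivity) two_ne_zero).1 ?_
      rw [mul_pow, mul_pow, mul_pow, Real.sq_sqrt (by positivity), Real.sq_sqrt (by positivity)]
      calc _ = 2 * C0 * M ^ 2 *
            ((σw ^ d) ^ 2 * σb ^ 2 * ((1 + σw) ^ 2 * q) / (N * δ)) := by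
            simp only [v]; field_simp
        _ ≤ 2 * C0 * M ^ 2 * (4 * (1 / σw + Y) ^ 2) := by gcongr
        _ = _ := by ring
    calc Z / N * t₂ = Z1 * (σw ^ d * σb / N * t₂) := by rw [hZ]; ring
      _ ≤ Z1 * (√(8 * C0) * M * (1 / σw + Y)) := by gcongr
      _ = _ := by ring
  have h4 : Z1 * K1 * M * Y ≤ Z1 * K1 * M * (1 / σw + Y) := by
    gcongr
    exact le_add_of_nonneg_left (by positivity)
  have h5 : Z / N * (t₁ + t₂) < Z / N * |sm - N * I| := by
    refine lt_of_le_of_lt ?_ hx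
    rw [mul_add, h1]
    calc _ ≤ Z1 * K1 * M * (1 / σw + Y) + Z1 * √(8 * C0) * M * (1 / σw + Y) := add_le_add h4 h2
      _ = _ := by ring
  exact lt_of_mul_lt_mul_left h5 (by positivity)

end Combination

end Ridgelet

end

/-! ### Assembly of the theorem. -/

theorem mainTheorem6 (d : ℕ) (hd : 1 ≤ d)
    (S : ℝ) (hS : 0 < S)
    (𝒳 : Set (Ridgelet.E d)) (h𝒳 : IsCompact 𝒳) (h𝒳S : 𝒳 ⊆ interior (Ridgelet.cube d S))
    (χ : Ridgelet.E d → ℝ) (hχ : Ridgelet.IsMollifier S 𝒳 χ)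
    (φ : ℝ → ℝ) (φhat : ℝ → ℂ) (ψ : 𝓢(ℝ, ℝ)) (hφψ : Ridgelet.IsRidgeletPair d φ φhat ψ)
    (L : NNReal) (hL : LipschitzWith L φ)
    (pw : Ridgelet.E d → ℝ) (pb : ℝ → ℝ) (hp : Ridgelet.IsFiniteBandwidth pw pb) :
    ∃ C : ℝ, ∀ f : Ridgelet.E d → ℝ, ContDiff ℝ 1 f → Ridgelet.M1Star S f < ∞ →
      ∀ σw σb : ℝ, 0 < σw → 0 < σb → ∀ δ : ℝ, 0 < δ →
      ∀ D n N : ℕ, 1 ≤ n → D = n ^ d → 1 ≤ N →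
      ∀ (Ω : Type*) [MeasurableSpace Ω] (P : Measure Ω) [IsProbabilityMeasure P]
        (θ : Fin N → Ω → Ridgelet.E d × ℝ),
        iIndepFun θ P →
        (∀ i, HasLaw (θ i) ((Ridgelet.scaledLaw σw pw).prod (Ridgelet.scaledLaw σb pb)) P) →
        ENNReal.ofReal (1 - δ) ≤ P {ω | ∀ x ∈ 𝒳,
          |f x - Ridgelet.ridgeletOperator S χ φ ψ pw pb σw σb n N (fun i => θ i ω) f x| ≤
            C * (Ridgelet.M1Star S f).toReal *
              (1 / σw + σw ^ d * (σw + 1) ^ 2 / σb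
                + σb * (σb + 1) * σw ^ d * (σw + 1) ^ 2 / (D : ℝ) ^ (1 / (d : ℝ))
                + σb * σw ^ (d + 1) / (δ * Real.sqrt N))} := by
  open Ridgelet in
  obtain ⟨C1, hC1, hmean⟩ := exists_mean_bound hS hχ hφψ hL hp
  obtain ⟨C2, hC2, hdev⟩ := exists_deviation_bound hd hS hχ hL hp ψ
  refine ⟨C1 + C2, ?_⟩
  intro f hf hM σw σb hσw hσb δ hδ D n N hn hD hN Ω _ P _ θ hind hlaw
  have := isProbabilityMeasure_scaledLaw hσw hp.regular_w
  have := isProbabilityMeasure_scaledLaw hσb hp.regular_b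
  rcases lt_or_ge 1 δ with hδ1 | hδ1
  · rw [ENNReal.ofReal_of_nonpos (by linarith)]
    exact zero_le
  have hDn : (D : ℝ) ^ (1 / (d : ℝ)) = n := by
    rw [hD, Nat.cast_pow, one_div]
    exact Real.pow_rpow_inv_natCast (Nat.cast_nonneg n) (by omega)
  rw [hDn]
  have hn' : (0 : ℝ) < n := by exact_mod_cast hn
  have hN' : (0 : ℝ) < N := by exact_mod_cast hN
  have hcube : 𝒳 ⊆ cube d S := h𝒳S.trans interior_subset
  -- If M = 0 then f vanishes on the cube, hence at all nodes, and both sides are 0. The deviation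
  -- bound needs M > 0 for positive thresholds.
  rcases (ENNReal.toReal_nonneg (a := M1Star S f)).eq_or_lt' with hM0 | hMpos
  · have hf0 (x) (hx : x ∈ cube d S) : f x = 0 :=
      abs_nonpos_iff.1 (hM0 ▸ abs_le_M1Star hM hx)
    have huniv : {ω | ∀ x ∈ 𝒳, |f x - ridgeletOperator S χ φ ψ pw pb σw σb n N
        (fun i => θ i ω) f x| ≤ (C1 + C2) * (M1Star S f).toReal *
          (1 / σw + σw ^ d * (σw + 1) ^ 2 / σb + σb * (σb + 1) * σw ^ d * (σw + 1) ^ 2 / n +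
            σb * σw ^ (d + 1) / (δ * Real.sqrt N))} = Set.univ := by
      refine Set.eq_univ_of_forall fun ω x hx => ?_
      have hg (ϑ : E d × ℝ) : gridCoefficient S χ n f ψ ϑ = 0 :=
        Finset.sum_eq_zero fun j _ => by rw [hf0 _ (gridNode_mem_cube hS.le hn j)]; ring
      rw [ridgeletOperator_eq, hM0, hf0 x (hcube hx)]
      simp [hg]
    rw [huniv, measure_univ, ENNReal.ofReal_le_one]
    linarith
  set μ := (scaledLaw σw pw).prod (scaledLaw σb pb)
  set M := (M1Star S f).toReal
  -- Countability makes the bad event measurable; the estimate is a closed condition in x, so it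
  -- passes to the closure of `t`, which contains 𝒳.
  obtain ⟨t, ht𝒳, htc, htd⟩ := h𝒳.isSeparable.exists_countable_dense_subset
  have : Countable t := htc.to_subtype
  have hφ := hL.continuous
  have hbad := hdev f hM hMpos σw σb hσw hσb δ hδ hδ1 n N hn hN t htc (ht𝒳.trans hcube)
  set Bad : Set (Fin N → E d × ℝ) := {θ | ∃ x : t,
        C2 * M * (1 / σw + σb * σw ^ (d + 1) / (δ * √N)) <
        |ridgeletOperator S χ φ ψ pw pb σw σb n N θ f x - totalMass pw pb σw σb *
          ∫ θ, gridCoefficient S χ n f ψ θ * φ (inner ℝ θ.1 (x : E d) + θ.2) ∂μ|} with hBad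
  have hmeas : MeasurableSet Bad := by
    rw [hBad, Set.ofPred_exists]
    refine MeasurableSet.iUnion fun x => measurableSet_lt measurable_const ?_
    simp only [ridgeletOperator_eq]
    have := continuous_gridCoefficient (S := S) (χ := χ) (f := f) (ψ := ψ) n
    exact (by fun_prop : Continuous _).measurable
  -- Independence and the common law identify the joint law, so the bound on the product space
  -- transfers to P.
  have hmap : P.map (fun ω i => θ i ω) = Measure.pi fun _ : Fin N => μ := by
    rw [hind.map_fun_eq_pi_map fun i => (hlaw i).aemeasurable]
    exact congrArg _ (funext fun i => (hlaw i).map_eq)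
  have hae : AEMeasurable (fun ω i => θ i ω) P :=
    aemeasurable_pi_lambda _ fun i => (hlaw i).aemeasurable
  calc ENNReal.ofReal (1 - δ) = 1 - ENNReal.ofReal δ := by
        rw [ENNReal.ofReal_sub _ hδ.le, ENNReal.ofReal_one]
    _ ≤ 1 - Measure.pi (fun _ : Fin N => μ) Bad := tsub_le_tsub_left hbad 1
    _ = Measure.pi (fun _ : Fin N => μ) Badᶜ := (prob_compl_eq_one_sub hmeas).symm
    _ = P ((fun ω i => θ i ω) ⁻¹' Badᶜ) := by
        rw [← hmap, Measure.map_apply_of_aemeasurable hae hmeas.compl]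
    _ ≤ _ := measure_mono ?_
  intro ω hω x hx
  have hgood (y : E d) (hy : y ∈ t) : |ridgeletOperator S χ φ ψ pw pb σw σb n N
      (fun i => θ i ω) f y - totalMass pw pb σw σb *
        ∫ θ, gridCoefficient S χ n f ψ θ * φ (inner ℝ θ.1 y + θ.2) ∂μ| ≤
      C2 * M * (1 / σw + σb * σw ^ (d + 1) / (δ * √N)) := by
    by_contra! h
    exact hω ⟨⟨y, hy⟩, h⟩
  have hclosed : IsClosed {x | |f x - ridgeletOperator S χ φ ψ pw pb σw σb n N
      (fun i => θ i ω) f x| ≤ (C1 + C2) * M *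
        (1 / σw + σw ^ d * (σw + 1) ^ 2 / σb + σb * (σb + 1) * σw ^ d * (σw + 1) ^ 2 / n +
          σb * σw ^ (d + 1) / (δ * √N))} :=
    isClosed_le (hf.continuous.sub (continuous_ridgeletOperator hφ pw pb σw σb n N _)).abs
      continuous_const
  refine closure_minimal (fun y hy => ?_) hclosed (htd hx)
  have h1 := hmean f hf hM y (hcube (ht𝒳 hy)) σw σb hσw hσb n hn
  rw [hχ.eq_one y (ht𝒳 hy), one_mul] at h1
  have h2 := hgood y hy
  rw [abs_sub_comm] at h1 h2
  refine (abs_sub_le _ _ _).trans ((add_le_add h1 h2).trans ?_)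
  set T1 := 1 / σw
  set T2 := σw ^ d * (σw + 1) ^ 2 / σb
  set T3 := σb * (σb + 1) * σw ^ d * (σw + 1) ^ 2 / n
  set T4 := σb * σw ^ (d + 1) / (δ * √N)
  have hT2 : 0 ≤ T2 := by positivity
  have hT3 : 0 ≤ T3 := by positivity
  have hT4 : 0 ≤ T4 := by positivity
  calc _ ≤ C1 * M * (T1 + T2 + T3 + T4) + C2 * M * (T1 + T2 + T3 + T4) := by
        exact add_le_add (mul_le_mul_of_nonneg_left (by linarith) (by positivity))
          (mul_le_mul_of_nonneg_left (by linarith) (by positivity))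
    _ = _ := by ring
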